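/- Let $(\varepsilon_n)_{n\in\mathbb{Z}}$ be independent identically distributed random variables with $E\varepsilon_0=0$ such that $l(x)=E\,\varepsilon_0^2 I(|\varepsilon_0|\le x)$ is slowly varying at infinity. (A function $h$ is slowly varying at infinity if it is positive and measurable on $[x_0,\infty)$ for some $x_0>0$ and $h(\lambda x)/h(x)\to1$ as $x\to\infty$ for every $\lambda>0$.) Let $(a_i)_{i\ge0}$ be real numbers with $a_n=n^{-\alpha}L(n)$ for $n\ge1$, where $1/2<\alpha<1$ and $L(n)=h(n)$ for some slowly varying function $h$. Put $$X_k=\sum_{i\ge0}a_i\varepsilon_{k-i},\qquad S_m=\sum_{i=1}^m X_i,\qquad A^2=\sum_{i\ge0}a_i^2,$$ $$b=\inf\{x\ge1:l(x)>0\},\qquad \eta_n=\inf\{s\ge b+1: l(s)/s^2\le 1/n\},\qquad l_n=l(\eta_n),$$ $$c_\alpha=\frac1{(1-\alpha)^2}\int_0^\infty\bigl[x^{1-\alpha}-\max(x-1,0)^{1-\alpha}\bigr]^2dx .$$ The series defining $X_k$ converges almost surely (as a limit of partial sums), $A^2<\infty$, and, as $n\to\infty$, $$\frac1{n l_n}\sum_{i=1}^nX_i^2\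 \to\ A^2\quad\text{in probability.}$$ Consequently, on the space $D[0,1]$ of right-continuous functions with left limits, with the Skorohod ($J_1$) topology, $$\frac{S_{[nt]}}{n a_n\bigl(\sum_{i=1}^nX_i^2\bigr)^{1/2}}\ \Rightarrow\ \frac{\sqrt{c_\alpha}}{A}\,W_H(t),\qquad H=\tfrac32-\alpha,$$ where $\Rightarrow$ is weak convergence and $W_H$ is fractional Brownian motion with Hurst index $H$: the centered continuous Gaussian process with covariance $\frac12\bigl(s^{2H}+t^{2H}-|t-s|^{2H}\bigr)$. In particular ($t=1$), $$\frac{S_n}{n a_n\bigl(\sum_{i=1}^nX_i^2\bigr)^{1/2}}\ \Rightarrow\ N\!\left(0,\frac{c_\alpha}{A^2}\right).$$ -/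

import Mathlib

open MeasureTheory ProbabilityTheory Filter Topology
open scoped ENNReal NNReal unitInterval

/-! ### Slowly varying functions -/

/-- `h` is slowly varying at infinity: for some `A > 0` it is positive and measurable on `[A, ∞)`,
and `h (c x) / h x → 1` as `x → ∞`, for every `c > 0`. -/
def IsSlowlyVarying (h : ℝ → ℝ) : Prop :=
  (∃ A : ℝ, 0 < A ∧ (∀ x, A ≤ x → 0 < h x) ∧ Measurable (fun x : Set.Ici A => h x)) ∧
    ∀ c : ℝ, 0 < c → Tendsto (fun x => h (c * x) / h x) atTop (𝓝 1)

/-- A sequence is slowly varying in the strong sense if it is the restriction to the positive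
integers of a slowly varying function. -/
def IsStronglySlowlyVaryingSeq (L : ℕ → ℝ) : Prop :=
  ∃ h : ℝ → ℝ, IsSlowlyVarying h ∧ ∀ n : ℕ, 1 ≤ n → L n = h n

/-! ### The innovations and the normalizing constants -/

section Innovations

variable {Ω : Type*} [MeasurableSpace Ω]

/-- The truncated second moment `l(x) = E ξ² 1(|ξ| ≤ x)`. -/
noncomputable def truncSecondMoment (ξ : Ω → ℝ) (P : Measure Ω) (x : ℝ) : ℝ :=
  ∫ ω, {ω | |ξ ω| ≤ x}.indicator (fun ω => ξ ω ^ 2) ω ∂P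

/-- `b = inf {x ≥ 1 : l(x) > 0}`. -/
noncomputable def truncStart (l : ℝ → ℝ) : ℝ := sInf {x : ℝ | 1 ≤ x ∧ 0 < l x}

/-- `η_j = inf {s ≥ b + 1 : l(s) / s² ≤ 1 / j}`. -/
noncomputable def truncLevel (l : ℝ → ℝ) (j : ℕ) : ℝ :=
  sInf {s : ℝ | truncStart l + 1 ≤ s ∧ l s / s ^ 2 ≤ 1 / (j : ℝ)}

/-- `l_n = l(η_n)`. -/
noncomputable def truncVar (l : ℝ → ℝ) (n : ℕ) : ℝ := l (truncLevel l n)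

/-- The innovations are independent and identically distributed, centered, and in the domain of
attraction of a normal law (their truncated second moment is slowly varying). -/
structure IsCenteredDANInnovation (ε : ℤ → Ω → ℝ) (P : Measure Ω) : Prop where
  measurable : ∀ i, Measurable (ε i)
  indep : iIndepFun ε P
  identDistrib : ∀ i, IdentDistrib (ε i) (ε 0) P P
  integrable : Integrable (ε 0) P
  centered : ∫ ω, ε 0 ω ∂P = 0
  slowlyVarying : IsSlowlyVarying (truncSecondMoment (ε 0) P)

/-- The partial sum `∑_{i < N} a_i ε_{k-i}` of the series defining `X_k`. -/
def linearProcessPartial (a : ℕ → ℝ) (ε : ℤ → Ω → ℝ) (k : ℤ) (N : ℕ) (ω : Ω) : ℝ :=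
  ∑ i ∈ Finset.range N, a i * ε (k - i) ω

/-- The causal linear process `X_k = ∑_{i ≥ 0} a_i ε_{k-i}`. The series is a limit of partial sums,
as it need not converge absolutely; the value where the limit does not exist is immaterial. -/
noncomputable def linearProcess (a : ℕ → ℝ) (ε : ℤ → Ω → ℝ) (k : ℤ) (ω : Ω) : ℝ :=
  limUnder atTop (fun N => linearProcessPartial a ε k N ω)

/-- `S_m = X_1 + ⋯ + X_m`. -/
noncomputable def linearSum (a : ℕ → ℝ) (ε : ℤ → Ω → ℝ) (m : ℕ) (ω : Ω) : ℝ :=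
  ∑ i ∈ Finset.Icc 1 m, linearProcess a ε (i : ℤ) ω

/-- `X_1² + ⋯ + X_n²`. -/
noncomputable def linearSqSum (a : ℕ → ℝ) (ε : ℤ → Ω → ℝ) (n : ℕ) (ω : Ω) : ℝ :=
  ∑ i ∈ Finset.Icc 1 n, linearProcess a ε (i : ℤ) ω ^ 2

end Innovations

/-- `c_α = (1 - α)⁻² ∫_0^∞ [x^{1-α} - max(x-1,0)^{1-α}]² dx`. -/
noncomputable def cAlpha (α : ℝ) : ℝ :=
  (∫ x in Set.Ioi (0 : ℝ), (x ^ (1 - α) - (max (x - 1) 0) ^ (1 - α)) ^ 2) / (1 - α) ^ 2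

/-! ### The space `D[0,1]` with the Skorokhod topology -/

/-- `D[0,1]`: real functions on `[0,1]` which are right-continuous and have left limits. -/
structure SkorokhodD where
  /-- the underlying function -/
  toFun : I → ℝ
  rightCont : ∀ t, ContinuousWithinAt toFun (Set.Ici t) t
  leftLim : ∀ t, ∃ y, Tendsto toFun (𝓝[<] t) (𝓝 y)

namespace SkorokhodD

instance : CoeFun SkorokhodD (fun _ => I → ℝ) := ⟨SkorokhodD.toFun⟩

/-- Multiplication of a càdlàg function by a constant. -/
noncomputable instance : SMul ℝ SkorokhodD where
  smul c f :=
    { toFun := fun t => c * f t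
      rightCont := fun t => (f.rightCont t).const_mul c
      leftLim := fun t => (f.leftLim t).imp' (fun y => c * y) fun _ h => h.const_mul c }

/-- The cost of the time change `e` (an increasing bijection of `[0,1]`, automatically a
homeomorphism): the larger of `sup_t |e t - t|` and `sup_t |f t - g (e t)|`. -/
noncomputable def cost (f g : SkorokhodD) (e : I ≃o I) : ℝ≥0∞ :=
  max (⨆ t, edist (e t) t) (⨆ t, edist (f t) (g (e t)))

theorem cost_symm (f g : SkorokhodD) (e : I ≃o I) : cost g f e.symm = cost f g e := by
  unfold cost
  congr 1
  · rw [← e.toEquiv.iSup_comp]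
    simp [edist_comm]
  · rw [← e.toEquiv.iSup_comp]
    simp [edist_comm]

theorem cost_trans (f g h : SkorokhodD) (e e' : I ≃o I) :
    cost f h (e.trans e') ≤ cost f g e + cost g h e' := by
  unfold cost
  refine max_le (iSup_le fun t => ?_) (iSup_le fun t => ?_)
  · refine (edist_triangle _ (e t) _).trans ?_
    rw [add_comm]
    exact add_le_add (le_max_of_le_left (le_iSup (fun t => edist (e t) t) t))
      (le_max_of_le_left (le_iSup (fun t => edist (e' t) t) (e t)))
  · refine (edist_triangle _ (g (e t)) _).trans ?_
    exact add_le_add (le_max_of_le_right (le_iSup (fun t => edist (f t) (g (e t))) t))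
      (le_max_of_le_right (le_iSup (fun t => edist (g t) (h (e' t))) (e t)))

/-- Skorokhod's (J1) distance: the infimum of the costs of all time changes. -/
noncomputable instance : PseudoEMetricSpace SkorokhodD where
  edist f g := ⨅ e : I ≃o I, cost f g e
  edist_self f := by
    refine le_antisymm (iInf_le_of_le (OrderIso.refl I) ?_) bot_le
    simp [cost]
  edist_comm f g := by
    have key : ∀ f g : SkorokhodD, (⨅ e : I ≃o I, cost f g e) ≤ ⨅ e : I ≃o I, cost g f e :=
      fun f g => le_iInf fun e => iInf_le_of_le e.symm (cost_symm g f e).le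
    exact le_antisymm (key f g) (key g f)
  edist_triangle f g h := by
    refine ENNReal.le_of_forall_pos_le_add fun δ hδ hfin => ?_
    have hδ' : (0 : ℝ≥0∞) < (δ : ℝ≥0∞) / 2 := by
      simpa using hδ.ne'
    obtain ⟨h1, h2⟩ := ENNReal.add_lt_top.1 hfin
    obtain ⟨e, he⟩ := iInf_lt_iff.1 (ENNReal.lt_add_right h1.ne hδ'.ne')
    obtain ⟨e', he'⟩ := iInf_lt_iff.1 (ENNReal.lt_add_right h2.ne hδ'.ne')
    refine (iInf_le_of_le (e.trans e') (cost_trans f g h e e')).trans ?_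
    refine (add_le_add he.le he'.le).trans (le_of_eq ?_)
    rw [add_add_add_comm, ENNReal.add_halves]

/-- `D[0,1]` carries the Borel σ-algebra of the Skorokhod topology. -/
noncomputable instance : MeasurableSpace SkorokhodD := borel SkorokhodD

instance : BorelSpace SkorokhodD := ⟨rfl⟩

/-- The path `t ↦ s_{[nt]}` of `D[0,1]` attached to a sequence `s`. -/
noncomputable def stepPath (s : ℕ → ℝ) (n : ℕ) : SkorokhodD where
  toFun t := s ⌊(n : ℝ) * (t : ℝ)⌋₊
  rightCont t := by
    have h1 : Tendsto (fun u : I => (n : ℝ) * (u : ℝ)) (𝓝[≥] t) (𝓝[≥] ((n : ℝ) * (t : ℝ))) := by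
      refine tendsto_nhdsWithin_iff.2 ⟨?_, ?_⟩
      · exact ((continuous_const.mul continuous_subtype_val).tendsto t).mono_left inf_le_left
      · filter_upwards [self_mem_nhdsWithin] with u hu
        exact mul_le_mul_of_nonneg_left (show (t : ℝ) ≤ u from hu) (Nat.cast_nonneg n)
    have h2 := (tendsto_floor_right_pure_floor ((n : ℝ) * (t : ℝ))).comp h1
    refine tendsto_nhds_of_eventually_eq ?_
    filter_upwards [tendsto_pure.1 h2] with u hu
    simp only [Function.comp] at hu
    rw [← Int.floor_toNat, ← Int.floor_toNat, hu]
  leftLim t := by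
    rcases Nat.eq_zero_or_pos n with rfl | hn
    · exact ⟨s 0, by simpa using tendsto_const_nhds⟩
    have h1 : Tendsto (fun u : I => (n : ℝ) * (u : ℝ)) (𝓝[<] t) (𝓝[<] ((n : ℝ) * (t : ℝ))) := by
      refine tendsto_nhdsWithin_iff.2 ⟨?_, ?_⟩
      · exact ((continuous_const.mul continuous_subtype_val).tendsto t).mono_left inf_le_left
      · filter_upwards [self_mem_nhdsWithin] with u hu
        exact mul_lt_mul_of_pos_left (show (u : ℝ) < t from hu) (Nat.cast_pos.2 hn)
    have h2 := (tendsto_floor_left_pure_ceil_sub_one ((n : ℝ) * (t : ℝ))).comp h1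
    refine ⟨s (⌈(n : ℝ) * (t : ℝ)⌉ - 1).toNat, tendsto_nhds_of_eventually_eq ?_⟩
    filter_upwards [tendsto_pure.1 h2] with u hu
    simp only [Function.comp] at hu
    rw [← Int.floor_toNat, hu]

end SkorokhodD

/-! ### Fractional Brownian motion -/

/-- `W` is a fractional Brownian motion on `[0,1]` with Hurst index `H`, as a random element of
`D[0,1]`: a centered Gaussian process with covariance `(t^{2H} + s^{2H} - |t - s|^{2H}) / 2`
and continuous paths. -/
structure IsFractionalBrownianMotion {Ω : Type*} [MeasurableSpace Ω] (H : ℝ)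
    (W : Ω → SkorokhodD) (P : Measure Ω) : Prop where
  measurable : Measurable W
  gaussian : IsGaussianProcess (fun (t : I) ω => W ω t) P
  centered : ∀ t : I, ∫ ω, W ω t ∂P = 0
  covariance : ∀ s t : I, cov[fun ω => W ω s, fun ω => W ω t; P] =
    ((t : ℝ) ^ (2 * H) + (s : ℝ) ^ (2 * H) - |(t : ℝ) - (s : ℝ)| ^ (2 * H)) / 2
  continuous_paths : ∀ᵐ ω ∂P, Continuous (W ω).toFun

/-!
# The self-normalized invariance principle for linear processes with long memory

The innovations have infinite variance in general, but their truncated second moment `l` is slowly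
varying, and `Q_n = √(n l_n)` is the right scale for their sums. Everything rests on one truncation:
for a reference time `n` the innovation `ε_{n-r}` is cut at the level `η_n √(1 + r / n)`
(`growingLevel`). The levels have to grow with `r` because `∑ |a_i|` diverges. Potter's bounds give,
for this choice (`IsTruncScale`), variances of order `l_n (1 + r / n) ^ δ` and removed parts with
first moments `o(Q_n / n) (1 + r / n) ^ (δ - 1 / 2)`; both can be summed against the coefficients,
which by Potter's bounds again decay like `r ^ (δ - α)`, since `α > 1 / 2`. So the series converge:
the truncated ones as martingales bounded in `L²`, the removed parts absolutely.

*Squares.* The squares of a finite moving average obey the weak law: the squared innovations by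
truncation and Chebyshev's inequality (`IsCenteredDANInnovation.tendstoInMeasure_sum_sq`), and the
products of different innovations because they are orthogonal (`tendstoInMeasure_sum_mul`). The
tails of the series contribute little, uniformly in `n`
(`IsCenteredDANInnovation.eventually_sum_sq_tail_le`).

*Finite-dimensional distributions.* A linear combination of the `S_{[n t_k]}` is a series
`∑_r c_r ε_{n-r}`. By Karamata's theorem `c_{[nx]} / (n a_n)` converges to a combination of the
kernels `fbmKernel α t_k` of the moving average representation of fractional Brownian motion. The
characteristic function of the series is a product of those of the innovations, and the expansion of
the latter at the origin compares it with the Gaussian one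
(`IsCenteredDANInnovation.tendsto_charFun_linearSum`). The scaling of the kernels identifies the
covariance (`IsPotterSequence.integral_sq_sum_fbmKernel`), and Lévy's theorem concludes.

*Tightness.* The truncated part of `S_{k+h} - S_k` has a second moment of order
`(n a_n Q_n)² (h / n) ^ γ` with `γ = 3 - 2α - 2δ > 1` (`IsPotterSequence.exists_tsum_increment_le`),
so dyadic chaining controls its oscillation over blocks of length `n / M`; the removed part is
uniformly small in mean. This is `IsCenteredDANInnovation.eventually_modulus_le`.

*Weak convergence in `D[0,1]`.* By the modulus estimate the path is uniformly close to its
discretization with mesh `1 / M`, a continuous image of a finite-dimensional vector; the paths of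
the limit being continuous, its discretizations converge to it, and the two approximations combine
(`tendstoInDistribution_of_approx`). The random normalization enters only through Slutsky's theorem
for the finite-dimensional vectors, `Q_n / √(∑ X_i²)` tending to `1 / A` by the weak law.
-/

/-! ### Slowly varying functions: uniform convergence and Potter bounds -/

/-- The points `v` at which the increments along `x` have already become small fill `[0, 2]`. -/
theorem tendsto_volume_good_set {k : ℝ → ℝ} (hk : Measurable k)
    (hlim : ∀ u : ℝ, Tendsto (fun x => k (x + u) - k x) atTop (𝓝 0)) {κ : ℝ} (hκ : 0 < κ)
    {x : ℕ → ℝ} (hx : Tendsto x atTop atTop) :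
    Tendsto (fun n => volume {v ∈ Set.Icc (0 : ℝ) 2 | ∀ m ≥ n, |k (x m + v) - k (x m)| < κ})
      atTop (𝓝 2) ∧
    ∀ n, MeasurableSet {v ∈ Set.Icc (0 : ℝ) 2 | ∀ m ≥ n, |k (x m + v) - k (x m)| < κ} := by
  constructor
  · have hmono : Monotone
        (fun n : ℕ => {v ∈ Set.Icc (0 : ℝ) 2 | ∀ m ≥ n, |k (x m + v) - k (x m)| < κ}) :=
      fun n n' hn v hv => ⟨hv.1, fun m hm => hv.2 m (hn.trans hm)⟩
    have h := tendsto_measure_iUnion_atTop (μ := (volume : Measure ℝ)) hmono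
    have hU : (⋃ n : ℕ, {v ∈ Set.Icc (0 : ℝ) 2 | ∀ m ≥ n, |k (x m + v) - k (x m)| < κ})
        = Set.Icc 0 2 := by
      ext v
      simp only [Set.mem_iUnion, Set.mem_ofPred_eq]
      refine ⟨fun ⟨n, hn⟩ => hn.1, fun hv => ?_⟩
      have := ((hlim v).comp hx).abs
      simp only [abs_zero] at this
      obtain ⟨n, hn⟩ := eventually_atTop.1 (this.eventually_lt_const hκ)
      exact ⟨n, hv, fun m hm => hn m hm⟩
    rw [hU, Real.volume_Icc] at h
    rw [sub_zero, ENNReal.ofReal_ofNat] at h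
    exact h
  · intro n
    have : {v ∈ Set.Icc (0 : ℝ) 2 | ∀ m ≥ n, |k (x m + v) - k (x m)| < κ} =
        Set.Icc (0 : ℝ) 2 ∩ ⋂ m : ℕ, ⋂ (_ : m ≥ n), {v | |k (x m + v) - k (x m)| < κ} := by
      ext v; simp
    rw [this]
    refine measurableSet_Icc.inter (MeasurableSet.iInter fun m => MeasurableSet.iInter fun _ => ?_)
    refine measurableSet_lt ?_ measurable_const
    exact continuous_abs.measurable.comp
      ((hk.comp (measurable_const.add measurable_id)).sub measurable_const)

/-- The uniform convergence theorem for slowly varying functions, in additive notation. If it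
failed along `x n` and `u n`, the set of `v ∈ [0, 2]` at which the increment `k (x n + v) - k (x n)`
is small and the translate by `u n` of the set at which `k (x n + u n + v) - k (x n + u n)` is small
would both have measure more than `3 / 2` inside `[0, 3]`, hence would meet. -/
theorem uniform_of_tendsto_increment {k : ℝ → ℝ} (hk : Measurable k)
    (hlim : ∀ u : ℝ, Tendsto (fun x => k (x + u) - k x) atTop (𝓝 0)) {κ : ℝ} (hκ : 0 < κ) :
    ∃ X : ℝ, ∀ x ≥ X, ∀ u ∈ Set.Icc (0 : ℝ) 1, |k (x + u) - k x| < κ := by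
  by_contra! hcon
  choose x hx u hu hxu using fun n : ℕ => hcon n
  have hxt : Tendsto x atTop atTop := tendsto_atTop_mono hx tendsto_natCast_atTop_atTop
  have hxt' : Tendsto (fun n => x n + u n) atTop atTop :=
    tendsto_atTop_mono (fun n => le_add_of_nonneg_right (hu n).1) hxt
  obtain ⟨hV, hVm⟩ := tendsto_volume_good_set hk hlim (half_pos hκ) hxt
  obtain ⟨hW, hWm⟩ := tendsto_volume_good_set hk hlim (half_pos hκ) hxt'
  have h32 : (3 / 2 : ℝ≥0∞) < 2 := by
    rw [ENNReal.div_lt_iff (by simp) (by simp)]; norm_num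
  obtain ⟨n, hVn, hWn⟩ := ((hV.eventually_const_lt h32).and (hW.eventually_const_lt h32)).exists
  set V := {v ∈ Set.Icc (0 : ℝ) 2 | ∀ m ≥ n, |k (x m + v) - k (x m)| < κ / 2}
  set W := {v ∈ Set.Icc (0 : ℝ) 2 | ∀ m ≥ n, |k (x m + u m + v) - k (x m + u m)| < κ / 2}
  have hWt : volume ((fun v => v - u n) ⁻¹' W) = volume W := by
    simp only [sub_eq_add_neg]
    exact measure_preimage_add_right volume (-u n) W
  have hWm' : MeasurableSet ((fun v => v - u n) ⁻¹' W) := (measurable_id.sub_const _) (hWm n)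
  have hne : ¬ Disjoint V ((fun v => v - u n) ⁻¹' W) := by
    intro hd
    have h1 : volume (V ∪ (fun v => v - u n) ⁻¹' W) ≤ volume (Set.Icc (0 : ℝ) 3) := by
      refine measure_mono (Set.union_subset (fun v hv => ⟨hv.1.1, hv.1.2.trans (by norm_num)⟩) ?_)
      intro v hv
      have := hv.1; have h2 := hu n
      simp only [Set.mem_Icc] at this h2 ⊢
      constructor <;> linarith
    rw [measure_union hd hWm', hWt, Real.volume_Icc] at h1
    have h2 := (ENNReal.add_lt_add hVn hWn).trans_le h1
    rw [ENNReal.div_add_div_same] at h2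
    norm_num at h2
    have h3 : (6 / 2 : ℝ≥0∞) = 3 := by
      rw [show (6 : ℝ≥0∞) = 3 * 2 by norm_num]
      exact ENNReal.mul_div_cancel_right (by simp) (by simp)
    rw [h3] at h2
    exact lt_irrefl _ h2
  obtain ⟨v, hv, hvW⟩ := Set.not_disjoint_iff.1 hne
  have e1 := hv.2 n le_rfl
  have e2 := hvW.2 n le_rfl
  have e3 : x n + u n + (v - u n) = x n + v := by ring
  simp only [e3] at e2
  have := hxu n
  rw [abs_lt] at e1 e2
  rcases le_abs.1 this with h | h <;> linarith [e1.1, e1.2, e2.1, e2.2]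

/-- The uniform convergence theorem, over the ratios in `[1, e]`. -/
theorem IsSlowlyVarying.uniform_log {h : ℝ → ℝ} (hh : IsSlowlyVarying h) {κ : ℝ} (hκ : 0 < κ) :
    ∃ X : ℝ, 1 ≤ X ∧ (∀ x ≥ X, 0 < h x) ∧
      ∀ x ≥ X, ∀ y ≥ x, y ≤ Real.exp 1 * x → |Real.log (h y) - Real.log (h x)| < κ := by
  obtain ⟨⟨A, hA, hpos, hmeas⟩, hlim⟩ := hh
  -- extended by a constant below `A`, the function is positive and measurable on the whole line
  let k : ℝ → ℝ := fun x => Real.log (h (max (Real.exp x) A))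
  have hk : Measurable k := by
    have h1 : Measurable (fun x : ℝ => (⟨max (Real.exp x) A, Set.mem_Ici.2 (le_max_right _ _)⟩ : Set.Ici A)) :=
      Measurable.subtype_mk (Real.measurable_exp.max measurable_const)
    exact Real.measurable_log.comp (hmeas.comp h1)
  have hkl : ∀ u : ℝ, Tendsto (fun x => k (x + u) - k x) atTop (𝓝 0) := by
    intro u
    have h1 := (hlim (Real.exp u) (Real.exp_pos u)).comp Real.tendsto_exp_atTop
    have h2 := h1.log one_ne_zero
    rw [Real.log_one] at h2
    refine h2.congr' ?_
    have hx0 : ∀ᶠ x in atTop, A ≤ Real.exp x := Real.tendsto_exp_atTop.eventually_ge_atTop A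
    have hx1 : ∀ᶠ x in atTop, A ≤ Real.exp (x + u) :=
      (Real.tendsto_exp_atTop.comp (tendsto_atTop_add_const_right _ u tendsto_id)).eventually_ge_atTop A
    filter_upwards [hx0, hx1] with x hx hx'
    simp only [k, Function.comp, max_eq_left hx, max_eq_left hx']
    rw [← Real.log_div (hpos _ hx').ne' (hpos _ hx).ne', add_comm x u, Real.exp_add]
  obtain ⟨X, hX⟩ := uniform_of_tendsto_increment hk hkl hκ
  refine ⟨max 1 (max A (Real.exp X)), le_max_left _ _, fun x hx => hpos x ?_, ?_⟩
  · exact ((le_max_left _ _).trans (le_max_right _ _)).trans hx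
  intro x hx y hxy hy
  have hxA : A ≤ x := ((le_max_left _ _).trans (le_max_right _ _)).trans hx
  have hxX : Real.exp X ≤ x := ((le_max_right _ _).trans (le_max_right _ _)).trans hx
  have hx0 : 0 < x := hA.trans_le hxA
  have hy0 : 0 < y := hx0.trans_le hxy
  have := hX (Real.log x) ((Real.le_log_iff_exp_le hx0).2 hxX) (Real.log y - Real.log x)
    ⟨sub_nonneg.2 (Real.log_le_log hx0 hxy), by
      have := Real.log_le_log hy0 hy
      rw [Real.log_mul (Real.exp_pos 1).ne' hx0.ne', Real.log_exp] at this
      linarith⟩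
  simpa only [k, add_sub_cancel, Real.exp_log hx0, Real.exp_log hy0, max_eq_left hxA,
    max_eq_left (hxA.trans hxy)] using this

/-- Potter's bounds. -/
theorem IsSlowlyVarying.potter {h : ℝ → ℝ} (hh : IsSlowlyVarying h) {δ : ℝ} (hδ : 0 < δ) :
    ∃ X : ℝ, 1 ≤ X ∧ (∀ x ≥ X, 0 < h x) ∧
      ∀ x ≥ X, ∀ y ≥ x, h y ≤ 2 * (y / x) ^ δ * h x ∧ h x ≤ 2 * (y / x) ^ δ * h y := by
  have hκ : 0 < min δ (Real.log 2) := lt_min hδ (Real.log_pos (by norm_num))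
  obtain ⟨X, hX1, hpos, hX⟩ := hh.uniform_log hκ
  refine ⟨X, hX1, hpos, fun x hx y hy => ?_⟩
  have hx0 : 0 < x := by linarith
  -- one step for each factor `e` between `x` and `y`
  have key : ∀ n : ℕ, ∀ z ≥ x, z ≤ Real.exp 1 ^ n * x →
      |Real.log (h z) - Real.log (h x)| ≤ δ * (Real.log (z / x)) + Real.log 2 := by
    intro n
    induction n with
    | zero =>
      intro z hz hzx
      have : z = x := le_antisymm (by simpa using hzx) hz
      subst this
      simp [hx0.ne', Real.log_nonneg]
    | succ n ih =>
      intro z hz hzx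
      have hz0 : 0 < z := hx0.trans_le hz
      rcases le_total z (Real.exp 1 * x) with h1 | h1
      · have h2 := (hX x hx z hz h1).le.trans (min_le_right _ _)
        have : 0 ≤ δ * Real.log (z / x) :=
          mul_nonneg hδ.le (Real.log_nonneg ((one_le_div hx0).2 hz))
        linarith
      · have hw : x ≤ z / Real.exp 1 := by
          rw [le_div_iff₀ (Real.exp_pos 1)]; linarith
        have h2 := ih (z / Real.exp 1) hw (by
          rw [div_le_iff₀ (Real.exp_pos 1)]
          calc z ≤ _ := hzx
            _ = _ := by ring)
        have h3 := hX (z / Real.exp 1) (hx.trans hw) z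
          (div_le_self hz0.le (Real.one_le_exp zero_le_one))
          (by rw [mul_div_cancel₀ _ (Real.exp_pos 1).ne'])
        have h4 : Real.log (z / Real.exp 1 / x) = Real.log (z / x) - 1 := by
          rw [Real.log_div (by positivity) hx0.ne', Real.log_div hz0.ne' (Real.exp_pos 1).ne',
            Real.log_exp, Real.log_div hz0.ne' hx0.ne']; ring
        rw [h4] at h2
        have h5 := abs_sub_le (Real.log (h z)) (Real.log (h (z / Real.exp 1))) (Real.log (h x))
        have h6 := h3.le.trans (min_le_left _ _)
        linarith
  obtain ⟨n, hn⟩ := pow_unbounded_of_one_lt (y / x) (Real.one_lt_exp_iff.2 one_pos)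
  have h1 := key n y hy (by rw [← div_le_iff₀ hx0]; exact hn.le)
  have hyx : 0 < y / x := div_pos (hx0.trans_le hy) hx0
  have hpx := hpos x hx
  have hpy := hpos y (hx.trans hy)
  rw [abs_le] at h1
  have e : 2 * (y / x) ^ δ = Real.exp (δ * Real.log (y / x) + Real.log 2) := by
    rw [Real.exp_add, Real.exp_log two_pos, Real.rpow_def_of_pos hyx]; ring_nf
  rw [e]
  constructor
  · rw [← Real.log_le_log_iff hpy (by positivity), Real.log_mul (Real.exp_pos _).ne' hpx.ne',
      Real.log_exp]
    linarith
  · rw [← Real.log_le_log_iff hpx (by positivity), Real.log_mul (Real.exp_pos _).ne' hpy.ne',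
      Real.log_exp]
    linarith

/-- Slow variation along comparable sequences. -/
theorem IsSlowlyVarying.tendsto_div {h : ℝ → ℝ} (hh : IsSlowlyVarying h) {x y : ℕ → ℝ}
    (hx : Tendsto x atTop atTop) {c : ℝ} (hc : 0 < c)
    (hy : Tendsto (fun n => y n / x n) atTop (𝓝 c)) :
    Tendsto (fun n => h (y n) / h (x n)) atTop (𝓝 1) := by
  -- compare both with `h (c * x n)`, as `y n / (c * x n)` tends to `1`
  have hcx : Tendsto (fun n => c * x n) atTop atTop := hx.const_mul_atTop hc
  have hr : Tendsto (fun n => y n / (c * x n)) atTop (𝓝 1) := by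
    have := hy.div_const c
    rw [div_self hc.ne'] at this
    refine this.congr fun n => ?_
    rw [div_div, mul_comm]
  have hyt : Tendsto y atTop atTop := by
    have := hcx.atTop_mul_pos one_pos hr
    refine this.congr' ?_
    filter_upwards [hcx.eventually_gt_atTop 0] with n hn
    exact mul_div_cancel₀ _ hn.ne'
  have h1 : Tendsto (fun n => Real.log (h (y n)) - Real.log (h (c * x n))) atTop (𝓝 0) := by
    rw [Metric.tendsto_nhds]
    intro κ hκ
    obtain ⟨X, hX1, hpos, hX⟩ := hh.uniform_log hκ
    have hu : ∀ᶠ n in atTop, y n / (c * x n) < Real.exp 1 :=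
      hr.eventually_lt_const (Real.one_lt_exp_iff.2 one_pos)
    have hl : ∀ᶠ n in atTop, (Real.exp 1)⁻¹ < y n / (c * x n) :=
      hr.eventually_const_lt (inv_lt_one_of_one_lt₀ (Real.one_lt_exp_iff.2 one_pos))
    filter_upwards [hu, hl, hyt.eventually_ge_atTop X, hcx.eventually_ge_atTop X] with n h1 h2 h3 h4
    have hp : 0 < c * x n := by linarith
    rw [div_lt_iff₀ hp] at h1
    rw [lt_div_iff₀ hp] at h2
    rw [Real.dist_eq, sub_zero]
    rcases le_total (c * x n) (y n) with h | h
    · exact hX _ h4 _ h h1.le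
    · rw [abs_sub_comm]
      refine hX _ h3 _ h ?_
      rw [inv_mul_lt_iff₀ (Real.exp_pos 1)] at h2
      exact h2.le
  obtain ⟨X, hX1, hpos, -⟩ := hh.uniform_log one_pos
  have h2 : Tendsto (fun n => h (y n) / h (c * x n)) atTop (𝓝 1) := by
    have := (Real.continuous_exp.tendsto 0).comp h1
    rw [Real.exp_zero] at this
    refine this.congr' ?_
    filter_upwards [hyt.eventually_ge_atTop X, hcx.eventually_ge_atTop X] with n h3 h4
    simp only [Function.comp]
    rw [Real.exp_sub, Real.exp_log (hpos _ h3), Real.exp_log (hpos _ h4)]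
  have h3 := h2.mul ((hh.2 c hc).comp hx)
  rw [one_mul] at h3
  refine h3.congr' ?_
  filter_upwards [hcx.eventually_ge_atTop X] with n h4
  simp only [Function.comp]
  rw [div_mul_div_cancel₀ (hpos _ h4).ne']

/-! ### Sums over the integers as integrals of step functions -/

theorem map_floor_mul_restrict_Ioi {n : ℕ} (hn : 0 < n) :
    (volume.restrict (Set.Ioi (0 : ℝ))).map (fun x : ℝ => ⌊(n : ℝ) * x⌋₊) =
      (n : ℝ≥0∞)⁻¹ • Measure.count := by
  have hn' : (0 : ℝ) < n := Nat.cast_pos.2 hn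
  refine Measure.ext_of_singleton fun r => ?_
  have hm : Measurable (fun x : ℝ => ⌊(n : ℝ) * x⌋₊) :=
    Nat.measurable_floor.comp (measurable_const.mul measurable_id)
  rw [Measure.restrict_congr_set Ioi_ae_eq_Ici, Measure.map_apply hm (measurableSet_singleton r),
    Measure.restrict_apply (hm (measurableSet_singleton r))]
  have : (fun x : ℝ => ⌊(n : ℝ) * x⌋₊) ⁻¹' {r} ∩ Set.Ici 0 =
      Set.Ico ((r : ℝ) / n) ((r + 1 : ℝ) / n) := by
    ext x
    simp only [Set.mem_inter_iff, Set.mem_preimage, Set.mem_singleton_iff, Set.mem_Ici, Set.mem_Ico]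
    rw [div_le_iff₀ hn', lt_div_iff₀ hn']
    constructor
    · rintro ⟨h, hx⟩
      rw [Nat.floor_eq_iff (by positivity)] at h
      constructor <;> linarith
    · rintro ⟨h1, h2⟩
      have hx : 0 ≤ x := by
        by_contra h
        have : x * n < 0 := mul_neg_of_neg_of_pos (not_le.1 h) hn'
        have : (0 : ℝ) ≤ r := Nat.cast_nonneg r
        linarith
      refine ⟨?_, hx⟩
      rw [Nat.floor_eq_iff (by positivity)]
      constructor <;> linarith
  rw [this, Real.volume_Ico, Measure.smul_apply, Measure.count_singleton]
  rw [← sub_div, add_sub_cancel_left, one_div, ENNReal.ofReal_inv_of_pos hn',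
    ENNReal.ofReal_natCast]
  simp

theorem measurable_floor_mul (n : ℕ) : Measurable (fun x : ℝ => ⌊(n : ℝ) * x⌋₊) :=
  Nat.measurable_floor.comp (measurable_const.mul measurable_id)

theorem integrableOn_floor_mul_iff {n : ℕ} (hn : 0 < n) (F : ℕ → ℝ) :
    IntegrableOn (fun x : ℝ => F ⌊(n : ℝ) * x⌋₊) (Set.Ioi (0 : ℝ)) ↔ Summable F := by
  have h := integrable_map_measure (f := fun x : ℝ => ⌊(n : ℝ) * x⌋₊)
    (μ := volume.restrict (Set.Ioi (0 : ℝ))) (g := F)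
    (measurable_of_countable F).aestronglyMeasurable (measurable_floor_mul n).aemeasurable
  rw [map_floor_mul_restrict_Ioi hn, integrable_smul_measure (by simp) (by simp [hn.ne']),
    integrable_count_iff] at h
  exact h.symm.trans ⟨fun h => h.of_norm, fun h => h.norm⟩

theorem integral_floor_mul {n : ℕ} (hn : 0 < n) {F : ℕ → ℝ} (hF : Summable F) :
    ∫ x in Set.Ioi (0 : ℝ), F ⌊(n : ℝ) * x⌋₊ = (n : ℝ)⁻¹ * ∑' r, F r := by
  have hi : Integrable F Measure.count := integrable_count_iff.2 hF.norm
  rw [← integral_map (f := F) (φ := fun x : ℝ => ⌊(n : ℝ) * x⌋₊)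
    (measurable_floor_mul n).aemeasurable (measurable_of_countable F).aestronglyMeasurable,
    map_floor_mul_restrict_Ioi hn, integral_smul_measure, integral_countable hi]
  simp [Measure.real]

/-! ### Regularly varying coefficients -/

/-- The power majorant `v ^ (-(α + δ)) + v ^ (-(α - δ))` of the rescaled coefficients. -/
noncomputable def potterMajorant (α δ v : ℝ) : ℝ := v ^ (-(α + δ)) + v ^ (-(α - δ))

theorem potterMajorant_nonneg {α δ v : ℝ} (hv : 0 ≤ v) : 0 ≤ potterMajorant α δ v :=
  add_nonneg (Real.rpow_nonneg hv _) (Real.rpow_nonneg hv _)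

theorem potterMajorant_anti {α δ v w : ℝ} (hδ : 0 ≤ δ) (hα : δ ≤ α) (hv : 0 < v) (hvw : v ≤ w) :
    potterMajorant α δ w ≤ potterMajorant α δ v :=
  add_le_add (Real.rpow_le_rpow_of_nonpos hv hvw (by linarith))
    (Real.rpow_le_rpow_of_nonpos hv hvw (by linarith))

/-- `a` is regularly varying of index `-α`, and `a i / a n` is bounded, for `N ≤ n` and for all `i`,
by `C` times the power majorant at `(i + 1) / n`. The shift by one takes care of `i = 0`. -/
structure IsPotterSequence (a : ℕ → ℝ) (α δ C : ℝ) (N : ℕ) : Prop where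
  C_pos : 0 < C
  N_pos : 1 ≤ N
  pos : ∀ n ≥ N, 0 < a n
  bound : ∀ n ≥ N, ∀ i : ℕ, |a i| ≤ C * a n * potterMajorant α δ (((i : ℝ) + 1) / n)
  tendsto : ∀ v : ℝ, 0 < v →
    Tendsto (fun n : ℕ => a ⌊(n : ℝ) * v⌋₊ / a n) atTop (𝓝 (v ^ (-α)))

theorem rpow_neg_div_le_four_mul {q i n : ℝ} (hq0 : 0 ≤ q) (hq : q ≤ 2) (hi : 1 ≤ i) (hn : 0 < n) :
    (i / n) ^ (-q) ≤ 4 * ((i + 1) / n) ^ (-q) := by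
  have h1 : (i + 1) / n ≤ 2 * (i / n) := by
    rw [← mul_div_assoc]; gcongr; linarith
  have h0 : 0 < (i + 1) / n := by positivity
  have h2 : (2 * (i / n)) ^ (-q) ≤ ((i + 1) / n) ^ (-q) :=
    Real.rpow_le_rpow_of_nonpos h0 h1 (by linarith)
  rw [Real.mul_rpow (by norm_num) (by positivity)] at h2
  have h3 : (1 / 4 : ℝ) ≤ 2 ^ (-q) := by
    calc (1 / 4 : ℝ) = 2 ^ (-2 : ℝ) := by
          rw [Real.rpow_neg (by norm_num)]; norm_num
      _ ≤ _ := Real.rpow_le_rpow_of_exponent_le (by norm_num) (by linarith)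
  have h4 : 0 ≤ (i / n) ^ (-q) := by positivity
  nlinarith

/-- A regularly varying sequence of index in `(-1, 0)` satisfies the Potter bounds at all indices,
the finitely many initial terms being absorbed in the constant. -/
theorem exists_isPotterSequence {α δ : ℝ} (hδ : 0 < δ) (hδα : δ < α) (hα : α < 1)
    {L : ℕ → ℝ} (hL : IsStronglySlowlyVaryingSeq L) {a : ℕ → ℝ}
    (ha : ∀ n : ℕ, 1 ≤ n → a n = (n : ℝ) ^ (-α) * L n) :
    ∃ C N, IsPotterSequence a α δ C N := by
  obtain ⟨h, hh, hLh⟩ := hL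
  obtain ⟨X, hX1, hpos, hX⟩ := hh.potter hδ
  have hah : ∀ n : ℕ, 1 ≤ n → a n = (n : ℝ) ^ (-α) * h n := fun n hn => by rw [ha n hn, hLh n hn]
  set N := ⌈X⌉₊ with hN
  have hN1 : 1 ≤ N := by
    rw [hN]; exact Nat.one_le_iff_ne_zero.2 (Nat.ceil_pos.2 (by linarith)).ne'
  have hNX : ∀ n : ℕ, N ≤ n → X ≤ n := fun n hn => (Nat.le_ceil X).trans (Nat.cast_le.2 hn)
  have hapos : ∀ n ≥ N, 0 < a n := fun n hn => by
    rw [hah n (hN1.trans hn)]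
    have := hpos n (hNX n hn)
    have : (0 : ℝ) < n := by have := hNX n hn; linarith
    positivity
  have hbig : ∀ n ≥ N, ∀ i ≥ N, a i ≤ 8 * a n * potterMajorant α δ (((i : ℝ) + 1) / n) := by
    intro n hn i hi
    have hn0 : (0 : ℝ) < n := by have := hNX n hn; linarith
    have hi1 : (1 : ℝ) ≤ i := by have := hNX i hi; linarith
    have hi0 : (0 : ℝ) < i := by linarith
    have hhn := hpos n (hNX n hn)
    have hhi := hpos i (hNX i hi)
    have han := hapos n hn
    -- in both cases the ratio of the slowly varying factors is at most `2 * (i / n) ^ s`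
    have main : ∀ s : ℝ, |s| ≤ δ → h i ≤ 2 * ((i : ℝ) / n) ^ s * h n →
        a i ≤ 8 * a n * (((i : ℝ) + 1) / n) ^ (-(α - s)) := by
      intro s hs hle
      rw [abs_le] at hs
      have e1 := rpow_neg_div_le_four_mul (q := α - s) (i := i) (n := n) (by linarith)
        (by linarith) hi1 hn0
      have e2 : ((i : ℝ) / n) ^ (-(α - s)) = (i : ℝ) ^ (-α) / (n : ℝ) ^ (-α) * ((i : ℝ) / n) ^ s := by
        rw [← Real.div_rpow hi0.le hn0.le, ← Real.rpow_add (by positivity)]; ring_nf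
      have e3 : a i ≤ 2 * a n * ((i : ℝ) / n) ^ (-(α - s)) := by
        rw [hah i (hN1.trans hi), hah n (hN1.trans hn), e2]
        calc (i : ℝ) ^ (-α) * h i ≤ (i : ℝ) ^ (-α) * (2 * ((i : ℝ) / n) ^ s * h n) := by gcongr
          _ = _ := by
            have : (n : ℝ) ^ (-α) ≠ 0 := (Real.rpow_pos_of_pos hn0 _).ne'
            field_simp
      nlinarith
    have hr0 : (0 : ℝ) ≤ ((i : ℝ) + 1) / n := by positivity
    unfold potterMajorant
    rcases le_total n i with hni | hni
    · have := main δ (abs_of_pos hδ).le (hX n (hNX n hn) i (Nat.cast_le.2 hni)).1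
      refine this.trans ?_
      gcongr
      linarith [Real.rpow_nonneg hr0 (-(α + δ))]
    · have h1 := (hX i (hNX i hi) n (Nat.cast_le.2 hni)).2
      rw [← inv_div, Real.inv_rpow (by positivity), ← Real.rpow_neg (by positivity)] at h1
      have := main (-δ) (by rw [abs_neg, abs_of_pos hδ]) h1
      rw [sub_neg_eq_add] at this
      refine this.trans ?_
      gcongr
      linarith [Real.rpow_nonneg hr0 (-(α - δ))]
  obtain ⟨M, hM⟩ : ∃ M : ℝ, ∀ i < N, |a i| ≤ M := by
    refine ⟨∑ i ∈ Finset.range N, |a i|, fun i hi => ?_⟩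
    exact Finset.single_le_sum (f := fun i => |a i|) (fun _ _ => abs_nonneg _)
      (Finset.mem_range.2 hi)
  have hM0 : 0 ≤ M := (abs_nonneg _).trans (hM 0 hN1)
  have haN := hapos N le_rfl
  refine ⟨8 * (1 + M / a N), N, by positivity, hN1, hapos, fun n hn i => ?_, fun v hv => ?_⟩
  · have hn0 : (0 : ℝ) < n := by have := hNX n hn; linarith
    have han := hapos n hn
    have hP := potterMajorant_nonneg (α := α) (δ := δ) (v := ((i : ℝ) + 1) / n) (by positivity)
    rcases le_or_gt N i with hi | hi
    · rw [abs_of_pos (hapos i hi)]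
      refine (hbig n hn i hi).trans ?_
      have : 0 ≤ M / a N := by positivity
      gcongr
      linarith
    · have h1 := hbig n hn N le_rfl
      have h2 : potterMajorant α δ (((N : ℝ) + 1) / n) ≤ potterMajorant α δ (((i : ℝ) + 1) / n) := by
        refine potterMajorant_anti hδ.le hδα.le (by positivity) ?_
        have : (i : ℝ) ≤ N := Nat.cast_le.2 hi.le
        gcongr
      calc |a i| ≤ M := hM i hi
        _ = M / a N * a N := by field_simp
        _ ≤ M / a N * (8 * a n * potterMajorant α δ (((N : ℝ) + 1) / n)) := by gcongr
        _ ≤ M / a N * (8 * a n * potterMajorant α δ (((i : ℝ) + 1) / n)) := by gcongr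
        _ ≤ 8 * (1 + M / a N) * a n * potterMajorant α δ (((i : ℝ) + 1) / n) := by
          have : 0 ≤ a n * potterMajorant α δ (((i : ℝ) + 1) / n) := by positivity
          nlinarith
  · have hfl : Tendsto (fun n : ℕ => ((⌊(n : ℝ) * v⌋₊ : ℕ) : ℝ) / n) atTop (𝓝 v) := by
      have := (tendsto_nat_floor_mul_div_atTop (R := ℝ) hv.le).comp tendsto_natCast_atTop_atTop
      simpa [Function.comp_def, mul_comm] using this
    have h1 := hh.tendsto_div tendsto_natCast_atTop_atTop hv hfl
    have h2 : Tendsto (fun n : ℕ => (((⌊(n : ℝ) * v⌋₊ : ℕ) : ℝ) / n) ^ (-α)) atTop (𝓝 (v ^ (-α))) :=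
      hfl.rpow_const (Or.inl hv.ne')
    have h3 := h2.mul h1
    rw [mul_one] at h3
    refine h3.congr' ?_
    have hf : Tendsto (fun n : ℕ => ⌊(n : ℝ) * v⌋₊) atTop atTop :=
      tendsto_nat_floor_atTop.comp (tendsto_natCast_atTop_atTop.atTop_mul_const hv)
    filter_upwards [hf.eventually_ge_atTop 1, eventually_ge_atTop 1] with n h4 h5
    rw [hah _ h4, hah _ h5, Real.div_rpow (by positivity) (by positivity), div_mul_div_comm]

theorem sum_range_rpow_le {q : ℝ} (hq0 : 0 ≤ q) (hq : q < 1) (m : ℕ) :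
    ∑ j ∈ Finset.range m, ((j : ℝ) + 1) ^ (-q) ≤ (m : ℝ) ^ (1 - q) / (1 - q) := by
  have h1q : 0 < 1 - q := by linarith
  induction m with
  | zero => simp [h1q.ne']
  | succ m ih =>
    rw [Finset.sum_range_succ]
    have hm : (0 : ℝ) < (m : ℝ) + 1 := by positivity
    have hs : (-1 : ℝ) ≤ -1 / ((m : ℝ) + 1) := by
      rw [le_div_iff₀ hm]; nlinarith [(Nat.cast_nonneg m : (0 : ℝ) ≤ m)]
    have hb := rpow_one_add_le_one_add_mul_self hs h1q.le (by linarith : 1 - q ≤ 1)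
    have e : (m : ℝ) = ((m : ℝ) + 1) * (1 + -1 / ((m : ℝ) + 1)) := by field_simp; ring
    have h2 : (m : ℝ) ^ (1 - q) ≤ ((m : ℝ) + 1) ^ (1 - q) - (1 - q) * ((m : ℝ) + 1) ^ (-q) := by
      conv_lhs => rw [e]
      rw [Real.mul_rpow hm.le (by linarith)]
      have h3 : ((m : ℝ) + 1) ^ (1 - q) = ((m : ℝ) + 1) ^ (-q) * ((m : ℝ) + 1) := by
        rw [← Real.rpow_add_one hm.ne']; ring_nf
      calc _ ≤ ((m : ℝ) + 1) ^ (1 - q) * (1 + (1 - q) * (-1 / ((m : ℝ) + 1))) := by gcongr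
        _ = _ := by rw [h3]; field_simp; ring
    push_cast
    rw [le_div_iff₀ h1q] at ih ⊢
    nlinarith

namespace IsPotterSequence

variable {a : ℕ → ℝ} {α δ C : ℝ} {N : ℕ}

theorem bound_floor (h : IsPotterSequence a α δ C N) (hδ : 0 ≤ δ) (hδα : δ ≤ α) {n : ℕ} (hn : N ≤ n)
    {v : ℝ} (hv : 0 < v) : |a ⌊(n : ℝ) * v⌋₊| ≤ C * a n * potterMajorant α δ v := by
  have hn0 : (0 : ℝ) < n := Nat.cast_pos.2 (h.N_pos.trans hn)
  refine (h.bound n hn _).trans ?_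
  have := h.C_pos
  have := h.pos n hn
  gcongr
  refine potterMajorant_anti hδ hδα hv ?_
  rw [le_div_iff₀ hn0, mul_comm]
  exact (Nat.lt_floor_add_one _).le

/-- Karamata's theorem for the partial sums of the coefficients. -/
theorem tendsto_sum_range_div (h : IsPotterSequence a α δ C N) (hδ : 0 < δ) (hδα : δ ≤ α)
    (hα : α + δ < 1) {m : ℕ → ℕ} {x : ℝ} (hx : 0 ≤ x)
    (hm : Tendsto (fun n => (m n : ℝ) / n) atTop (𝓝 x)) :
    Tendsto (fun n => (∑ j ∈ Finset.range (m n), a j) / (n * a n)) atTop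
      (𝓝 (x ^ (1 - α) / (1 - α))) := by
  let F : ℕ → ℝ → ℝ := fun n v => (Set.Iio ((m n : ℝ) / n)).indicator (fun v => a ⌊(n : ℝ) * v⌋₊ / a n) v
  have hF : ∀ᶠ n in atTop, ∫ v in Set.Ioi (0 : ℝ), F n v =
      (∑ j ∈ Finset.range (m n), a j) / (n * a n) := by
    filter_upwards [eventually_ge_atTop N] with n hn
    have hn1 : 0 < n := h.N_pos.trans hn
    have hn0 : (0 : ℝ) < n := Nat.cast_pos.2 hn1
    have e : ∀ v : ℝ, 0 < v →
        F n v = (fun j => if j ∈ Finset.range (m n) then a j / a n else 0) ⌊(n : ℝ) * v⌋₊ := by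
      intro v hv
      simp only [F, Set.indicator, Set.mem_Iio, Finset.mem_range]
      have : v < (m n : ℝ) / n ↔ ⌊(n : ℝ) * v⌋₊ < m n := by
        rw [lt_div_iff₀ hn0, Nat.floor_lt (by positivity), mul_comm]
      simp only [this]
    have hs : Summable (fun j => if j ∈ Finset.range (m n) then a j / a n else 0) :=
      summable_of_ne_finset_zero (s := Finset.range (m n)) (fun j hj => if_neg hj)
    rw [setIntegral_congr_fun measurableSet_Ioi (fun v hv => e v hv), integral_floor_mul hn1 hs,
      tsum_eq_sum (s := Finset.range (m n)) (fun j hj => if_neg hj),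
      Finset.sum_congr rfl (fun j hj => if_pos hj), ← Finset.sum_div]
    field_simp
  refine Tendsto.congr' hF ?_
  have hint : ∀ q y : ℝ, q < 1 → 0 ≤ y → IntegrableOn (fun v : ℝ => v ^ (-q)) (Set.Ioc 0 y) := by
    intro q y hq hy
    have := intervalIntegral.intervalIntegrable_rpow' (a := 0) (b := y) (r := -q) (by linarith)
    exact (intervalIntegrable_iff_integrableOn_Ioc_of_le hy).1 this
  have hlim : ∫ v in Set.Ioi (0 : ℝ), (Set.Iio x).indicator (fun v => v ^ (-α)) v =
      x ^ (1 - α) / (1 - α) := by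
    rw [setIntegral_indicator measurableSet_Iio]
    have : Set.Ioi (0 : ℝ) ∩ Set.Iio x = Set.Ioo 0 x := rfl
    rw [this, ← integral_Ioc_eq_integral_Ioo, ← intervalIntegral.integral_of_le hx,
      integral_rpow (Or.inl (by linarith))]
    have : -α + 1 ≠ 0 := by linarith
    rw [Real.zero_rpow this, sub_zero]
    ring_nf
  rw [← hlim]
  refine tendsto_integral_filter_of_dominated_convergence
    ((Set.Iic (x + 1)).indicator (fun v => C * potterMajorant α δ v)) ?_ ?_ ?_ ?_
  · refine Eventually.of_forall fun n => ?_
    refine Measurable.aestronglyMeasurable ?_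
    refine Measurable.indicator ?_ measurableSet_Iio
    exact ((measurable_of_countable a).comp (measurable_floor_mul n)).div_const _
  · filter_upwards [eventually_ge_atTop N, hm.eventually_lt_const (lt_add_one x)] with n hn hmn
    filter_upwards [ae_restrict_mem measurableSet_Ioi] with v hv
    have hv : 0 < v := hv
    have hP := potterMajorant_nonneg (α := α) (δ := δ) hv.le
    have hC := h.C_pos
    simp only [F, Set.indicator, Set.mem_Iio, Set.mem_Iic]
    split_ifs with h1 h2 h2
    · rw [Real.norm_eq_abs, abs_div, abs_of_pos (h.pos n hn), div_le_iff₀ (h.pos n hn)]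
      refine (h.bound_floor hδ.le hδα hn hv).trans (le_of_eq (by ring))
    · exact absurd (h1.le.trans hmn.le) h2
    · simpa using mul_nonneg hC.le hP
    · simp
  · rw [integrable_indicator_iff measurableSet_Iic, IntegrableOn, Measure.restrict_restrict
      measurableSet_Iic, Set.inter_comm, Set.Ioi_inter_Iic]
    refine Integrable.const_mul ?_ C
    exact (hint _ _ (by linarith) (by linarith)).add (hint _ _ (by linarith) (by linarith))
  · have hne : ∀ᵐ v ∂(volume.restrict (Set.Ioi (0 : ℝ))), v ≠ x := by
      refine ae_restrict_of_ae ?_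
      simp [ae_iff]
    filter_upwards [ae_restrict_mem measurableSet_Ioi, hne] with v hv hvx
    have hv : 0 < v := hv
    simp only [F, Set.indicator, Set.mem_Iio]
    rcases lt_or_gt_of_ne hvx with hlt | hlt
    · rw [if_pos hlt]
      refine (h.tendsto v hv).congr' ?_
      filter_upwards [hm.eventually_const_lt hlt] with n hn
      rw [if_pos hn]
    · rw [if_neg hlt.not_gt]
      refine tendsto_const_nhds.congr' ?_
      filter_upwards [hm.eventually_lt_const hlt] with n hn
      rw [if_neg hn.not_gt]

/-- The bound in Karamata's theorem, with an explicit dependence on `m / n`. -/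
theorem sum_range_abs_le (h : IsPotterSequence a α δ C N) (hδ : 0 < δ) (hδα : δ ≤ α)
    (hα : α + δ < 1) {n m : ℕ} (hn : N ≤ n) {K : ℝ} (hK : 1 ≤ K) (hm : (m : ℝ) ≤ K * n) :
    ∑ j ∈ Finset.range m, |a j| ≤
      C * (1 + K ^ (2 * δ)) / (1 - α - δ) * (n * a n) * ((m : ℝ) / n) ^ (1 - α - δ) := by
  have hn0 : (0 : ℝ) < n := Nat.cast_pos.2 (h.N_pos.trans hn)
  have hC := h.C_pos
  have han := h.pos n hn
  rcases Nat.eq_zero_or_pos m with rfl | hm0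
  · have : 1 - α - δ ≠ 0 := by linarith
    simp [Real.zero_rpow this]
  have hm0' : (0 : ℝ) < m := Nat.cast_pos.2 hm0
  have key : ∀ q : ℝ, 0 ≤ q → q < 1 → ∑ j ∈ Finset.range m, (((j : ℝ) + 1) / n) ^ (-q) ≤
      n * ((m : ℝ) / n) ^ (1 - q) / (1 - q) := by
    intro q hq0 hq
    have e : ∀ j ∈ Finset.range m, (((j : ℝ) + 1) / n) ^ (-q) = ((j : ℝ) + 1) ^ (-q) * (n : ℝ) ^ q := by
      intro j _
      rw [Real.div_rpow (by positivity) hn0.le, Real.rpow_neg hn0.le, div_inv_eq_mul]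
    rw [Finset.sum_congr rfl e, ← Finset.sum_mul]
    have := sum_range_rpow_le hq0 hq m
    calc _ ≤ (m : ℝ) ^ (1 - q) / (1 - q) * (n : ℝ) ^ q := by gcongr
      _ = _ := by
        rw [Real.div_rpow hm0'.le hn0.le, Real.rpow_sub hn0, Real.rpow_one]
        have : (n : ℝ) ^ q ≠ 0 := (Real.rpow_pos_of_pos hn0 _).ne'
        field_simp
  have h1 := key (α + δ) (by linarith) hα
  have h2 := key (α - δ) (by linarith) (by linarith)
  have hmn : 0 < (m : ℝ) / n := by positivity
  have h3 : ((m : ℝ) / n) ^ (1 - (α - δ)) ≤ K ^ (2 * δ) * ((m : ℝ) / n) ^ (1 - α - δ) := by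
    have : 1 - (α - δ) = 2 * δ + (1 - α - δ) := by ring
    rw [this, Real.rpow_add hmn]
    gcongr
    rwa [div_le_iff₀ hn0]
  have hden : 0 < 1 - α - δ := by linarith
  have h4 : n * ((m : ℝ) / n) ^ (1 - (α - δ)) / (1 - (α - δ)) ≤
      n * (K ^ (2 * δ) * ((m : ℝ) / n) ^ (1 - α - δ)) / (1 - α - δ) := by
    gcongr ?_ / ?_
    · gcongr
    · linarith
  calc ∑ j ∈ Finset.range m, |a j|
      ≤ ∑ j ∈ Finset.range m, C * a n * potterMajorant α δ (((j : ℝ) + 1) / n) :=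
        Finset.sum_le_sum fun j _ => h.bound n hn j
    _ = C * a n * (∑ j ∈ Finset.range m, (((j : ℝ) + 1) / n) ^ (-(α + δ)) +
        ∑ j ∈ Finset.range m, (((j : ℝ) + 1) / n) ^ (-(α - δ))) := by
        rw [← Finset.mul_sum, ← Finset.sum_add_distrib]; rfl
    _ ≤ C * a n * (n * ((m : ℝ) / n) ^ (1 - (α + δ)) / (1 - (α + δ)) +
        n * (K ^ (2 * δ) * ((m : ℝ) / n) ^ (1 - α - δ)) / (1 - α - δ)) := by
        gcongr
        exact h2.trans h4
    _ = _ := by rw [← sub_sub]; ring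

end IsPotterSequence

/-! ### Truncated moments of the innovations -/

section TruncatedMoments

variable {Ω : Type*} [MeasurableSpace Ω] {P : Measure Ω} {ξ : Ω → ℝ}

/-- The tail first moment `E |ξ| 1(|ξ| > x)`. -/
noncomputable def tailFirstMoment (ξ : Ω → ℝ) (P : Measure Ω) (x : ℝ) : ℝ :=
  ∫ ω, {ω | x < |ξ ω|}.indicator (fun ω => |ξ ω|) ω ∂P

theorem measurableSet_abs_le (hξ : Measurable ξ) (x : ℝ) : MeasurableSet {ω | |ξ ω| ≤ x} :=
  measurableSet_le (continuous_abs.measurable.comp hξ) measurable_const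

theorem measurableSet_lt_abs (hξ : Measurable ξ) (x : ℝ) : MeasurableSet {ω | x < |ξ ω|} :=
  measurableSet_lt measurable_const (continuous_abs.measurable.comp hξ)

omit [MeasurableSpace Ω] in
theorem indicator_abs_le_sq_le (x : ℝ) (ω : Ω) :
    {ω | |ξ ω| ≤ x}.indicator (fun ω => ξ ω ^ 2) ω ≤ x ^ 2 := by
  by_cases h : |ξ ω| ≤ x
  · rw [Set.indicator_of_mem (show ω ∈ {ω | |ξ ω| ≤ x} from h)]
    exact sq_le_sq' (by linarith [neg_abs_le (ξ ω)]) ((le_abs_self _).trans h)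
  · rw [Set.indicator_of_notMem (show ω ∉ {ω | |ξ ω| ≤ x} from h)]
    positivity

theorem integrable_indicator_abs_le [IsFiniteMeasure P] (hξ : Measurable ξ) (x : ℝ) :
    Integrable ({ω | |ξ ω| ≤ x}.indicator (fun ω => ξ ω ^ 2)) P := by
  refine Integrable.of_bound
    ((hξ.pow_const 2).indicator (measurableSet_abs_le hξ x)).aestronglyMeasurable (x ^ 2)
    (Eventually.of_forall fun ω => ?_)
  rw [Real.norm_of_nonneg (Set.indicator_nonneg (fun _ _ => sq_nonneg _) _)]
  exact indicator_abs_le_sq_le x ω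

theorem truncSecondMoment_nonneg (x : ℝ) : 0 ≤ truncSecondMoment ξ P x :=
  integral_nonneg fun _ => Set.indicator_nonneg (fun _ _ => sq_nonneg _) _

theorem truncSecondMoment_mono [IsFiniteMeasure P] (hξ : Measurable ξ) :
    Monotone (truncSecondMoment ξ P) := fun x y hxy =>
  integral_mono (integrable_indicator_abs_le hξ x) (integrable_indicator_abs_le hξ y) fun _ =>
    Set.indicator_le_indicator_of_subset (fun _ h => le_trans h hxy) (fun _ => sq_nonneg _) _

theorem integrable_indicator_lt_abs (hξ : Measurable ξ) (hi : Integrable ξ P) (x : ℝ) :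
    Integrable ({ω | x < |ξ ω|}.indicator (fun ω => |ξ ω|)) P :=
  hi.abs.indicator (measurableSet_lt_abs hξ x)

theorem tailFirstMoment_nonneg (x : ℝ) : 0 ≤ tailFirstMoment ξ P x :=
  integral_nonneg fun _ => Set.indicator_nonneg (fun _ _ => abs_nonneg _) _

theorem tendsto_tailFirstMoment (hξ : Measurable ξ) (hi : Integrable ξ P) {x : ℕ → ℝ}
    (hx : Tendsto x atTop atTop) :
    Tendsto (fun n => tailFirstMoment ξ P (x n)) atTop (𝓝 0) := by
  have := tendsto_integral_of_dominated_convergence (μ := P) (fun ω => |ξ ω|)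
    (F := fun n => {ω | x n < |ξ ω|}.indicator (fun ω => |ξ ω|)) (f := fun _ => 0)
    (fun n => (integrable_indicator_lt_abs hξ hi _).aestronglyMeasurable) hi.abs
    (fun n => Eventually.of_forall fun ω => ?_) (Eventually.of_forall fun ω => ?_)
  · rw [integral_zero] at this
    exact this
  · rw [Real.norm_of_nonneg (Set.indicator_nonneg (fun _ _ => abs_nonneg _) _)]
    exact Set.indicator_le_self' (fun _ _ => abs_nonneg _) _
  · refine tendsto_const_nhds.congr' ?_
    filter_upwards [hx.eventually_ge_atTop |ξ ω|] with n hn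
    rw [Set.indicator_of_notMem]
    exact not_lt.2 hn

/-- On `x < |ξ| ≤ 2x` one has `|ξ| ≤ ξ² / x`. -/
theorem tailFirstMoment_le_add [IsFiniteMeasure P] (hξ : Measurable ξ) (hi : Integrable ξ P) {x : ℝ}
    (hx : 0 < x) : tailFirstMoment ξ P x ≤ tailFirstMoment ξ P (2 * x) +
      (truncSecondMoment ξ P (2 * x) - truncSecondMoment ξ P x) / x := by
  unfold tailFirstMoment truncSecondMoment
  have hd : Integrable (fun ω => ({ω | |ξ ω| ≤ 2 * x}.indicator (fun ω => ξ ω ^ 2) ω -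
      {ω | |ξ ω| ≤ x}.indicator (fun ω => ξ ω ^ 2) ω) / x) P :=
    ((integrable_indicator_abs_le hξ _).sub (integrable_indicator_abs_le hξ _)).div_const _
  rw [← integral_sub (integrable_indicator_abs_le hξ _) (integrable_indicator_abs_le hξ _),
    ← integral_div, ← integral_add (integrable_indicator_lt_abs hξ hi _) hd]
  refine integral_mono (integrable_indicator_lt_abs hξ hi _)
    ((integrable_indicator_lt_abs hξ hi _).add hd) fun ω => ?_
  simp only [Set.indicator, Set.mem_ofPred_eq]
  rcases le_or_gt |ξ ω| x with h1 | h1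
  · rw [if_neg h1.not_gt, if_neg (by linarith), if_pos (by linarith), if_pos h1]; simp
  · rcases le_or_gt |ξ ω| (2 * x) with h2 | h2
    · rw [if_pos h1, if_neg h2.not_gt, if_pos h2, if_neg h1.not_ge, sub_zero, zero_add,
        le_div_iff₀ hx, ← sq_abs]
      nlinarith [abs_nonneg (ξ ω)]
    · rw [if_pos h1, if_pos h2, if_neg h2.not_ge, if_neg h1.not_ge]; simp

/-- The tail first moment is negligible with respect to `l(x) / x`: passing from `x` to
`2x` costs at most `(l(2x) - l(x)) / x`, a small multiple of `l(x) / x`, and these costs sum to a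
geometric series. -/
theorem tailFirstMoment_le [IsFiniteMeasure P] (hξ : Measurable ξ) (hi : Integrable ξ P)
    (hl : IsSlowlyVarying (truncSecondMoment ξ P)) {κ : ℝ} (hκ : 0 < κ) :
    ∃ X : ℝ, 1 ≤ X ∧ ∀ x ≥ X, tailFirstMoment ξ P x ≤ κ * (truncSecondMoment ξ P x / x) := by
  set l := truncSecondMoment ξ P
  obtain ⟨⟨A, hA, hpos, -⟩, hlim⟩ := hl
  have hκ' : 0 < min (κ / 4) (1 / 2) := by positivity
  set κ' := min (κ / 4) (1 / 2)
  have h2 := hlim 2 two_pos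
  obtain ⟨X, hX⟩ := eventually_atTop.1 (h2.eventually_lt_const (lt_add_of_pos_right 1 hκ'))
  refine ⟨max 1 (max A X), le_max_left _ _, fun x hx => ?_⟩
  -- The constant `4` absorbs the geometric series of ratio `3 / 4` produced by the induction.
  have key : ∀ k : ℕ, ∀ x ≥ max 1 (max A X),
      tailFirstMoment ξ P x ≤ tailFirstMoment ξ P (2 ^ k * x) + 4 * κ' * (l x / x) := by
    intro k
    induction k with
    | zero =>
      intro x hx
      have hx0 : 0 < x := lt_of_lt_of_le one_pos ((le_max_left _ _).trans hx)
      have : 0 ≤ l x := truncSecondMoment_nonneg x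
      simp only [pow_zero, one_mul]
      have : 0 ≤ 4 * κ' * (l x / x) := by positivity
      linarith
    | succ k ih =>
      intro x hx
      have hx0 : 0 < x := lt_of_lt_of_le one_pos ((le_max_left _ _).trans hx)
      have hlx : 0 < l x := hpos x (((le_max_left _ _).trans (le_max_right _ _)).trans hx)
      have h3 := hX x (((le_max_right _ _).trans (le_max_right _ _)).trans hx)
      rw [div_lt_iff₀ hlx] at h3
      have h4 := tailFirstMoment_le_add hξ hi hx0
      have h5 := ih (2 * x) (by linarith)
      rw [← mul_assoc, ← pow_succ] at h5
      have h6 : (l (2 * x) - l x) / x ≤ κ' * (l x / x) := by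
        rw [← mul_div_assoc]; gcongr; linarith
      have h7 : l (2 * x) / (2 * x) ≤ 3 / 4 * (l x / x) := by
        have : l (2 * x) ≤ 3 / 2 * l x := by
          have : κ' ≤ 1 / 2 := min_le_right _ _
          nlinarith
        calc l (2 * x) / (2 * x) ≤ (3 / 2 * l x) / (2 * x) := by gcongr
          _ = _ := by field_simp; norm_num
      have h8 : 4 * κ' * (l (2 * x) / (2 * x)) ≤ 4 * κ' * (3 / 4 * (l x / x)) := by gcongr
      linarith
  have hx0 : 0 < x := lt_of_lt_of_le one_pos ((le_max_left _ _).trans hx)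
  have hT : Tendsto (fun k : ℕ => tailFirstMoment ξ P (2 ^ k * x) + 4 * κ' * (l x / x)) atTop
      (𝓝 (0 + 4 * κ' * (l x / x))) :=
    (tendsto_tailFirstMoment hξ hi
      ((tendsto_pow_atTop_atTop_of_one_lt one_lt_two).atTop_mul_const hx0)).add_const _
  rw [zero_add] at hT
  refine (ge_of_tendsto' hT fun k => key k x hx).trans ?_
  have : 0 ≤ l x := truncSecondMoment_nonneg x
  gcongr
  have : κ' ≤ κ / 4 := min_le_left _ _
  linarith

theorem norm_exp_I_mul_sub_le {y : ℝ} (hy : |y| ≤ 1) :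
    ‖Complex.exp (y * Complex.I) - 1 - y * Complex.I + (y : ℂ) ^ 2 / 2‖ ≤ |y| ^ 3 := by
  have h := Complex.exp_bound (x := y * Complex.I) (by simpa using hy) (n := 3) (by norm_num)
  simp only [Finset.sum_range_succ, Finset.sum_range_zero, norm_mul, Complex.norm_real,
    Complex.norm_I, mul_one, Real.norm_eq_abs] at h
  have e : Complex.exp (y * Complex.I) - 1 - y * Complex.I + (y : ℂ) ^ 2 / 2 =
      Complex.exp (y * Complex.I) - (0 + (y * Complex.I) ^ 0 / (Nat.factorial 0 : ℂ) +
        (y * Complex.I) ^ 1 / (Nat.factorial 1 : ℂ) + (y * Complex.I) ^ 2 / (Nat.factorial 2 : ℂ)) := by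
    simp only [Nat.factorial, mul_pow, Complex.I_sq]
    push_cast
    ring
  rw [e]
  refine h.trans ?_
  have : 0 ≤ |y| ^ 3 := by positivity
  simp only [Nat.factorial]
  norm_num
  linarith

theorem norm_exp_I_mul_sub_one_sub_le {y : ℝ} (hy : 1 < |y|) :
    ‖Complex.exp (y * Complex.I) - 1 - y * Complex.I‖ ≤ 3 * |y| := by
  refine (norm_sub_le _ _).trans ?_
  have h1 := norm_sub_le (Complex.exp (y * Complex.I)) 1
  rw [Complex.norm_exp_ofReal_mul_I, norm_one] at h1
  rw [norm_mul, Complex.norm_I, Complex.norm_real, Real.norm_eq_abs, mul_one]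
  linarith

/-- Second order expansion at `0` of the characteristic function of a centered variable with slowly
varying truncated second moment. -/
theorem norm_charFun_sub_le [IsProbabilityMeasure P] (hξ : Measurable ξ) (hi : Integrable ξ P)
    (hc : ∫ ω, ξ ω ∂P = 0) (hl : IsSlowlyVarying (truncSecondMoment ξ P)) {κ : ℝ} (hκ : 0 < κ) :
    ∃ u : ℝ, 0 < u ∧ ∀ x : ℝ, x ≠ 0 → |x| < u →
      ‖charFun (P.map ξ) x - 1 + ((x ^ 2 * truncSecondMoment ξ P (1 / |x|) / 2 : ℝ) : ℂ)‖ ≤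
        κ * (x ^ 2 * truncSecondMoment ξ P (1 / |x|)) := by
  have hκ5 : 0 < min (κ / 5) 1 := by positivity
  have hκ5' : min (κ / 5) 1 ≤ κ / 5 := min_le_left _ _
  have hκ1 : min (κ / 5) 1 ≤ 1 := min_le_right _ _
  set κ' := min (κ / 5) 1
  obtain ⟨X, hX1, hX⟩ := tailFirstMoment_le hξ hi hl hκ5
  obtain ⟨⟨A, hA, hpos, -⟩, hlim⟩ := hl
  obtain ⟨Y, hY⟩ := eventually_atTop.1
    ((hlim κ' hκ5).eventually_const_lt (sub_lt_self 1 hκ5))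
  set l := truncSecondMoment ξ P with hldef
  refine ⟨1 / max X (max A Y), by positivity, fun x hx hxu => ?_⟩
  have hx0 : 0 < |x| := abs_pos.2 hx
  have hxM : max X (max A Y) < 1 / |x| := by
    rw [lt_one_div (by positivity) hx0]; exact hxu
  have h1x : X ≤ 1 / |x| := (le_max_left _ _).trans hxM.le
  have h2x : A ≤ 1 / |x| := ((le_max_left _ _).trans (le_max_right _ _)).trans hxM.le
  have h3x : Y ≤ 1 / |x| := ((le_max_right _ _).trans (le_max_right _ _)).trans hxM.le
  have hlx := hpos _ h2x
  have hT := hX _ h1x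
  have hS := hY _ h3x
  rw [lt_div_iff₀ hlx] at hS
  set s := 1 / |x| with hs
  have hs0 : 0 < s := by positivity
  have hxs : |x| * s = 1 := by rw [hs]; field_simp
  have i1 := integrable_indicator_abs_le (P := P) hξ s
  have i2 := integrable_indicator_abs_le (P := P) hξ (κ' * s)
  have i3 := integrable_indicator_lt_abs hξ hi s
  have ie : Integrable (fun ω => Complex.exp ((x * ξ ω : ℝ) * Complex.I)) P := by
    refine Integrable.of_bound (C := 1) ?_ (Eventually.of_forall fun ω => ?_)
    · exact (Complex.measurable_exp.comp ((Complex.measurable_ofReal.comp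
        (hξ.const_mul x)).mul_const _)).aestronglyMeasurable
    · rw [Complex.norm_exp_ofReal_mul_I]
  have ix : Integrable (fun ω => ((x * ξ ω : ℝ) : ℂ) * Complex.I) P :=
    (hi.const_mul x).ofReal.mul_const _
  have il : Integrable (fun ω => ((x ^ 2 / 2 *
      {ω | |ξ ω| ≤ s}.indicator (fun ω => ξ ω ^ 2) ω : ℝ) : ℂ)) P := (i1.const_mul _).ofReal
  -- The linear term vanishes in mean, as `ξ` is centered.
  have hint : charFun (P.map ξ) x - 1 + ((x ^ 2 * l s / 2 : ℝ) : ℂ) =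
      ∫ ω, (Complex.exp ((x * ξ ω : ℝ) * Complex.I) - 1 - ((x * ξ ω : ℝ) : ℂ) * Complex.I +
        ((x ^ 2 / 2 * {ω | |ξ ω| ≤ s}.indicator (fun ω => ξ ω ^ 2) ω : ℝ) : ℂ)) ∂P := by
    have ie1 : Integrable (fun ω => Complex.exp ((x * ξ ω : ℝ) * Complex.I) - 1) P :=
      ie.sub (integrable_const _)
    have ie2 : Integrable (fun ω => Complex.exp ((x * ξ ω : ℝ) * Complex.I) - 1 -
      ((x * ξ ω : ℝ) : ℂ) * Complex.I) P := ie1.sub ix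
    rw [integral_add ie2 il, integral_sub ie1 ix, integral_sub ie (integrable_const _),
      integral_mul_const, integral_complex_ofReal, integral_complex_ofReal, integral_const_mul, integral_const_mul,
      hc, charFun_apply_real, integral_map hξ.aemeasurable (by fun_prop)]
    simp only [hldef, truncSecondMoment]
    simp only [integral_const, probReal_univ, one_smul]
    have e : ∫ ω, Complex.exp (x * ξ ω * Complex.I) ∂P =
        ∫ ω, Complex.exp (((x * ξ ω : ℝ) : ℂ) * Complex.I) ∂P := by
      simp only [Complex.ofReal_mul]
    rw [e]
    push_cast
    ring
  rw [hint]
  -- Taylor expansions of order two where `|ξ| ≤ s = 1 / |x|`, the cubic error being small for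
  -- `|ξ| ≤ κ' s`, and of order one beyond `s`.
  have hb : ∀ ω, ‖Complex.exp ((x * ξ ω : ℝ) * Complex.I) - 1 - ((x * ξ ω : ℝ) : ℂ) * Complex.I +
        ((x ^ 2 / 2 * {ω | |ξ ω| ≤ s}.indicator (fun ω => ξ ω ^ 2) ω : ℝ) : ℂ)‖ ≤
      κ' * x ^ 2 * {ω | |ξ ω| ≤ s}.indicator (fun ω => ξ ω ^ 2) ω +
      x ^ 2 * ({ω | |ξ ω| ≤ s}.indicator (fun ω => ξ ω ^ 2) ω -
        {ω | |ξ ω| ≤ κ' * s}.indicator (fun ω => ξ ω ^ 2) ω) +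
      3 * |x| * {ω | s < |ξ ω|}.indicator (fun ω => |ξ ω|) ω := by
    intro ω
    have hy : |x * ξ ω| = |x| * |ξ ω| := abs_mul _ _
    have hind0 : 0 ≤ {ω | |ξ ω| ≤ κ' * s}.indicator (fun ω => ξ ω ^ 2) ω :=
      Set.indicator_nonneg (fun _ _ => sq_nonneg _) _
    have hind1 : {ω | |ξ ω| ≤ κ' * s}.indicator (fun ω => ξ ω ^ 2) ω ≤ ξ ω ^ 2 :=
      Set.indicator_le_self' (fun _ _ => sq_nonneg _) _
    rcases le_or_gt |ξ ω| s with h1 | h1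
    · have hy1 : |x * ξ ω| ≤ 1 := by
        rw [hy, ← hxs]; gcongr
      have hb := norm_exp_I_mul_sub_le hy1
      rw [Set.indicator_of_mem (show ω ∈ {ω | |ξ ω| ≤ s} from h1),
        Set.indicator_of_notMem (show ω ∉ {ω | s < |ξ ω|} from not_lt.2 h1), mul_zero, add_zero]
      have e : ((x ^ 2 / 2 * ξ ω ^ 2 : ℝ) : ℂ) = ((x * ξ ω : ℝ) : ℂ) ^ 2 / 2 := by
        push_cast; ring
      rw [e]
      refine hb.trans ?_
      have e3 : |x * ξ ω| ^ 3 = |x * ξ ω| * (x ^ 2 * ξ ω ^ 2) := by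
        rw [pow_succ', sq_abs]; ring
      rw [e3]
      have hnn : 0 ≤ x ^ 2 * ξ ω ^ 2 := by positivity
      rcases le_or_gt |ξ ω| (κ' * s) with h2 | h2
      · have : |x * ξ ω| ≤ κ' := by
          calc |x * ξ ω| = |x| * |ξ ω| := hy
            _ ≤ |x| * (κ' * s) := by gcongr
            _ = κ' * (|x| * s) := by ring
            _ = κ' := by rw [hxs, mul_one]
        have h5 : |x * ξ ω| * (x ^ 2 * ξ ω ^ 2) ≤ κ' * (x ^ 2 * ξ ω ^ 2) := by gcongr
        have h6 : 0 ≤ x ^ 2 * (ξ ω ^ 2 -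
          {ω | |ξ ω| ≤ κ' * s}.indicator (fun ω => ξ ω ^ 2) ω) :=
          mul_nonneg (sq_nonneg _) (sub_nonneg.2 hind1)
        linarith
      · rw [Set.indicator_of_notMem (show ω ∉ {ω | |ξ ω| ≤ κ' * s} from not_le.2 h2)]
        have h5 : |x * ξ ω| * (x ^ 2 * ξ ω ^ 2) ≤ 1 * (x ^ 2 * ξ ω ^ 2) := by gcongr
        have h6 : 0 ≤ κ' * (x ^ 2 * ξ ω ^ 2) := by positivity
        linarith
    · have hy1 : 1 < |x * ξ ω| := by
        rw [hy, ← hxs]; gcongr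
      have hb := norm_exp_I_mul_sub_one_sub_le hy1
      rw [Set.indicator_of_notMem (show ω ∉ {ω | |ξ ω| ≤ s} from not_le.2 h1),
        Set.indicator_of_mem (show ω ∈ {ω | s < |ξ ω|} from h1), mul_zero, mul_zero,
        Complex.ofReal_zero, add_zero, zero_add, zero_sub]
      have h2 : κ' * s < |ξ ω| := lt_of_le_of_lt (by nlinarith) h1
      rw [Set.indicator_of_notMem (show ω ∉ {ω | |ξ ω| ≤ κ' * s} from not_le.2 h2)]
      rw [hy] at hb
      linarith
  refine (norm_integral_le_of_norm_le ?_ (Eventually.of_forall hb)).trans ?_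
  · exact ((i1.const_mul _).add ((i1.sub i2).const_mul _)).add (i3.const_mul _)
  have i4 : Integrable (fun ω => x ^ 2 * ({ω | |ξ ω| ≤ s}.indicator (fun ω => ξ ω ^ 2) ω -
      {ω | |ξ ω| ≤ κ' * s}.indicator (fun ω => ξ ω ^ 2) ω)) P := (i1.sub i2).const_mul _
  have i5 : Integrable (fun ω => κ' * x ^ 2 * {ω | |ξ ω| ≤ s}.indicator (fun ω => ξ ω ^ 2) ω +
      x ^ 2 * ({ω | |ξ ω| ≤ s}.indicator (fun ω => ξ ω ^ 2) ω -
      {ω | |ξ ω| ≤ κ' * s}.indicator (fun ω => ξ ω ^ 2) ω)) P := (i1.const_mul _).add i4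
  rw [integral_add i5 (i3.const_mul _), integral_add (i1.const_mul _) i4, integral_const_mul, integral_const_mul,
    integral_const_mul, integral_sub i1 i2]
  change κ' * x ^ 2 * l s + x ^ 2 * (l s - l (κ' * s)) + 3 * |x| * tailFirstMoment ξ P s ≤ _
  have e1 : x ^ 2 * (l s - l (κ' * s)) ≤ x ^ 2 * (κ' * l s) := by gcongr; linarith
  have e2 : 3 * |x| * tailFirstMoment ξ P s ≤ 3 * |x| * (κ' * (l s / s)) := by gcongr
  have e3 : |x| * (l s / s) = x ^ 2 * l s := by
    rw [hs, ← sq_abs]; field_simp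
  have e4 : 3 * |x| * (κ' * (l s / s)) = 3 * κ' * (x ^ 2 * l s) := by rw [← e3]; ring
  have e5 : 5 * κ' * (x ^ 2 * l s) ≤ κ * (x ^ 2 * l s) := by gcongr; linarith
  linarith
end TruncatedMoments

/-! ### The truncation levels -/

/-- The levels `η_n` tend to infinity and `η_n ^ 2` is of the order of `n * l(η_n)`. -/
theorem truncLevel_spec {l : ℝ → ℝ} (hm : Monotone l) (hl : IsSlowlyVarying l) :
    Tendsto (truncLevel l) atTop atTop ∧
      ∀ᶠ n : ℕ in atTop, 1 ≤ truncLevel l n ∧ 0 < truncVar l n ∧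
        n * truncVar l n ≤ 4 * truncLevel l n ^ 2 ∧ truncLevel l n ^ 2 ≤ 4 * (n * truncVar l n) := by
  obtain ⟨X, hX1, hpos, hX⟩ := hl.potter one_pos
  set b := truncStart l with hb
  have hbdd : BddBelow {x : ℝ | 1 ≤ x ∧ 0 < l x} := ⟨1, fun x hx => hx.1⟩
  have hne : {x : ℝ | 1 ≤ x ∧ 0 < l x}.Nonempty := ⟨X, hX1, hpos X le_rfl⟩
  have hb1 : 1 ≤ b := le_csInf hne fun x hx => hx.1
  have hlb : 0 < l (b + 1) := by
    obtain ⟨x, hx, hxb⟩ := exists_lt_of_csInf_lt hne (lt_add_one b)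
    exact hx.2.trans_le (hm hxb.le)
  let A : ℕ → Set ℝ := fun n => {s : ℝ | b + 1 ≤ s ∧ l s / s ^ 2 ≤ 1 / (n : ℝ)}
  have hη : ∀ n, truncLevel l n = sInf (A n) := fun n => rfl
  have hAb : ∀ n, BddBelow (A n) := fun n => ⟨b + 1, fun s hs => hs.1⟩
  have hAne : ∀ n : ℕ, 0 < n → (A n).Nonempty := by
    intro n hn
    have hn0 : (0 : ℝ) < n := Nat.cast_pos.2 hn
    have hlX := hpos X le_rfl
    refine ⟨max (max X (b + 1)) (2 * l X / X * n), (le_max_right _ _).trans (le_max_left _ _), ?_⟩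
    set s := max (max X (b + 1)) (2 * l X / X * n)
    have hs1 : X ≤ s := (le_max_left _ _).trans (le_max_left _ _)
    have hs2 : 2 * l X / X * n ≤ s := le_max_right _ _
    have hs0 : 0 < s := by linarith
    have h1 := (hX X le_rfl s hs1).1
    rw [Real.rpow_one] at h1
    rw [div_le_div_iff₀ (by positivity) hn0]
    calc l s * n ≤ 2 * (s / X) * l X * n := by gcongr
      _ = s * (2 * l X / X * n) := by ring
      _ ≤ s * s := by gcongr
      _ = 1 * s ^ 2 := by ring
  have htend : Tendsto (truncLevel l) atTop atTop := by
    refine tendsto_atTop.2 fun S => ?_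
    set S' := max S (b + 1)
    have hS0 : 0 < S' := lt_of_lt_of_le (by linarith) (le_max_right S (b + 1))
    filter_upwards [tendsto_natCast_atTop_atTop.eventually_gt_atTop (S' ^ 2 / l (b + 1)),
      eventually_gt_atTop 0] with n hn hn1
    have hn0 : (0 : ℝ) < n := Nat.cast_pos.2 hn1
    refine (le_max_left S (b + 1)).trans ?_
    rw [hη]
    refine le_csInf (hAne n hn1) fun s hs => ?_
    by_contra hlt
    rw [not_le] at hlt
    have hs0 : 0 < s := by linarith [hs.1]
    have h1 := hs.2
    rw [div_le_div_iff₀ (by positivity) hn0] at h1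
    have h2 : l (b + 1) ≤ l s := hm hs.1
    rw [div_lt_iff₀ hlb] at hn
    have h3 : s ^ 2 ≤ S' ^ 2 := by gcongr
    nlinarith
  refine ⟨htend, ?_⟩
  filter_upwards [htend.eventually_ge_atTop (2 * (b + 1)), eventually_gt_atTop 0] with n hn hn1
  have hn0 : (0 : ℝ) < n := Nat.cast_pos.2 hn1
  set η := truncLevel l n
  have hη0 : 0 < η := by linarith
  refine ⟨by linarith, hlb.trans_le (hm (by linarith)), ?_, ?_⟩
  · -- some point of the defining set lies below `2 * η`
    obtain ⟨s, hs, hsη⟩ := exists_lt_of_csInf_lt (hAne n hn1) (show sInf (A n) < 2 * η by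
      change η < 2 * η; linarith)
    have hs1 : η ≤ s := csInf_le (hAb n) hs
    have hs0 : 0 < s := by linarith
    have h1 := hs.2
    rw [div_le_div_iff₀ (by positivity) hn0] at h1
    have h2 : l η ≤ l s := hm hs1
    have h3 : s ^ 2 ≤ (2 * η) ^ 2 := by gcongr
    change n * l η ≤ _
    nlinarith
  · -- `η / 2` does not belong to the defining set
    have h1 : η / 2 ∉ A n := fun h => by
      have : η ≤ η / 2 := csInf_le (hAb n) h
      linarith
    have h2 : 1 / (n : ℝ) < l (η / 2) / (η / 2) ^ 2 := by
      by_contra h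
      exact h1 ⟨by linarith, not_lt.1 h⟩
    rw [div_lt_div_iff₀ hn0 (by positivity)] at h2
    have h3 : l (η / 2) ≤ l η := hm (by linarith)
    change _ ≤ 4 * (n * l η)
    nlinarith

/-! ### Series of independent centered variables -/

section IndependentSeries

variable {Ω : Type*} [MeasurableSpace Ω] {P : Measure Ω} [IsProbabilityMeasure P]

theorem lintegral_sq_finset_sum {ι : Type*} {Y : ι → Ω → ℝ}
    (hY : iIndepFun Y P) (h2 : ∀ r, MemLp (Y r) 2 P) (h0 : ∀ r, ∫ ω, Y r ω ∂P = 0) (s : Finset ι) :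
    ∫⁻ ω, ENNReal.ofReal ((∑ r ∈ s, Y r ω) ^ 2) ∂P =
      ∑ r ∈ s, ENNReal.ofReal (∫ ω, Y r ω ^ 2 ∂P) := by
  have hs : MemLp (∑ r ∈ s, Y r) 2 P := memLp_finsetSum' s fun r _ => h2 r
  have hz : ∫ ω, (∑ r ∈ s, Y r) ω ∂P = 0 := by
    simp only [Finset.sum_apply]
    rw [integral_finsetSum _ fun r _ => (h2 r).integrable one_le_two]
    exact Finset.sum_eq_zero fun r _ => h0 r
  have hv := IndepFun.variance_sum (s := s) (X := Y) (μ := P) (fun r _ => h2 r)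
    fun i _ j _ hij => hY.indepFun hij
  rw [variance_of_integral_eq_zero hs.aemeasurable hz,
    Finset.sum_congr rfl fun r _ => variance_of_integral_eq_zero (h2 r).aemeasurable (h0 r)] at hv
  rw [← ENNReal.ofReal_sum_of_nonneg fun r _ => integral_nonneg fun ω => sq_nonneg _]
  rw [← ofReal_integral_eq_lintegral_ofReal]
  · congr 1
    simpa using hv
  · simpa using hs.integrable_sq
  · exact Eventually.of_forall fun ω => sq_nonneg _

variable {Y : ℕ → Ω → ℝ} {v c : ℕ → ℝ}

theorem lintegral_sq_weighted_sum_le (hY : iIndepFun Y P)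
    (h2 : ∀ r, MemLp (Y r) 2 P) (h0 : ∀ r, ∫ ω, Y r ω ∂P = 0)
    (hv : ∀ r, ∫ ω, Y r ω ^ 2 ∂P ≤ v r) (s : Finset ℕ) :
    ∫⁻ ω, ENNReal.ofReal ((∑ r ∈ s, c r * Y r ω) ^ 2) ∂P ≤
      ∑' r, ENNReal.ofReal (c r ^ 2 * v r) := by
  have h := lintegral_sq_finset_sum (Y := fun r ω => c r * Y r ω)
    (hY.comp (fun r y => c r * y) fun r => measurable_const_mul _) (fun r => (h2 r).const_mul _)
    (fun r => by rw [integral_const_mul, h0, mul_zero]) s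
  rw [h]
  refine le_trans (Finset.sum_le_sum fun r _ => ?_) (ENNReal.sum_le_tsum s)
  refine ENNReal.ofReal_le_ofReal ?_
  simp only [mul_pow]
  rw [integral_const_mul]
  exact mul_le_mul_of_nonneg_left (hv r) (sq_nonneg _)

/-- Fatou's lemma for the limit of the partial sums of an independent centered series. -/
theorem lintegral_sq_limit_le (hm : ∀ r, Measurable (Y r)) (hY : iIndepFun Y P)
    (h2 : ∀ r, MemLp (Y r) 2 P) (h0 : ∀ r, ∫ ω, Y r ω ∂P = 0)
    (hv : ∀ r, ∫ ω, Y r ω ^ 2 ∂P ≤ v r) {Z : Ω → ℝ}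
    (hZ : ∀ᵐ ω ∂P, Tendsto (fun N => ∑ r ∈ Finset.range N, c r * Y r ω) atTop (𝓝 (Z ω))) :
    ∫⁻ ω, ENNReal.ofReal (Z ω ^ 2) ∂P ≤ ∑' r, ENNReal.ofReal (c r ^ 2 * v r) := by
  have h1 : ∫⁻ ω, ENNReal.ofReal (Z ω ^ 2) ∂P ≤ ∫⁻ ω, liminf (fun N =>
      ENNReal.ofReal ((∑ r ∈ Finset.range N, c r * Y r ω) ^ 2)) atTop ∂P := by
    refine lintegral_mono_ae ?_
    filter_upwards [hZ] with ω hω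
    exact (ENNReal.tendsto_ofReal (hω.pow 2)).liminf_eq.ge
  refine h1.trans ((lintegral_liminf_le fun N => ?_).trans ?_)
  · exact ENNReal.measurable_ofReal.comp
      ((Finset.measurable_sum _ fun r _ => (hm r).const_mul _).pow_const 2)
  · refine liminf_le_of_le (by isBoundedDefault) fun b hb => ?_
    obtain ⟨N, hN⟩ := hb.exists
    exact hN.trans (lintegral_sq_weighted_sum_le hY h2 h0 hv _)

/-- An independent centered series with summable variances converges almost surely, being a
martingale bounded in `L²`. -/
theorem ae_exists_tendsto_sum (hm : ∀ r, Measurable (Y r)) (hY : iIndepFun Y P)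
    (h2 : ∀ r, MemLp (Y r) 2 P) (h0 : ∀ r, ∫ ω, Y r ω ∂P = 0)
    (hv : ∀ r, ∫ ω, Y r ω ^ 2 ∂P ≤ v r) (hs : ∑' r, ENNReal.ofReal (c r ^ 2 * v r) ≠ ∞) :
    ∀ᵐ ω ∂P, ∃ z, Tendsto (fun N => ∑ r ∈ Finset.range N, c r * Y r ω) atTop (𝓝 z) := by
  have hsm : ∀ r, StronglyMeasurable (Y r) := fun r => (hm r).stronglyMeasurable
  have hi : ∀ r, Integrable (Y r) P := fun r => (h2 r).integrable one_le_two
  set 𝓕 := Filtration.natural Y hsm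
  let f : ℕ → Ω → ℝ := fun N ω => ∑ r ∈ Finset.range (N + 1), c r * Y r ω
  have hint : ∀ N, Integrable (f N) P := fun N =>
    integrable_finsetSum _ fun r _ => (hi r).const_mul _
  have hmart : Martingale f 𝓕 P := by
    refine martingale_of_condExp_sub_eq_zero_nat (fun N => ?_) hint fun N => ?_
    · refine Finset.stronglyMeasurable_fun_sum _ fun r hr => StronglyMeasurable.const_mul ?_ _
      exact ((Filtration.stronglyAdapted_natural hsm) r).mono
        (𝓕.mono (Nat.lt_succ_iff.1 (Finset.mem_range.1 hr)))
    · have e : f (N + 1) - f N = c (N + 1) • Y (N + 1) := by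
        ext ω
        simp only [f, Pi.sub_apply, Pi.smul_apply, smul_eq_mul]
        rw [Finset.sum_range_succ _ (N + 1), add_sub_cancel_left]
      rw [e]
      refine (condExp_smul _ _ _).trans ?_
      filter_upwards [hY.condExp_natural_ae_eq_of_lt hsm (Nat.lt_succ_self N)] with ω hω
      have hω' : (P[Y (N + 1) | 𝓕 N]) ω = _ := hω
      simp only [Pi.smul_apply, hω', h0, smul_zero, Pi.zero_apply]
  have hbd : ∀ N, eLpNorm (f N) 1 P ≤ ((1 + ∑' r, ENNReal.ofReal (c r ^ 2 * v r)).toNNReal : ℝ≥0∞) := by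
    intro N
    rw [ENNReal.coe_toNNReal (by simpa using hs), eLpNorm_one_eq_lintegral_enorm]
    calc ∫⁻ ω, ‖f N ω‖ₑ ∂P ≤ ∫⁻ ω, (1 + ENNReal.ofReal (f N ω ^ 2)) ∂P := by
          refine lintegral_mono fun ω => ?_
          rw [Real.enorm_eq_ofReal_abs, ← ENNReal.ofReal_one,
            ← ENNReal.ofReal_add zero_le_one (sq_nonneg _)]
          refine ENNReal.ofReal_le_ofReal ?_
          rw [← sq_abs (f N ω)]
          nlinarith [sq_nonneg (|f N ω| - 1), abs_nonneg (f N ω)]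
      _ = 1 + ∫⁻ ω, ENNReal.ofReal (f N ω ^ 2) ∂P := by
          rw [lintegral_add_left measurable_const]; simp
      _ ≤ _ := by
          gcongr
          exact lintegral_sq_weighted_sum_le hY h2 h0 hv _
  filter_upwards [hmart.submartingale.exists_ae_tendsto_of_bdd hbd] with ω ⟨z, hz⟩
  exact ⟨z, (tendsto_add_atTop_iff_nat 1).1 hz⟩

theorem norm_prod_sub_prod_le {ι : Type*} (s : Finset ι) {z w : ι → ℂ} (hz : ∀ i, ‖z i‖ ≤ 1)
    (hw : ∀ i, ‖w i‖ ≤ 1) : ‖∏ i ∈ s, z i - ∏ i ∈ s, w i‖ ≤ ∑ i ∈ s, ‖z i - w i‖ := by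
  classical
  induction s using Finset.induction_on with
  | empty => simp
  | insert i s hi ih =>
    rw [Finset.prod_insert hi, Finset.prod_insert hi, Finset.sum_insert hi]
    have e : z i * ∏ j ∈ s, z j - w i * ∏ j ∈ s, w j =
        (z i - w i) * ∏ j ∈ s, z j + w i * (∏ j ∈ s, z j - ∏ j ∈ s, w j) := by ring
    rw [e]
    refine (norm_add_le _ _).trans (add_le_add ?_ ?_)
    · rw [norm_mul]
      refine mul_le_of_le_one_right (norm_nonneg _) ?_
      rw [norm_prod]
      exact Finset.prod_le_one (fun _ _ => norm_nonneg _) fun j _ => hz j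
    · rw [norm_mul]
      exact (mul_le_of_le_one_left (norm_nonneg _) (hw i)).trans ih

/-- The characteristic function, at `1`, of an almost sure limit of weighted sums of independent
copies of `ξ`, compared with a Gaussian one. -/
theorem norm_charFun_limit_sub_le {e : ℕ → Ω → ℝ} {ξ Z : Ω → ℝ} (he : ∀ r, Measurable (e r))
    (hind : iIndepFun e P) (hid : ∀ r, IdentDistrib (e r) ξ P P)
    (hZ : ∀ᵐ ω ∂P, Tendsto (fun N => ∑ r ∈ Finset.range N, c r * e r ω) atTop (𝓝 (Z ω)))
    (hZm : AEMeasurable Z P)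
    {g E : ℕ → ℝ} (hg : ∀ r, 0 ≤ g r) (hgs : Summable g) (hEs : Summable E)
    (hE : ∀ r, ‖charFun (P.map ξ) (c r) - Complex.exp (-(g r : ℂ))‖ ≤ E r) :
    ‖charFun (P.map Z) 1 - Complex.exp (-((∑' r, g r : ℝ) : ℂ))‖ ≤ ∑' r, E r := by
  have hm : ∀ N, Measurable (fun ω => ∑ r ∈ Finset.range N, c r * e r ω) := fun N =>
    Finset.measurable_sum _ fun r _ => (he r).const_mul _
  have hprod : ∀ N, charFun (P.map fun ω => ∑ r ∈ Finset.range N, c r * e r ω) 1 =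
      ∏ r ∈ Finset.range N, charFun (P.map ξ) (c r) := by
    intro N
    have hi : iIndepFun (fun r ω => c r * e r ω) P :=
      hind.comp (fun r y => c r * y) fun r => measurable_const_mul _
    rw [(hi.restrict _).charFun_map_fun_finsetSum_eq_prod fun r _ => ((he r).const_mul _).aemeasurable]
    rw [Finset.prod_apply]
    refine Finset.prod_congr rfl fun r _ => ?_
    rw [charFun_map_mul_comp (he r).aemeasurable, (hid r).map_eq, mul_one]
  have hlim : Tendsto (fun N => charFun (P.map fun ω => ∑ r ∈ Finset.range N, c r * e r ω) 1) atTop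
      (𝓝 (charFun (P.map Z) 1)) := by
    simp only [charFun_apply_real]
    rw [integral_map hZm (by fun_prop)]
    have : ∀ N, ∫ x, Complex.exp ((1 : ℝ) * x * Complex.I)
        ∂(P.map fun ω => ∑ r ∈ Finset.range N, c r * e r ω) =
        ∫ ω, Complex.exp ((1 : ℝ) * ((∑ r ∈ Finset.range N, c r * e r ω : ℝ) : ℂ) * Complex.I) ∂P :=
      fun N => integral_map (hm N).aemeasurable (by fun_prop)
    simp only [this]
    refine tendsto_integral_of_dominated_convergence (fun _ => 1) (fun N => ?_)
      (integrable_const _) (fun N => Eventually.of_forall fun ω => ?_) ?_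
    · have : Measurable fun ω => ((∑ r ∈ Finset.range N, c r * e r ω : ℝ) : ℂ) :=
        Complex.measurable_ofReal.comp (hm N)
      exact (Complex.measurable_exp.comp ((this.const_mul _).mul_const _)).aestronglyMeasurable
    · rw [← Complex.ofReal_mul, Complex.norm_exp_ofReal_mul_I]
    · filter_upwards [hZ] with ω hω
      have hc : Continuous fun x : ℝ => Complex.exp ((1 : ℝ) * (x : ℂ) * Complex.I) := by fun_prop
      exact (hc.tendsto _).comp hω
  have hexp : Tendsto (fun N => ∏ r ∈ Finset.range N, Complex.exp (-(g r : ℂ))) atTop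
      (𝓝 (Complex.exp (-((∑' r, g r : ℝ) : ℂ)))) := by
    have h1 := hgs.hasSum.tendsto_sum_nat
    have hc : Continuous fun x : ℝ => Complex.exp (-(x : ℂ)) := by fun_prop
    refine ((hc.tendsto _).comp h1).congr fun N => ?_
    simp only [Function.comp]
    rw [← Complex.exp_sum]
    push_cast
    rw [Finset.sum_neg_distrib]
  refine le_of_tendsto (hlim.sub hexp).norm (Eventually.of_forall fun N => ?_)
  rw [hprod]
  have : IsProbabilityMeasure (P.map ξ) :=
    Measure.isProbabilityMeasure_map (hid 0).aemeasurable_snd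
  refine (norm_prod_sub_prod_le _ (fun r => norm_charFun_le_one _) fun r => ?_).trans ?_
  · rw [← Complex.ofReal_neg, Complex.norm_exp_ofReal, Real.exp_le_one_iff]
    linarith [hg r]
  · refine (Finset.sum_le_sum fun r _ => hE r).trans ?_
    exact hEs.sum_le_tsum _ fun r _ => (norm_nonneg _).trans (hE r)

end IndependentSeries

/-! ### Centered truncation -/

section Truncation

variable {Ω : Type*} [MeasurableSpace Ω] {P : Measure Ω}

/-- The truncated mean `E ξ 1(|ξ| ≤ T)`. -/
noncomputable def truncMean (ξ : Ω → ℝ) (P : Measure Ω) (T : ℝ) : ℝ :=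
  ∫ ω, {ω | |ξ ω| ≤ T}.indicator ξ ω ∂P

/-- The truncation of `y` at level `T`, recentered by `m`. -/
noncomputable def truncCore (m T y : ℝ) : ℝ := (if |y| ≤ T then y else 0) - m

/-- The part of `y` removed by the recentered truncation. -/
noncomputable def truncRest (m T y : ℝ) : ℝ := (if |y| ≤ T then 0 else y) + m

theorem truncCore_add_truncRest (m T y : ℝ) : truncCore m T y + truncRest m T y = y := by
  unfold truncCore truncRest; split_ifs <;> ring

theorem measurable_truncCore (m T : ℝ) : Measurable (truncCore m T) := by
  unfold truncCore
  exact (Measurable.ite (measurableSet_le continuous_abs.measurable measurable_const)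
    measurable_id measurable_const).sub_const _

theorem measurable_truncRest (m T : ℝ) : Measurable (truncRest m T) := by
  unfold truncRest
  exact (Measurable.ite (measurableSet_le continuous_abs.measurable measurable_const)
    measurable_const measurable_id).add_const _

variable {ξ : Ω → ℝ}

theorem abs_truncCore_le (m : ℝ) {T : ℝ} (hT : 0 ≤ T) (y : ℝ) : |truncCore m T y| ≤ T + |m| := by
  unfold truncCore
  refine (abs_sub _ _).trans ?_
  gcongr
  split_ifs with h
  · exact h
  · simpa using hT

theorem memLp_truncCore [IsFiniteMeasure P] (hξ : Measurable ξ) (m : ℝ) {T : ℝ} (hT : 0 ≤ T) :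
    MemLp (fun ω => truncCore m T (ξ ω)) 2 P :=
  MemLp.of_bound ((measurable_truncCore m T).comp hξ).aestronglyMeasurable (T + |m|)
    (Eventually.of_forall fun _ => abs_truncCore_le m hT _)

theorem integrable_indicator_trunc (hξ : Measurable ξ) (hi : Integrable ξ P) (T : ℝ) :
    Integrable ({ω | |ξ ω| ≤ T}.indicator ξ) P := hi.indicator (measurableSet_abs_le hξ T)

theorem integral_truncCore [IsProbabilityMeasure P] (hξ : Measurable ξ) (hi : Integrable ξ P)
    (T : ℝ) : ∫ ω, truncCore (truncMean ξ P T) T (ξ ω) ∂P = 0 := by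
  have e : ∀ ω, truncCore (truncMean ξ P T) T (ξ ω) =
      {ω | |ξ ω| ≤ T}.indicator ξ ω - truncMean ξ P T := fun ω => rfl
  simp only [e]
  rw [integral_sub (integrable_indicator_trunc hξ hi T) (integrable_const _)]
  simp [truncMean]

theorem integral_sq_truncCore_le [IsProbabilityMeasure P] (hξ : Measurable ξ) (hi : Integrable ξ P)
    (T : ℝ) :
    ∫ ω, truncCore (truncMean ξ P T) T (ξ ω) ^ 2 ∂P ≤ truncSecondMoment ξ P T := by
  have e : ∀ ω, truncCore (truncMean ξ P T) T (ξ ω) ^ 2 =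
      {ω | |ξ ω| ≤ T}.indicator (fun ω => ξ ω ^ 2) ω -
        2 * truncMean ξ P T * {ω | |ξ ω| ≤ T}.indicator ξ ω + truncMean ξ P T ^ 2 := by
    intro ω
    simp only [truncCore, Set.indicator, Set.mem_ofPred_eq]
    split_ifs <;> ring
  have i1 := integrable_indicator_abs_le (P := P) hξ T
  have i2 := (integrable_indicator_trunc hξ hi T).const_mul (2 * truncMean ξ P T)
  have i3 : Integrable (fun ω => {ω | |ξ ω| ≤ T}.indicator (fun ω => ξ ω ^ 2) ω -
        2 * truncMean ξ P T * {ω | |ξ ω| ≤ T}.indicator ξ ω) P := i1.sub i2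
  simp only [e]
  rw [integral_add i3 (integrable_const _), integral_sub i1 i2, integral_const_mul]
  change truncSecondMoment ξ P T - 2 * truncMean ξ P T * truncMean ξ P T + _ ≤ _
  simp only [integral_const, probReal_univ, one_smul]
  nlinarith [sq_nonneg (truncMean ξ P T)]

theorem abs_truncMean_le (hξ : Measurable ξ) (hi : Integrable ξ P) (hc : ∫ ω, ξ ω ∂P = 0) (T : ℝ) :
    |truncMean ξ P T| ≤ tailFirstMoment ξ P T := by
  have h : truncMean ξ P T = -∫ ω, {ω | T < |ξ ω|}.indicator ξ ω ∂P := by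
    have h1 := integral_add (integrable_indicator_trunc hξ hi T)
      (hi.indicator (measurableSet_lt_abs hξ T))
    have e : ∀ ω, {ω | |ξ ω| ≤ T}.indicator ξ ω + {ω | T < |ξ ω|}.indicator ξ ω = ξ ω := by
      intro ω
      simp only [Set.indicator, Set.mem_ofPred_eq]
      rcases le_or_gt |ξ ω| T with h | h
      · rw [if_pos h, if_neg h.not_gt, add_zero]
      · rw [if_neg h.not_ge, if_pos h, zero_add]
    simp only [e, hc] at h1
    change 0 = truncMean ξ P T + _ at h1
    linarith
  rw [h, abs_neg]
  refine (abs_integral_le_integral_abs).trans (le_of_eq ?_)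
  refine integral_congr_ae (Eventually.of_forall fun ω => ?_)
  simp only [Set.indicator]
  split_ifs <;> simp

/-- The removed part consists of the tail of `ξ` and of the truncated mean, which is itself bounded
by the tail since `ξ` is centered. -/
theorem lintegral_truncRest_le [IsProbabilityMeasure P] (hξ : Measurable ξ) (hi : Integrable ξ P)
    (hc : ∫ ω, ξ ω ∂P = 0) (T : ℝ) :
    ∫⁻ ω, ENNReal.ofReal |truncRest (truncMean ξ P T) T (ξ ω)| ∂P ≤
      ENNReal.ofReal (2 * tailFirstMoment ξ P T) := by
  calc _ ≤ ∫⁻ ω, (ENNReal.ofReal ({ω | T < |ξ ω|}.indicator (fun ω => |ξ ω|) ω) +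
        ENNReal.ofReal (tailFirstMoment ξ P T)) ∂P := by
        refine lintegral_mono fun ω => ?_
        rw [← ENNReal.ofReal_add (Set.indicator_nonneg (fun _ _ => abs_nonneg _) _)
          (tailFirstMoment_nonneg T)]
        refine ENNReal.ofReal_le_ofReal ?_
        refine (abs_add_le _ _).trans (add_le_add (le_of_eq ?_) (abs_truncMean_le hξ hi hc T))
        simp only [Set.indicator, Set.mem_ofPred_eq]
        rcases le_or_gt |ξ ω| T with h | h
        · rw [if_pos h, if_neg h.not_gt, abs_zero]
        · rw [if_neg h.not_ge, if_pos h]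
    _ = _ := by
        rw [lintegral_add_right _ measurable_const,
          ← ofReal_integral_eq_lintegral_ofReal (integrable_indicator_lt_abs hξ hi T)
            (Eventually.of_forall fun ω => Set.indicator_nonneg (fun _ _ => abs_nonneg _) _),
          lintegral_const, measure_univ, mul_one]
        change ENNReal.ofReal (tailFirstMoment ξ P T) + _ = _
        rw [← ENNReal.ofReal_add (tailFirstMoment_nonneg T) (tailFirstMoment_nonneg T), two_mul]

end Truncation

/-! ### Weighted sums over the rescaled index -/

theorem one_add_le_two_mul_floor {n : ℕ} (hn : 0 < n) (x : ℝ) :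
    1 + x ≤ 2 * (1 + (⌊(n : ℝ) * x⌋₊ : ℝ) / n) := by
  have hn0 : (0 : ℝ) < n := Nat.cast_pos.2 hn
  have hn1 : (1 : ℝ) ≤ n := Nat.one_le_cast.2 hn
  have h1 : (n : ℝ) * x < ⌊(n : ℝ) * x⌋₊ + 1 := Nat.lt_floor_add_one _
  have h2 : x < ((⌊(n : ℝ) * x⌋₊ : ℝ) + 1) / n := by
    rw [lt_div_iff₀ hn0, mul_comm]; exact h1
  have h3 : ((⌊(n : ℝ) * x⌋₊ : ℝ) + 1) / n ≤ (⌊(n : ℝ) * x⌋₊ : ℝ) / n + 1 := by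
    rw [add_div]; gcongr; exact (div_le_one hn0).2 hn1
  have h4 : 0 ≤ (⌊(n : ℝ) * x⌋₊ : ℝ) / n := by positivity
  linarith

theorem one_add_floor_rpow_le {n : ℕ} (hn : 0 < n) {q x : ℝ} (hq : 0 ≤ q) (hx : 0 < x) :
    (1 + (⌊(n : ℝ) * x⌋₊ : ℝ) / n) ^ (-q) ≤ 2 ^ q * (1 + x) ^ (-q) := by
  have h := one_add_le_two_mul_floor hn x
  have h1 : (2 * (1 + (⌊(n : ℝ) * x⌋₊ : ℝ) / n)) ^ (-q) ≤ (1 + x) ^ (-q) :=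
    Real.rpow_le_rpow_of_nonpos (by linarith) h (by linarith)
  rw [Real.mul_rpow (by norm_num) (by positivity), Real.rpow_neg (by norm_num)] at h1
  have h2 : (0 : ℝ) < 2 ^ q := by positivity
  rwa [inv_mul_le_iff₀ h2] at h1

theorem integrableOn_one_add_rpow {q : ℝ} (hq : 1 < q) :
    IntegrableOn (fun x : ℝ => (1 + x) ^ (-q)) (Set.Ioi 0) := by
  have := integrableOn_add_rpow_Ioi_of_lt (a := -q) (c := 0) (m := 1) (by linarith) (by norm_num)
  simpa only [add_comm] using this

theorem exists_tsum_one_add_rpow_le {q : ℝ} (hq : 1 < q) :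
    ∃ K : ℝ, 0 < K ∧ ∀ n : ℕ, 0 < n → Summable (fun r : ℕ => (1 + (r : ℝ) / n) ^ (-q)) ∧
      ∑' r : ℕ, (1 + (r : ℝ) / n) ^ (-q) ≤ K * n := by
  have hint := integrableOn_one_add_rpow hq
  set J := ∫ x in Set.Ioi (0 : ℝ), (1 + x) ^ (-q)
  have hJ : 0 ≤ J := setIntegral_nonneg measurableSet_Ioi fun x hx => by
    have : 0 < x := hx
    positivity
  refine ⟨2 ^ q * J + 1, by positivity, fun n hn => ?_⟩
  have hn0 : (0 : ℝ) < n := Nat.cast_pos.2 hn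
  have hs : Summable (fun r : ℕ => (1 + (r : ℝ) / n) ^ (-q)) := by
    rw [← integrableOn_floor_mul_iff hn]
    refine Integrable.mono' (hint.const_mul (2 ^ q)) ?_ ?_
    · exact ((measurable_of_countable fun r : ℕ => (1 + (r : ℝ) / n) ^ (-q)).comp
        (measurable_floor_mul n)).aestronglyMeasurable
    · filter_upwards [ae_restrict_mem measurableSet_Ioi] with x hx
      rw [Real.norm_of_nonneg (by positivity)]
      exact one_add_floor_rpow_le hn (by linarith) hx
  refine ⟨hs, ?_⟩
  have h1 := integral_floor_mul hn hs
  have h2 : ∫ x in Set.Ioi (0 : ℝ), (1 + ((⌊(n : ℝ) * x⌋₊ : ℕ) : ℝ) / n) ^ (-q) ≤ 2 ^ q * J := by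
    rw [← integral_const_mul]
    refine setIntegral_mono_on ((integrableOn_floor_mul_iff hn _).2 hs) (hint.const_mul _)
      measurableSet_Ioi fun x hx => one_add_floor_rpow_le hn (by linarith) hx
  rw [h1, inv_mul_le_iff₀ hn0] at h2
  nlinarith

/-! ### Coefficients of the linear process -/

/-- The coefficient of `ε_{K-r}` in `X_{K-d}`. -/
noncomputable def shiftCoeff (a : ℕ → ℝ) (d r : ℕ) : ℝ := if d ≤ r then a (r - d) else 0

/-- The coefficients of a partial sum telescope into a sum of `a` over a window of length `m`. For
`r + 1 < n` the truncated subtractions leave out the negative indices, where `a` would be zero. -/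
theorem sum_shiftCoeff (a : ℕ → ℝ) {m n : ℕ} (hm : m ≤ n) (r : ℕ) :
    ∑ i ∈ Finset.Icc 1 m, shiftCoeff a (n - i) r =
      ∑ j ∈ Finset.range (m + r + 1 - n), a j - ∑ j ∈ Finset.range (r + 1 - n), a j := by
  induction m with
  | zero => simp
  | succ m ih =>
    rw [Finset.sum_Icc_succ_top (by omega), ih (by omega)]
    unfold shiftCoeff
    split_ifs with h
    · have e1 : m + 1 + r + 1 - n = (m + r + 1 - n) + 1 := by omega
      have e2 : r - (n - (m + 1)) = m + r + 1 - n := by omega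
      rw [e1, Finset.sum_range_succ, e2]; ring
    · have e1 : m + 1 + r + 1 - n = 0 := by omega
      have e2 : m + r + 1 - n = 0 := by omega
      rw [e1, e2, add_zero]

theorem sum_abs_shiftCoeff_le (a : ℕ → ℝ) (n r : ℕ) :
    ∑ d ∈ Finset.range n, |shiftCoeff a d r| ≤ ∑ j ∈ Finset.range (r + 1), |a j| := by
  have h1 : ∀ d, |shiftCoeff a d r| = if d ≤ r then |a (r - d)| else 0 := by
    intro d; unfold shiftCoeff; split_ifs <;> simp
  simp only [h1]
  rw [← Finset.sum_filter]
  have h2 : ∑ j ∈ Finset.range (r + 1), |a j| = ∑ d ∈ Finset.range (r + 1), |a (r - d)| := by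
    rw [← Finset.sum_range_reflect]
    simp
  rw [h2]
  refine Finset.sum_le_sum_of_subset_of_nonneg (fun d hd => ?_) fun _ _ _ => abs_nonneg _
  simp only [Finset.mem_filter, Finset.mem_range] at hd ⊢
  omega

namespace IsPotterSequence

variable {a : ℕ → ℝ} {α δ C : ℝ} {N : ℕ}

/-- Far from the origin the shifted coefficients decay like a power. -/
theorem abs_shiftCoeff_le_far (h : IsPotterSequence a α δ C N) (hδ : 0 < δ) (hδα : δ ≤ α)
    (hα : α + δ < 1) {n : ℕ} (hn : N ≤ n) {d r : ℕ} (hd : d ≤ n) (hr : 3 * n ≤ r) :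
    |shiftCoeff a d r| ≤ 4 * C * a n * (1 + (r : ℝ) / n) ^ (-(α - δ)) := by
  have hn0 : (0 : ℝ) < n := Nat.cast_pos.2 (h.N_pos.trans hn)
  have hC := h.C_pos
  have han := h.pos n hn
  unfold shiftCoeff
  rw [if_pos (by omega)]
  refine (h.bound n hn _).trans ?_
  have hr' : (3 : ℝ) * n ≤ r := by exact_mod_cast hr
  have hd' : (d : ℝ) ≤ n := by exact_mod_cast hd
  set y : ℝ := (((r - d : ℕ) : ℝ) + 1) / n with hy
  have hrn : 3 ≤ (r : ℝ) / n := by rw [le_div_iff₀ hn0]; exact hr'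
  have hy1 : (1 + (r : ℝ) / n) / 2 ≤ y := by
    have : (r : ℝ) / n - 1 ≤ y := by
      rw [hy, Nat.cast_sub (by omega), le_div_iff₀ hn0, sub_mul, div_mul_cancel₀ _ hn0.ne']
      linarith
    linarith
  have hy2 : 1 ≤ y := by linarith
  have e1 : y ^ (-(α + δ)) ≤ y ^ (-(α - δ)) :=
    Real.rpow_le_rpow_of_exponent_le hy2 (by linarith)
  have e2 : y ^ (-(α - δ)) ≤ ((1 + (r : ℝ) / n) / 2) ^ (-(α - δ)) :=
    Real.rpow_le_rpow_of_nonpos (by positivity) hy1 (by linarith)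
  have e3 : ((1 + (r : ℝ) / n) / 2) ^ (-(α - δ)) ≤ 2 * (1 + (r : ℝ) / n) ^ (-(α - δ)) := by
    rw [Real.div_rpow (by positivity) (by norm_num), Real.rpow_neg (by norm_num : (0 : ℝ) ≤ 2),
      div_inv_eq_mul, mul_comm]
    gcongr
    calc (2 : ℝ) ^ (α - δ) ≤ 2 ^ (1 : ℝ) :=
          Real.rpow_le_rpow_of_exponent_le (by norm_num) (by linarith)
      _ = 2 := Real.rpow_one 2
  have e4 : potterMajorant α δ y ≤ 4 * (1 + (r : ℝ) / n) ^ (-(α - δ)) := by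
    unfold potterMajorant; linarith
  calc C * a n * potterMajorant α δ y ≤ C * a n * (4 * (1 + (r : ℝ) / n) ^ (-(α - δ))) := by gcongr
    _ = _ := by ring

/-- The total weight of `ε_{n-r}` in `X_1, …, X_n`. -/
theorem exists_sum_abs_shiftCoeff_le (h : IsPotterSequence a α δ C N) (hδ : 0 < δ) (hδα : δ ≤ α)
    (hα : α + δ < 1) : ∃ K : ℝ, 0 < K ∧ ∀ n ≥ N, ∀ r : ℕ,
      ∑ d ∈ Finset.range n, |shiftCoeff a d r| ≤ K * (n * a n) * (1 + (r : ℝ) / n) ^ (-(α - δ)) := by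
  have hC := h.C_pos
  have hden : 0 < 1 - α - δ := by linarith
  set K1 := C * (1 + 3 ^ (2 * δ)) / (1 - α - δ) with hK1
  have hK1p : 0 < K1 := by positivity
  refine ⟨12 * K1 + 4 * C, by positivity, fun n hn r => ?_⟩
  have hn0 : (0 : ℝ) < n := Nat.cast_pos.2 (h.N_pos.trans hn)
  have han := h.pos n hn
  have hw : 0 < (1 + (r : ℝ) / n) ^ (-(α - δ)) := by positivity
  -- Near the origin by the Karamata bound, far from it by monotonicity of the power majorant.
  rcases lt_or_ge r (3 * n) with hr | hr
  · have hr' : ((r + 1 : ℕ) : ℝ) ≤ 3 * n := by exact_mod_cast hr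
    have h1 := h.sum_range_abs_le hδ hδα hα hn (by norm_num : (1 : ℝ) ≤ 3) hr'
    have h2 : (((r + 1 : ℕ) : ℝ) / n) ^ (1 - α - δ) ≤ 3 := by
      calc (((r + 1 : ℕ) : ℝ) / n) ^ (1 - α - δ) ≤ 3 ^ (1 - α - δ) := by
            refine Real.rpow_le_rpow (by positivity) ?_ hden.le
            rwa [div_le_iff₀ hn0]
        _ ≤ 3 ^ (1 : ℝ) := Real.rpow_le_rpow_of_exponent_le (by norm_num) (by linarith)
        _ = 3 := Real.rpow_one 3
    have h3 : (1 / 4 : ℝ) ≤ (1 + (r : ℝ) / n) ^ (-(α - δ)) := by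
      have hrn : (r : ℝ) / n ≤ 3 := by
        rw [div_le_iff₀ hn0]; push_cast at hr'; linarith
      calc (1 / 4 : ℝ) = 4 ^ (-1 : ℝ) := by rw [Real.rpow_neg_one]; norm_num
        _ ≤ 4 ^ (-(α - δ)) := Real.rpow_le_rpow_of_exponent_le (by norm_num) (by linarith)
        _ ≤ _ := Real.rpow_le_rpow_of_nonpos (by positivity) (by linarith) (by linarith)
    calc _ ≤ _ := sum_abs_shiftCoeff_le a n r
      _ ≤ _ := h1
      _ ≤ K1 * (n * a n) * 3 := by rw [← hK1]; gcongr
      _ = 12 * K1 * (n * a n) * (1 / 4) := by ring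
      _ ≤ (12 * K1 + 4 * C) * (n * a n) * (1 + (r : ℝ) / n) ^ (-(α - δ)) := by
        gcongr; linarith
  · calc _ ≤ ∑ d ∈ Finset.range n, 4 * C * a n * (1 + (r : ℝ) / n) ^ (-(α - δ)) :=
          Finset.sum_le_sum fun d hd =>
            h.abs_shiftCoeff_le_far hδ hδα hα hn (Finset.mem_range.1 hd).le hr
      _ = 4 * C * (n * a n) * (1 + (r : ℝ) / n) ^ (-(α - δ)) := by
          rw [Finset.sum_const, Finset.card_range, nsmul_eq_mul]; ring
      _ ≤ _ := by gcongr; linarith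

theorem exists_abs_le_rpow (h : IsPotterSequence a α δ C N) (hδ : 0 < δ) (hδα : δ ≤ α)
    (hα : α + δ < 1) : ∃ K : ℝ, 0 < K ∧ ∀ j : ℕ, |a j| ≤ K * (1 + (j : ℝ)) ^ (-(α - δ)) := by
  obtain ⟨K, hK, hb⟩ := h.exists_sum_abs_shiftCoeff_le hδ hδα hα
  have hN0 : (0 : ℝ) < N := Nat.cast_pos.2 h.N_pos
  have hN1 : (1 : ℝ) ≤ N := Nat.one_le_cast.2 h.N_pos
  have haN := h.pos N le_rfl
  refine ⟨K * (N * a N) * N ^ (α - δ), by positivity, fun j => ?_⟩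
  have h1 : |a j| ≤ ∑ d ∈ Finset.range N, |shiftCoeff a d j| := by
    have := Finset.single_le_sum (f := fun d => |shiftCoeff a d j|) (fun _ _ => abs_nonneg _)
      (Finset.mem_range.2 h.N_pos)
    simpa [shiftCoeff] using this
  refine (h1.trans (hb N le_rfl j)).trans ?_
  rw [mul_assoc _ (((N : ℝ)) ^ (α - δ))]
  gcongr
  have h2 : (1 + (j : ℝ)) / N ≤ 1 + (j : ℝ) / N := by
    rw [add_div]; gcongr; exact (div_le_one hN0).2 hN1
  calc (1 + (j : ℝ) / N) ^ (-(α - δ)) ≤ ((1 + (j : ℝ)) / N) ^ (-(α - δ)) :=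
        Real.rpow_le_rpow_of_nonpos (by positivity) h2 (by linarith)
    _ = _ := by
        rw [Real.div_rpow (by positivity) hN0.le, Real.rpow_neg hN0.le, div_inv_eq_mul, mul_comm]

theorem summable_sq_mul_rpow (h : IsPotterSequence a α δ C N) (hδ : 0 < δ) (hδα : δ ≤ α)
    (hα : α + δ < 1) {s : ℝ} (hs : 1 < 2 * (α - δ) - s) :
    Summable fun j : ℕ => a j ^ 2 * (1 + (j : ℝ)) ^ s := by
  obtain ⟨K, hK, hb⟩ := h.exists_abs_le_rpow hδ hδα hα
  obtain ⟨K', -, hs'⟩ := exists_tsum_one_add_rpow_le hs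
  have h1 := (hs' 1 one_pos).1
  simp only [Nat.cast_one, div_one] at h1
  refine Summable.of_nonneg_of_le (fun j => by positivity) (fun j => ?_) (h1.mul_left (K ^ 2))
  have hj : (0 : ℝ) < 1 + j := by positivity
  have h2 : a j ^ 2 ≤ (K * (1 + (j : ℝ)) ^ (-(α - δ))) ^ 2 := by
    rw [← sq_abs]; gcongr; exact hb j
  calc a j ^ 2 * (1 + (j : ℝ)) ^ s ≤ (K * (1 + (j : ℝ)) ^ (-(α - δ))) ^ 2 * (1 + (j : ℝ)) ^ s := by
        gcongr
    _ = K ^ 2 * (1 + (j : ℝ)) ^ (-(2 * (α - δ) - s)) := by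
        rw [mul_pow, ← Real.rpow_natCast (_ ^ (-(α - δ))) 2, ← Real.rpow_mul hj.le, mul_assoc,
          ← Real.rpow_add hj]
        push_cast; ring_nf

theorem summable_sq (h : IsPotterSequence a α δ C N) (hδ : 0 < δ) (hδα : δ ≤ α)
    (hα : α + δ < 1) (hα2 : 1 < 2 * (α - δ)) : Summable fun j : ℕ => a j ^ 2 := by
  simpa using h.summable_sq_mul_rpow hδ hδα hα (s := 0) (by linarith)

end IsPotterSequence

/-! ### Innovations truncated at growing levels -/

/-- The truncation level of `ε_{n-r}`: it grows with `r`, since the total weight of the distant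
innovations is infinite. -/
noncomputable def growingLevel (η : ℝ) (n r : ℕ) : ℝ := η * √(1 + (r : ℝ) / n)

/-- The estimates on the truncated moments at the levels `growingLevel η n r`, in terms of
`√(n * l(η))`. -/
structure IsTruncScale (l tail : ℝ → ℝ) (δ κ : ℝ) (n : ℕ) (η : ℝ) : Prop where
  n_pos : 0 < n
  one_le : 1 ≤ η
  pos : 0 < l η
  le_level : n * l η ≤ 4 * η ^ 2
  level_le : η ^ 2 ≤ 4 * (n * l η)
  core : ∀ r : ℕ, l (growingLevel η n r) ≤ 2 * l η * (1 + (r : ℝ) / n) ^ δ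
  tail : ∀ r : ℕ, tail (growingLevel η n r) ≤
    κ * (√(n * l η) / n) * (1 + (r : ℝ) / n) ^ (-(1 / 2 - δ))

theorem eventually_isTruncScale {l tail : ℝ → ℝ} (hm : Monotone l) (hl : IsSlowlyVarying l)
    (ht : ∀ κ : ℝ, 0 < κ → ∃ X : ℝ, 1 ≤ X ∧ ∀ x ≥ X, tail x ≤ κ * (l x / x))
    {δ κ : ℝ} (hδ : 0 < δ) (hκ : 0 < κ) :
    ∀ᶠ n : ℕ in atTop, IsTruncScale l tail δ κ n (truncLevel l n) := by
  obtain ⟨htend, hev⟩ := truncLevel_spec hm hl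
  obtain ⟨X, hX1, hpos, hX⟩ := hl.potter (show 0 < 2 * δ by positivity)
  obtain ⟨Y, hY1, hY⟩ := ht (κ / 4) (by positivity)
  filter_upwards [hev, eventually_gt_atTop 0, htend.eventually_ge_atTop X,
    htend.eventually_ge_atTop Y] with n ⟨h1, h2, h3, h4⟩ hn hnX hnY
  have hn0 : (0 : ℝ) < n := Nat.cast_pos.2 hn
  change 0 < l (truncLevel l n) at h2
  change n * l (truncLevel l n) ≤ _ at h3
  change _ ≤ 4 * (n * l (truncLevel l n)) at h4
  set η := truncLevel l n
  have hη0 : 0 < η := by linarith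
  have hge : ∀ r : ℕ, η ≤ growingLevel η n r := fun r =>
    le_mul_of_one_le_right hη0.le (Real.one_le_sqrt.2 (by linarith [show 0 ≤ (r : ℝ) / n by positivity]))
  have hcore : ∀ r : ℕ, l (growingLevel η n r) ≤ 2 * l η * (1 + (r : ℝ) / n) ^ δ := by
    intro r
    have h5 := (hX η hnX _ (hge r)).1
    have e : growingLevel η n r / η = √(1 + (r : ℝ) / n) := by
      unfold growingLevel; field_simp
    rw [e, Real.sqrt_eq_rpow, ← Real.rpow_mul (by positivity)] at h5
    ring_nf at h5 ⊢
    linarith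
  refine ⟨hn, h1, h2, h3, h4, hcore, fun r => ?_⟩
  have hw : (0 : ℝ) < 1 + (r : ℝ) / n := by positivity
  have hg0 : 0 < growingLevel η n r := hη0.trans_le (hge r)
  have hl2 : l η / η ≤ 2 * (√(n * l η) / n) := by
    have hs : √(n * l η) ^ 2 = n * l η := Real.sq_sqrt (by positivity)
    have hs2 : √(n * l η) ≤ 2 * η := by
      rw [Real.sqrt_le_left (by positivity)]; linarith
    have hs0 : 0 ≤ √(n * l η) := Real.sqrt_nonneg _
    rw [← mul_div_assoc, div_le_div_iff₀ hη0 hn0]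
    calc l η * n = √(n * l η) * √(n * l η) := by rw [← sq, hs]; ring
      _ ≤ √(n * l η) * (2 * η) := by gcongr
      _ = 2 * √(n * l η) * η := by ring
  have e : (1 + (r : ℝ) / n) ^ δ / √(1 + (r : ℝ) / n) = (1 + (r : ℝ) / n) ^ (-(1 / 2 - δ)) := by
    rw [Real.sqrt_eq_rpow, ← Real.rpow_sub hw]; ring_nf
  calc tail (growingLevel η n r) ≤ κ / 4 * (l (growingLevel η n r) / growingLevel η n r) :=
        hY _ (hnY.trans (hge r))
    _ ≤ κ / 4 * (2 * l η * (1 + (r : ℝ) / n) ^ δ / growingLevel η n r) := by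
        gcongr; exact hcore r
    _ = κ / 2 * (l η / η) * (1 + (r : ℝ) / n) ^ (-(1 / 2 - δ)) := by
        rw [← e]; unfold growingLevel; field_simp; ring
    _ ≤ κ / 2 * (2 * (√(n * l η) / n)) * (1 + (r : ℝ) / n) ^ (-(1 / 2 - δ)) := by gcongr
    _ = _ := by ring

namespace IsTruncScale

variable {l tail : ℝ → ℝ} {α δ κ : ℝ} {n : ℕ} {η : ℝ}

theorem growingLevel_pos (h : IsTruncScale l tail δ κ n η) (r : ℕ) : 0 < growingLevel η n r := by
  have := h.one_le
  unfold growingLevel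
  positivity

theorem tsum_core_ne_top (h : IsTruncScale l tail δ κ n η) (hα2 : 1 < 2 * (α - δ) - δ)
    {c : ℕ → ℝ} {G : ℝ} (hc : ∀ r : ℕ, |c r| ≤ G * (1 + (r : ℝ) / n) ^ (-(α - δ))) :
    ∑' r, ENNReal.ofReal (c r ^ 2 * l (growingLevel η n r)) ≠ ∞ := by
  obtain ⟨K, -, hK⟩ := exists_tsum_one_add_rpow_le hα2
  have hs := ((hK n h.n_pos).1.mul_left (G ^ 2 * (2 * l η)))
  have hle : ∀ r, c r ^ 2 * l (growingLevel η n r) ≤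
      G ^ 2 * (2 * l η) * (1 + (r : ℝ) / n) ^ (-(2 * (α - δ) - δ)) := by
    intro r
    have hw : (0 : ℝ) < 1 + (r : ℝ) / n := by positivity
    have h1 : c r ^ 2 ≤ (G * (1 + (r : ℝ) / n) ^ (-(α - δ))) ^ 2 := by
      rw [← sq_abs]; gcongr; exact hc r
    have h2 := h.core r
    have hl := h.pos
    calc _ ≤ c r ^ 2 * (2 * l η * (1 + (r : ℝ) / n) ^ δ) := by gcongr
      _ ≤ (G * (1 + (r : ℝ) / n) ^ (-(α - δ))) ^ 2 * (2 * l η * (1 + (r : ℝ) / n) ^ δ) := by gcongr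
      _ = G ^ 2 * (2 * l η) * ((1 + (r : ℝ) / n) ^ (-(2 * (α - δ))) * (1 + (r : ℝ) / n) ^ δ) := by
        rw [mul_pow, ← Real.rpow_natCast (_ ^ (-(α - δ))) 2, ← Real.rpow_mul hw.le]
        push_cast; ring_nf
      _ = _ := by rw [← Real.rpow_add hw]; ring_nf
  have hl := h.pos
  refine ne_top_of_le_ne_top ?_ (ENNReal.tsum_le_tsum fun r => ENNReal.ofReal_le_ofReal (hle r))
  rw [← ENNReal.ofReal_tsum_of_nonneg (fun r => by positivity) hs]
  exact ENNReal.ofReal_ne_top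

theorem exists_tsum_tail_le (hα2 : 1 < α - δ + (1 / 2 - δ)) :
    ∃ K : ℝ, 0 < K ∧ ∀ {l tail : ℝ → ℝ} {κ : ℝ} {n : ℕ} {η : ℝ}, 0 ≤ κ → IsTruncScale l tail δ κ n η →
      ∀ {c : ℕ → ℝ} {G : ℝ}, 0 ≤ G → (∀ r : ℕ, |c r| ≤ G * (1 + (r : ℝ) / n) ^ (-(α - δ))) →
      ∑' r, ENNReal.ofReal (|c r| * (2 * tail (growingLevel η n r))) ≤
        ENNReal.ofReal (K * κ * G * √(n * l η)) := by
  obtain ⟨K, hK0, hK⟩ := exists_tsum_one_add_rpow_le hα2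
  refine ⟨2 * K, by positivity, ?_⟩
  intro l tail κ n η hκ h c G hG hc
  have hn0 : (0 : ℝ) < n := Nat.cast_pos.2 h.n_pos
  obtain ⟨hs, hsum⟩ := hK n h.n_pos
  have hle : ∀ r, |c r| * (2 * tail (growingLevel η n r)) ≤ G * (2 * κ * (√(n * l η) / n)) *
      (1 + (r : ℝ) / n) ^ (-(α - δ + (1 / 2 - δ))) := by
    intro r
    have hw : (0 : ℝ) < 1 + (r : ℝ) / n := by positivity
    have h2 := h.tail r
    calc _ ≤ |c r| * (2 * (κ * (√(n * l η) / n) * (1 + (r : ℝ) / n) ^ (-(1 / 2 - δ)))) := by gcongr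
      _ ≤ G * (1 + (r : ℝ) / n) ^ (-(α - δ)) *
          (2 * (κ * (√(n * l η) / n) * (1 + (r : ℝ) / n) ^ (-(1 / 2 - δ)))) := by
          gcongr; exact hc r
      _ = G * (2 * κ * (√(n * l η) / n)) *
          ((1 + (r : ℝ) / n) ^ (-(α - δ)) * (1 + (r : ℝ) / n) ^ (-(1 / 2 - δ))) := by ring
      _ = _ := by rw [← Real.rpow_add hw]; ring_nf
  refine (ENNReal.tsum_le_tsum fun r => ENNReal.ofReal_le_ofReal (hle r)).trans ?_
  rw [← ENNReal.ofReal_tsum_of_nonneg (fun r => by positivity) (hs.mul_left _), tsum_mul_left]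
  refine ENNReal.ofReal_le_ofReal ?_
  calc _ ≤ G * (2 * κ * (√(n * l η) / n)) * (K * n) := by gcongr
    _ = _ := by field_simp

end IsTruncScale

/-! ### Splitting the linear process -/

section Splitting

variable {Ω : Type*} [MeasurableSpace Ω] {P : Measure Ω} {ε : ℤ → Ω → ℝ}

/-- The recentered truncation of `ε_{K-r}` at level `T r`. -/
noncomputable def coreInnovation (ε : ℤ → Ω → ℝ) (P : Measure Ω) (T : ℕ → ℝ) (K : ℤ) (r : ℕ)
    (ω : Ω) : ℝ := truncCore (truncMean (ε 0) P (T r)) (T r) (ε (K - r) ω)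

/-- The part of `ε_{K-r}` removed by the recentered truncation at level `T r`. -/
noncomputable def restInnovation (ε : ℤ → Ω → ℝ) (P : Measure Ω) (T : ℕ → ℝ) (K : ℤ) (r : ℕ)
    (ω : Ω) : ℝ := truncRest (truncMean (ε 0) P (T r)) (T r) (ε (K - r) ω)

/-- The sum of the series with coefficients `c` in the truncated innovations. -/
noncomputable def coreSeries (ε : ℤ → Ω → ℝ) (P : Measure Ω) (T : ℕ → ℝ) (K : ℤ) (c : ℕ → ℝ)
    (ω : Ω) : ℝ := limUnder atTop fun N => ∑ r ∈ Finset.range N, c r * coreInnovation ε P T K r ω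

/-- The sum of the absolute values of the series with coefficients `c` in the removed parts. -/
noncomputable def restBound (ε : ℤ → Ω → ℝ) (P : Measure Ω) (T : ℕ → ℝ) (K : ℤ) (c : ℕ → ℝ)
    (ω : Ω) : ℝ≥0∞ := ∑' r, ENNReal.ofReal (|c r| * |restInnovation ε P T K r ω|)

namespace IsCenteredDANInnovation

variable (hε : IsCenteredDANInnovation ε P) {T : ℕ → ℝ} (K : ℤ)

include hε

theorem measurable_coreInnovation (r : ℕ) : Measurable (coreInnovation ε P T K r) :=
  (measurable_truncCore _ _).comp (hε.measurable _)

theorem measurable_restInnovation (r : ℕ) : Measurable (restInnovation ε P T K r) :=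
  (measurable_truncRest _ _).comp (hε.measurable _)

theorem iIndepFun_reverse : iIndepFun (fun r : ℕ => ε (K - r)) P :=
  hε.indep.precomp (g := fun r : ℕ => K - r) fun r s h => by simpa using h

theorem iIndepFun_coreInnovation : iIndepFun (coreInnovation ε P T K) P :=
  (hε.iIndepFun_reverse K).comp (fun r => truncCore (truncMean (ε 0) P (T r)) (T r))
    fun _ => measurable_truncCore _ _

variable [IsProbabilityMeasure P]

theorem memLp_coreInnovation (hT : ∀ r, 0 ≤ T r) (r : ℕ) : MemLp (coreInnovation ε P T K r) 2 P :=
  memLp_truncCore (hε.measurable _) _ (hT r)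

theorem integral_coreInnovation (r : ℕ) : ∫ ω, coreInnovation ε P T K r ω ∂P = 0 := by
  have h := ((hε.identDistrib (K - r)).comp
    (measurable_truncCore (truncMean (ε 0) P (T r)) (T r))).integral_eq
  exact h.trans (integral_truncCore (hε.measurable 0) hε.integrable _)

theorem integral_sq_coreInnovation_le (r : ℕ) :
    ∫ ω, coreInnovation ε P T K r ω ^ 2 ∂P ≤ truncSecondMoment (ε 0) P (T r) := by
  have h := ((hε.identDistrib (K - r)).comp
    ((measurable_truncCore (truncMean (ε 0) P (T r)) (T r)).pow_const 2)).integral_eq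
  exact h.le.trans (integral_sq_truncCore_le (hε.measurable 0) hε.integrable _)

theorem lintegral_restInnovation_le (r : ℕ) :
    ∫⁻ ω, ENNReal.ofReal |restInnovation ε P T K r ω| ∂P ≤
      ENNReal.ofReal (2 * tailFirstMoment (ε 0) P (T r)) := by
  have h := ((hε.identDistrib (K - r)).comp
    (ENNReal.measurable_ofReal.comp (continuous_abs.measurable.comp
      (measurable_truncRest (truncMean (ε 0) P (T r)) (T r))))).lintegral_eq
  exact h.le.trans (lintegral_truncRest_le (hε.measurable 0) hε.integrable hε.centered _)

theorem lintegral_restBound_le (c : ℕ → ℝ) : ∫⁻ ω, restBound ε P T K c ω ∂P ≤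
    ∑' r, ENNReal.ofReal (|c r| * (2 * tailFirstMoment (ε 0) P (T r))) := by
  have hm : ∀ r, Measurable fun ω => ENNReal.ofReal |restInnovation ε P T K r ω| := fun r =>
    ENNReal.measurable_ofReal.comp (continuous_abs.measurable.comp (hε.measurable_restInnovation K r))
  unfold restBound
  simp only [ENNReal.ofReal_mul (abs_nonneg _)]
  rw [lintegral_tsum fun r => ((hm r).const_mul _).aemeasurable]
  refine ENNReal.tsum_le_tsum fun r => ?_
  rw [lintegral_const_mul _ (hm r)]
  gcongr
  exact hε.lintegral_restInnovation_le K r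

omit [IsProbabilityMeasure P] in
theorem measurable_restBound (c : ℕ → ℝ) : Measurable (restBound ε P T K c) :=
  Measurable.tsum fun r => ENNReal.measurable_ofReal.comp
    ((continuous_abs.measurable.comp (hε.measurable_restInnovation K r)).const_mul _)

theorem ae_tendsto_coreSeries (hT : ∀ r, 0 ≤ T r) {c : ℕ → ℝ}
    (h1 : ∑' r, ENNReal.ofReal (c r ^ 2 * truncSecondMoment (ε 0) P (T r)) ≠ ∞) :
    ∀ᵐ ω ∂P, Tendsto (fun N => ∑ r ∈ Finset.range N, c r * coreInnovation ε P T K r ω) atTop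
      (𝓝 (coreSeries ε P T K c ω)) := by
  filter_upwards [ae_exists_tendsto_sum (hε.measurable_coreInnovation K)
    (hε.iIndepFun_coreInnovation K) (hε.memLp_coreInnovation K hT) (hε.integral_coreInnovation K)
    (hε.integral_sq_coreInnovation_le K) h1] with ω hω
  exact tendsto_nhds_limUnder hω

theorem ae_restBound_lt_top {c : ℕ → ℝ}
    (h2 : ∑' r, ENNReal.ofReal (|c r| * (2 * tailFirstMoment (ε 0) P (T r))) ≠ ∞) :
    ∀ᵐ ω ∂P, restBound ε P T K c ω < ∞ :=
  ae_lt_top (hε.measurable_restBound K c)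
    (ne_top_of_le_ne_top h2 (hε.lintegral_restBound_le K c))

/-- A series in the innovations converges almost surely as soon as the truncated parts have summable
variances and the removed parts converge absolutely in mean. -/
theorem ae_tendsto_series (hT : ∀ r, 0 ≤ T r) {c : ℕ → ℝ}
    (h1 : ∑' r, ENNReal.ofReal (c r ^ 2 * truncSecondMoment (ε 0) P (T r)) ≠ ∞)
    (h2 : ∑' r, ENNReal.ofReal (|c r| * (2 * tailFirstMoment (ε 0) P (T r))) ≠ ∞) :
    ∀ᵐ ω ∂P, ∃ v : ℝ, Tendsto (fun N => ∑ r ∈ Finset.range N, c r * ε (K - r) ω) atTop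
      (𝓝 (coreSeries ε P T K c ω + v)) ∧ ENNReal.ofReal |v| ≤ restBound ε P T K c ω := by
  filter_upwards [hε.ae_tendsto_coreSeries K hT h1, hε.ae_restBound_lt_top K h2] with ω hu hv
  have hs : Summable fun r => ‖c r * restInnovation ε P T K r ω‖ := by
    have := ENNReal.summable_toReal hv.ne
    refine this.congr fun r => ?_
    rw [ENNReal.toReal_ofReal (by positivity), norm_mul, Real.norm_eq_abs, Real.norm_eq_abs]
  refine ⟨∑' r, c r * restInnovation ε P T K r ω, ?_, ?_⟩
  · refine (hu.add hs.of_norm.hasSum.tendsto_sum_nat).congr fun N => ?_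
    rw [← Finset.sum_add_distrib]
    refine Finset.sum_congr rfl fun r _ => ?_
    rw [← mul_add]
    congr 1
    exact truncCore_add_truncRest _ _ _
  · refine (ENNReal.ofReal_le_ofReal (norm_tsum_le_tsum_norm hs)).trans (le_of_eq ?_)
    rw [ENNReal.ofReal_tsum_of_nonneg (fun _ => norm_nonneg _) hs]
    simp only [restBound, norm_mul, Real.norm_eq_abs]

end IsCenteredDANInnovation

omit [MeasurableSpace Ω] in
theorem sum_range_shiftCoeff_mul (a : ℕ → ℝ) (K : ℤ) (d N : ℕ) (ω : Ω) :
    ∑ r ∈ Finset.range (N + d), shiftCoeff a d r * ε (K - r) ω =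
      linearProcessPartial a ε (K - d) N ω := by
  unfold linearProcessPartial
  rw [add_comm N d, Finset.sum_range_add]
  rw [Finset.sum_eq_zero fun r hr => by
    rw [shiftCoeff, if_neg (by have := Finset.mem_range.1 hr; omega), zero_mul], zero_add]
  refine Finset.sum_congr rfl fun j _ => ?_
  rw [shiftCoeff, if_pos (by omega), Nat.add_sub_cancel_left]
  congr 2
  push_cast
  ring

/-- Almost surely, `X_{K-d}` is the sum of its series, and is split into the series of the truncated
innovations and a term dominated by the series of the removed parts. -/
theorem IsCenteredDANInnovation.ae_linearProcess_eq [IsProbabilityMeasure P]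
    (hε : IsCenteredDANInnovation ε P) {T : ℕ → ℝ} (K : ℤ) (hT : ∀ r, 0 ≤ T r) {a : ℕ → ℝ} {d : ℕ}
    (h1 : ∑' r, ENNReal.ofReal (shiftCoeff a d r ^ 2 * truncSecondMoment (ε 0) P (T r)) ≠ ∞)
    (h2 : ∑' r, ENNReal.ofReal (|shiftCoeff a d r| * (2 * tailFirstMoment (ε 0) P (T r))) ≠ ∞) :
    ∀ᵐ ω ∂P, Tendsto (fun N => linearProcessPartial a ε (K - d) N ω) atTop
        (𝓝 (linearProcess a ε (K - d) ω)) ∧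
      Tendsto (fun N => ∑ r ∈ Finset.range N, shiftCoeff a d r * ε (K - r) ω) atTop
        (𝓝 (linearProcess a ε (K - d) ω)) ∧
      ∃ v : ℝ, linearProcess a ε (K - d) ω = coreSeries ε P T K (shiftCoeff a d) ω + v ∧
        ENNReal.ofReal |v| ≤ restBound ε P T K (shiftCoeff a d) ω := by
  filter_upwards [hε.ae_tendsto_series K hT h1 h2] with ω ⟨v, hv, hb⟩
  have h3 : Tendsto (fun N => linearProcessPartial a ε (K - d) N ω) atTop
      (𝓝 (coreSeries ε P T K (shiftCoeff a d) ω + v)) := by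
    refine ((tendsto_add_atTop_iff_nat d).2 hv).congr fun N => ?_
    exact sum_range_shiftCoeff_mul a K d N ω
  have h4 : linearProcess a ε (K - d) ω = coreSeries ε P T K (shiftCoeff a d) ω + v :=
    h3.limUnder_eq
  rw [h4]
  exact ⟨h3, hv, v, rfl, hb⟩

end Splitting

/-! ### The standing estimates -/

/-- The exponent `δ` of the Potter bounds is small with respect to the gaps `α - 1 / 2` and
`1 - α`. -/
structure IsSmallExponent (α δ : ℝ) : Prop where
  pos : 0 < δ
  lower : 8 * δ ≤ 2 * α - 1
  upper : 4 * δ ≤ 1 - α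

namespace IsSmallExponent

variable {α δ : ℝ} (h : IsSmallExponent α δ)

include h

theorem le_alpha : δ ≤ α := by linarith [h.pos, h.lower]
theorem add_lt_one : α + δ < 1 := by linarith [h.pos, h.upper]
theorem one_lt_core : 1 < 2 * (α - δ) - δ := by linarith [h.pos, h.lower]
theorem one_lt_tail : 1 < α - δ + (1 / 2 - δ) := by linarith [h.pos, h.lower]
theorem one_lt_sq : 1 < 2 * (α - δ) := by linarith [h.pos, h.lower]

end IsSmallExponent

theorem exists_isSmallExponent {α : ℝ} (hα : 1 / 2 < α) (hα' : α < 1) :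
    ∃ δ, IsSmallExponent α δ := by
  refine ⟨min ((2 * α - 1) / 8) ((1 - α) / 4), lt_min (by linarith) (by linarith), ?_, ?_⟩
  · linarith [min_le_left ((2 * α - 1) / 8) ((1 - α) / 4)]
  · linarith [min_le_right ((2 * α - 1) / 8) ((1 - α) / 4)]

section Standing

variable {Ω : Type*} [MeasurableSpace Ω] {P : Measure Ω} [IsProbabilityMeasure P] {ε : ℤ → Ω → ℝ}
  {a : ℕ → ℝ} {α δ C : ℝ} {N : ℕ}

theorem IsCenteredDANInnovation.eventually_isTruncScale (hε : IsCenteredDANInnovation ε P)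
    (hδ : 0 < δ) {κ : ℝ} (hκ : 0 < κ) :
    ∀ᶠ n : ℕ in atTop, IsTruncScale (truncSecondMoment (ε 0) P) (tailFirstMoment (ε 0) P) δ κ n
      (truncLevel (truncSecondMoment (ε 0) P) n) :=
  _root_.eventually_isTruncScale (truncSecondMoment_mono (hε.measurable 0)) hε.slowlyVarying
    (fun _ hκ => tailFirstMoment_le (hε.measurable 0) hε.integrable hε.slowlyVarying hκ) hδ hκ

theorem abs_shiftCoeff_le_sum {a' : ℕ → ℝ} (ha' : ∀ j, |a' j| ≤ |a j|) {d n : ℕ} (hd : d < n)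
    (r : ℕ) : |shiftCoeff a' d r| ≤ ∑ d ∈ Finset.range n, |shiftCoeff a d r| := by
  refine le_trans ?_ (Finset.single_le_sum (f := fun d => |shiftCoeff a d r|)
    (fun _ _ => abs_nonneg _) (Finset.mem_range.2 hd))
  simp only [shiftCoeff]
  split_ifs
  · exact ha' _
  · simp

theorem IsCenteredDANInnovation.ae_linearProcess_eq_of_scale (hε : IsCenteredDANInnovation ε P)
    (hsm : IsSmallExponent α δ) (ha : IsPotterSequence a α δ C N) {κ : ℝ} (hκ : 0 ≤ κ) {n : ℕ}
    {η : ℝ} (hsc : IsTruncScale (truncSecondMoment (ε 0) P) (tailFirstMoment (ε 0) P) δ κ n η)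
    (hn : N ≤ n) {a' : ℕ → ℝ} (ha' : ∀ j, |a' j| ≤ |a j|) (K : ℤ) :
    ∀ᵐ ω ∂P, ∀ d < n, Tendsto (fun M => linearProcessPartial a' ε (K - d) M ω) atTop
        (𝓝 (linearProcess a' ε (K - d) ω)) ∧
      Tendsto (fun M => ∑ r ∈ Finset.range M, shiftCoeff a' d r * ε (K - r) ω) atTop
        (𝓝 (linearProcess a' ε (K - d) ω)) ∧
      Tendsto (fun M => ∑ r ∈ Finset.range M,
        shiftCoeff a' d r * coreInnovation ε P (growingLevel η n) K r ω) atTop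
        (𝓝 (coreSeries ε P (growingLevel η n) K (shiftCoeff a' d) ω)) ∧
      ∃ v : ℝ, linearProcess a' ε (K - d) ω =
          coreSeries ε P (growingLevel η n) K (shiftCoeff a' d) ω + v ∧
        ENNReal.ofReal |v| ≤ restBound ε P (growingLevel η n) K (shiftCoeff a' d) ω := by
  obtain ⟨G, hG, hb⟩ := ha.exists_sum_abs_shiftCoeff_le hsm.pos hsm.le_alpha hsm.add_lt_one
  obtain ⟨K', -, hK'⟩ := IsTruncScale.exists_tsum_tail_le hsm.one_lt_tail
  have han := ha.pos n hn
  rw [ae_all_iff]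
  intro d
  by_cases hd : d < n
  swap
  · exact Eventually.of_forall fun ω h => absurd h hd
  have hc : ∀ r : ℕ, |shiftCoeff a' d r| ≤ G * (n * a n) * (1 + (r : ℝ) / n) ^ (-(α - δ)) :=
    fun r => (abs_shiftCoeff_le_sum ha' hd r).trans (hb n hn r)
  have hT : ∀ r, 0 ≤ growingLevel η n r := fun r => (hsc.growingLevel_pos r).le
  have h1 := hsc.tsum_core_ne_top hsm.one_lt_core hc
  have h2 := ne_top_of_le_ne_top ENNReal.ofReal_ne_top (hK' hκ hsc (by positivity) hc)
  filter_upwards [hε.ae_linearProcess_eq K hT h1 h2, hε.ae_tendsto_coreSeries K hT h1]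
    with ω h3 h4 _
  exact ⟨h3.1, h3.2.1, h4, h3.2.2⟩

/-- The series defining the linear process converges almost surely. -/
theorem IsCenteredDANInnovation.ae_tendsto_linearProcess (hε : IsCenteredDANInnovation ε P)
    (hsm : IsSmallExponent α δ) (ha : IsPotterSequence a α δ C N) {a' : ℕ → ℝ}
    (ha' : ∀ j, |a' j| ≤ |a j|) (k : ℤ) :
    ∀ᵐ ω ∂P, Tendsto (fun M => linearProcessPartial a' ε k M ω) atTop
      (𝓝 (linearProcess a' ε k ω)) := by
  obtain ⟨n, h1, h2⟩ := ((hε.eventually_isTruncScale hsm.pos one_pos).and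
    (eventually_ge_atTop N)).exists
  filter_upwards [hε.ae_linearProcess_eq_of_scale hsm ha zero_le_one h1 h2 ha' k] with ω hω
  simpa using (hω 0 h1.n_pos).1

theorem IsCenteredDANInnovation.aemeasurable_linearProcess (hε : IsCenteredDANInnovation ε P)
    (hsm : IsSmallExponent α δ) (ha : IsPotterSequence a α δ C N) {a' : ℕ → ℝ}
    (ha' : ∀ j, |a' j| ≤ |a j|) (k : ℤ) :
    AEMeasurable (linearProcess a' ε k) P := by
  refine aemeasurable_of_tendsto_metrizable_ae atTop (fun M => ?_)
    (hε.ae_tendsto_linearProcess hsm ha ha' k)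
  exact (Finset.measurable_sum _ fun i _ => (hε.measurable _).const_mul _).aemeasurable

end Standing

/-! ### Convergence in probability through exceptional sets -/

section InProbability

variable {Ω : Type*} [MeasurableSpace Ω] {P : Measure Ω}

/-- Convergence in probability to a constant, in terms of exceptional sets of small probability. -/
theorem tendstoInMeasure_const_iff {f : ℕ → Ω → ℝ} {c : ℝ} :
    TendstoInMeasure P f atTop (fun _ => c) ↔ ∀ θ > 0, ∀ ρ > 0, ∀ᶠ n in atTop,
      ∃ B : Set Ω, P B ≤ ENNReal.ofReal ρ ∧ ∀ᵐ ω ∂P, ω ∉ B → |f n ω - c| ≤ θ := by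
  rw [tendstoInMeasure_iff_dist]
  constructor
  · intro h θ hθ ρ hρ
    filter_upwards [ENNReal.tendsto_nhds_zero.1 (h θ hθ) (ENNReal.ofReal ρ)
      (ENNReal.ofReal_pos.2 hρ)] with n hn
    refine ⟨_, hn, Eventually.of_forall fun ω hω => ?_⟩
    have : ¬ θ ≤ dist (f n ω) c := hω
    rw [Real.dist_eq] at this
    exact (not_le.1 this).le
  · intro h θ hθ
    rw [ENNReal.tendsto_nhds_zero]
    intro ρ hρ
    rcases eq_or_ne ρ ∞ with rfl | hρt
    · exact Eventually.of_forall fun _ => le_top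
    filter_upwards [h (θ / 2) (half_pos hθ) ρ.toReal (ENNReal.toReal_pos hρ.ne' hρt)]
      with n ⟨B, hB, hω⟩
    rw [ENNReal.ofReal_toReal hρt] at hB
    refine (measure_mono_ae ?_).trans hB
    filter_upwards [hω] with ω h1 h2
    have h2 : θ ≤ dist (f n ω) c := h2
    by_contra hnB
    have := h1 hnB
    rw [Real.dist_eq] at h2
    linarith

theorem TendstoInMeasure.add_real {f g : ℕ → Ω → ℝ} {c d : ℝ}
    (hf : TendstoInMeasure P f atTop (fun _ => c)) (hg : TendstoInMeasure P g atTop (fun _ => d)) :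
    TendstoInMeasure P (fun n ω => f n ω + g n ω) atTop (fun _ => c + d) := by
  rw [tendstoInMeasure_const_iff] at *
  intro θ hθ ρ hρ
  filter_upwards [hf (θ / 2) (half_pos hθ) (ρ / 2) (half_pos hρ),
    hg (θ / 2) (half_pos hθ) (ρ / 2) (half_pos hρ)] with n ⟨B, hB, h1⟩ ⟨B', hB', h2⟩
  refine ⟨B ∪ B', ?_, ?_⟩
  · refine (measure_union_le _ _).trans ((add_le_add hB hB').trans ?_)
    rw [← ENNReal.ofReal_add (by positivity) (by positivity), add_halves]
  · filter_upwards [h1, h2] with ω h1 h2 hω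
    rw [Set.mem_union, not_or] at hω
    have := h1 hω.1
    have := h2 hω.2
    have e : f n ω + g n ω - (c + d) = (f n ω - c) + (g n ω - d) := by ring
    rw [e]
    exact (abs_add_le _ _).trans (by linarith)

theorem TendstoInMeasure.const_mul_real {f : ℕ → Ω → ℝ} {c : ℝ} (b : ℝ)
    (hf : TendstoInMeasure P f atTop (fun _ => c)) :
    TendstoInMeasure P (fun n ω => b * f n ω) atTop (fun _ => b * c) := by
  rw [tendstoInMeasure_const_iff] at *
  intro θ hθ ρ hρ
  have hb : 0 < |b| + 1 := by positivity
  filter_upwards [hf (θ / (|b| + 1)) (by positivity) ρ hρ] with n ⟨B, hB, h1⟩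
  refine ⟨B, hB, ?_⟩
  filter_upwards [h1] with ω h1 hω
  have := h1 hω
  rw [← mul_sub, abs_mul]
  calc |b| * |f n ω - c| ≤ (|b| + 1) * (θ / (|b| + 1)) := by gcongr; linarith
    _ = θ := by field_simp

theorem TendstoInMeasure.sum_real {ι : Type*} (s : Finset ι) {f : ι → ℕ → Ω → ℝ} {c : ι → ℝ}
    (hf : ∀ i, TendstoInMeasure P (f i) atTop (fun _ => c i)) :
    TendstoInMeasure P (fun n ω => ∑ i ∈ s, f i n ω) atTop (fun _ => ∑ i ∈ s, c i) := by
  classical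
  induction s using Finset.induction_on with
  | empty =>
    simp only [Finset.sum_empty]
    rw [tendstoInMeasure_const_iff]
    intro θ hθ ρ hρ
    exact Eventually.of_forall fun n => ⟨∅, by simp, Eventually.of_forall fun ω _ => by
      simpa using hθ.le⟩
  | insert i s hi ih =>
    simp only [Finset.sum_insert hi]
    exact TendstoInMeasure.add_real (hf i) ih

theorem measure_lt_abs_le_of_sq {g : Ω → ℝ} (hg : AEMeasurable g P) {b θ : ℝ}
    (hb : ∫⁻ ω, ENNReal.ofReal (g ω ^ 2) ∂P ≤ ENNReal.ofReal b) (hθ : 0 < θ) :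
    P {ω | θ < |g ω|} ≤ ENNReal.ofReal (b / θ ^ 2) := by
  have h1 : P {ω | θ < |g ω|} ≤ P {ω | ENNReal.ofReal (θ ^ 2) ≤ ENNReal.ofReal (g ω ^ 2)} := by
    refine measure_mono fun ω hω => ENNReal.ofReal_le_ofReal ?_
    have hω : θ < |g ω| := hω
    rw [← sq_abs (g ω)]
    exact pow_le_pow_left₀ hθ.le hω.le 2
  have h0 : ENNReal.ofReal (θ ^ 2) ≠ 0 := (ENNReal.ofReal_pos.2 (by positivity)).ne'
  refine h1.trans ((meas_ge_le_lintegral_div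
    (ENNReal.measurable_ofReal.comp_aemeasurable (hg.pow_const 2)) h0 ENNReal.ofReal_ne_top).trans ?_)
  rw [ENNReal.ofReal_div_of_pos (by positivity)]
  exact ENNReal.div_le_div_right hb _

theorem tendstoInMeasure_zero_of_sq {f : ℕ → Ω → ℝ} (hf : ∀ n, AEMeasurable (f n) P) {b : ℕ → ℝ}
    (hb : ∀ᶠ n in atTop, ∫⁻ ω, ENNReal.ofReal (f n ω ^ 2) ∂P ≤ ENNReal.ofReal (b n))
    (hb0 : Tendsto b atTop (𝓝 0)) : TendstoInMeasure P f atTop (fun _ => 0) := by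
  rw [tendstoInMeasure_const_iff]
  intro θ hθ ρ hρ
  filter_upwards [hb, hb0.eventually_lt_const (show 0 < ρ * θ ^ 2 by positivity)] with n h1 h2
  refine ⟨{ω | θ < |f n ω|}, (measure_lt_abs_le_of_sq (hf n) h1 hθ).trans ?_, ?_⟩
  · refine ENNReal.ofReal_le_ofReal ?_
    rw [div_le_iff₀ (by positivity)]; exact h2.le
  · refine Eventually.of_forall fun ω hω => ?_
    rw [sub_zero]
    exact not_lt.1 hω

/-- The limit in probability is not affected by changes on events of small probability. -/
theorem TendstoInMeasure.of_whp_eq {f g : ℕ → Ω → ℝ} {c : ℝ}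
    (hg : TendstoInMeasure P g atTop (fun _ => c))
    (hfg : ∀ ρ > 0, ∀ᶠ n in atTop, ∃ B : Set Ω, P B ≤ ENNReal.ofReal ρ ∧
      ∀ ω, ω ∉ B → f n ω = g n ω) :
    TendstoInMeasure P f atTop (fun _ => c) := by
  rw [tendstoInMeasure_const_iff] at *
  intro θ hθ ρ hρ
  filter_upwards [hg θ hθ (ρ / 2) (half_pos hρ), hfg (ρ / 2) (half_pos hρ)]
    with n ⟨B, hB, h1⟩ ⟨B', hB', h2⟩
  refine ⟨B ∪ B', ?_, ?_⟩
  · refine (measure_union_le _ _).trans ((add_le_add hB hB').trans ?_)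
    rw [← ENNReal.ofReal_add (by positivity) (by positivity), add_halves]
  · filter_upwards [h1] with ω h1 hω
    rw [Set.mem_union, not_or] at hω
    rw [h2 ω hω.2]
    exact h1 hω.1

theorem integral_sq_sum_of_orthogonal {ι : Type*} {Z : ι → Ω → ℝ} (s : Finset ι)
    (h2 : ∀ i, MemLp (Z i) 2 P) (ho : ∀ i j, i ≠ j → ∫ ω, Z i ω * Z j ω ∂P = 0) :
    ∫⁻ ω, ENNReal.ofReal ((∑ i ∈ s, Z i ω) ^ 2) ∂P =
      ENNReal.ofReal (∑ i ∈ s, ∫ ω, Z i ω ^ 2 ∂P) := by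
  have hm : ∀ i j, Integrable (fun ω => Z i ω * Z j ω) P := fun i j => (h2 i).integrable_mul (h2 j)
  have e : ∀ ω, (∑ i ∈ s, Z i ω) ^ 2 = ∑ i ∈ s, ∑ j ∈ s, Z i ω * Z j ω := fun ω => by
    rw [sq, Finset.sum_mul_sum]
  have hi : Integrable (fun ω => (∑ i ∈ s, Z i ω) ^ 2) P := by
    simp only [e]
    exact integrable_finsetSum _ fun i _ => integrable_finsetSum _ fun j _ => hm i j
  rw [← ofReal_integral_eq_lintegral_ofReal hi (Eventually.of_forall fun ω => sq_nonneg _)]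
  congr 1
  simp only [e]
  rw [integral_finsetSum _ fun i _ => integrable_finsetSum _ fun j _ => hm i j]
  refine Finset.sum_congr rfl fun i hi => ?_
  rw [integral_finsetSum _ fun j _ => hm i j, Finset.sum_eq_single_of_mem i hi]
  · simp only [sq]
  · intro j _ hj
    exact ho i j hj.symm

end InProbability

/-! ### The weak law of large numbers for products of innovations -/

section TailProbabilities

variable {Ω : Type*} [MeasurableSpace Ω] {P : Measure Ω}

theorem measure_lt_abs_le_tailFirstMoment {ξ : Ω → ℝ} (hξ : Measurable ξ) (hi : Integrable ξ P)
    {T : ℝ} (hT : 0 < T) :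
    P {ω | T < |ξ ω|} ≤ ENNReal.ofReal (tailFirstMoment ξ P T / T) := by
  rw [ENNReal.ofReal_div_of_pos hT, ENNReal.le_div_iff_mul_le
    (Or.inl (ENNReal.ofReal_pos.2 hT).ne') (Or.inl ENNReal.ofReal_ne_top)]
  unfold tailFirstMoment
  rw [ofReal_integral_eq_lintegral_ofReal (integrable_indicator_lt_abs hξ hi T)
    (Eventually.of_forall fun ω => Set.indicator_nonneg (fun _ _ => abs_nonneg _) _), mul_comm,
    ← lintegral_indicator_const (measurableSet_lt_abs hξ T)]
  refine lintegral_mono fun ω => ?_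
  by_cases h : T < |ξ ω|
  · rw [Set.indicator_of_mem (show ω ∈ {ω | T < |ξ ω|} from h),
      Set.indicator_of_mem (show ω ∈ {ω | T < |ξ ω|} from h)]
    exact ENNReal.ofReal_le_ofReal h.le
  · rw [Set.indicator_of_notMem (show ω ∉ {ω | T < |ξ ω|} from h)]
    exact bot_le

theorem IsCenteredDANInnovation.measure_exists_lt_abs_le {ε : ℤ → Ω → ℝ}
    (hε : IsCenteredDANInnovation ε P) {ι : Type*} (s : Finset ι) (k : ι → ℤ) {T : ι → ℝ}
    (hT : ∀ i, 0 < T i) {b : ℝ} (hb : ∀ i, tailFirstMoment (ε 0) P (T i) / T i ≤ b) :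
    P {ω | ∃ i ∈ s, T i < |ε (k i) ω|} ≤ ENNReal.ofReal (s.card * b) := by
  have e : {ω | ∃ i ∈ s, T i < |ε (k i) ω|} = ⋃ i ∈ s, {ω | T i < |ε (k i) ω|} := by
    ext ω; simp
  rw [e]
  refine (measure_biUnion_finset_le _ _).trans ?_
  calc _ ≤ ∑ i ∈ s, ENNReal.ofReal b := by
        refine Finset.sum_le_sum fun i _ => ?_
        have h := (hε.identDistrib (k i)).measure_mem_eq
          (measurableSet_lt (measurable_const (a := T i)) continuous_abs.measurable)
        refine h.le.trans ((measure_lt_abs_le_tailFirstMoment (hε.measurable 0) hε.integrable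
          (hT i)).trans (ENNReal.ofReal_le_ofReal (hb i)))
    _ = _ := by
        rw [Finset.sum_const, nsmul_eq_mul, ENNReal.ofReal_mul (by positivity), ENNReal.ofReal_natCast]

/-- The truncated fourth moment is `o(T² l(T))`, the truncated second moment varying slowly: the
part with `|ξ| ≤ κ T` is small because `κ` is, and the remaining part because `l(κ T)` is close to
`l(T)`. -/
theorem integral_sq_indicator_sq_le [IsFiniteMeasure P] {ξ : Ω → ℝ} (hξ : Measurable ξ) {T κ : ℝ}
    (hκ1 : κ ≤ 1) (hT : 0 ≤ T) :
    ∫ ω, ({ω | |ξ ω| ≤ T}.indicator (fun ω => ξ ω ^ 2) ω) ^ 2 ∂P ≤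
      (κ * T) ^ 2 * truncSecondMoment ξ P T +
        T ^ 2 * (truncSecondMoment ξ P T - truncSecondMoment ξ P (κ * T)) := by
  have hle : κ * T ≤ T := mul_le_of_le_one_left hT hκ1
  have i1 := integrable_indicator_abs_le (P := P) hξ T
  have i2 := integrable_indicator_abs_le (P := P) hξ (κ * T)
  have i3 : Integrable (fun ω => T ^ 2 * ({ω | |ξ ω| ≤ T}.indicator (fun ω => ξ ω ^ 2) ω -
      {ω | |ξ ω| ≤ κ * T}.indicator (fun ω => ξ ω ^ 2) ω)) P := (i1.sub i2).const_mul _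
  have i4 : Integrable (fun ω => (κ * T) ^ 2 * {ω | |ξ ω| ≤ T}.indicator (fun ω => ξ ω ^ 2) ω) P :=
    i1.const_mul _
  unfold truncSecondMoment
  rw [← integral_sub i1 i2, ← integral_const_mul, ← integral_const_mul, ← integral_add i4 i3]
  refine integral_mono_of_nonneg (Eventually.of_forall fun ω => sq_nonneg _) (i4.add i3)
    (Eventually.of_forall fun ω => ?_)
  have hsq : ξ ω ^ 2 = |ξ ω| ^ 2 := (sq_abs _).symm
  simp only [Set.indicator, Set.mem_ofPred_eq]
  by_cases h1 : |ξ ω| ≤ κ * T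
  · rw [if_pos h1, if_pos (h1.trans hle)]
    have : ξ ω ^ 2 ≤ (κ * T) ^ 2 := by rw [hsq]; gcongr
    nlinarith [sq_nonneg (ξ ω)]
  · rw [if_neg h1]
    by_cases h2 : |ξ ω| ≤ T
    · rw [if_pos h2]
      have : ξ ω ^ 2 ≤ T ^ 2 := by rw [hsq]; gcongr
      nlinarith [sq_nonneg (ξ ω), mul_nonneg (sq_nonneg (κ * T)) (sq_nonneg (ξ ω))]
    · rw [if_neg h2]; simp

end TailProbabilities

namespace IsTruncScale

variable {l tail : ℝ → ℝ} {α δ κ : ℝ} {n : ℕ} {η : ℝ}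

theorem le_growingLevel (h : IsTruncScale l tail δ κ n η) (r : ℕ) : η ≤ growingLevel η n r :=
  le_mul_of_one_le_right (zero_le_one.trans h.one_le)
    (Real.one_le_sqrt.2 (by linarith [show 0 ≤ (r : ℝ) / n by positivity]))

theorem scale_pos (h : IsTruncScale l tail δ κ n η) : 0 < n * l η :=
  mul_pos (Nat.cast_pos.2 h.n_pos) h.pos

theorem sqrt_le_level (h : IsTruncScale l tail δ κ n η) : √(n * l η) ≤ 2 * η := by
  have := h.one_le
  refine Real.sqrt_le_iff.2 ⟨by linarith, h.le_level.trans (by nlinarith)⟩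

theorem tail_le (h : IsTruncScale l tail δ κ n η) (hκ : 0 ≤ κ) (hδ : δ ≤ 1 / 2) (r : ℕ) :
    tail (growingLevel η n r) ≤ κ * (√(n * l η) / n) := by
  refine (h.tail r).trans (mul_le_of_le_one_right (by positivity) ?_)
  exact Real.rpow_le_one_of_one_le_of_nonpos (by linarith [show 0 ≤ (r : ℝ) / n by positivity])
    (by linarith)

theorem tail_div_le (h : IsTruncScale l tail δ κ n η) (hκ : 0 ≤ κ) (hδ : δ ≤ 1 / 2) (r : ℕ) :
    tail (growingLevel η n r) / growingLevel η n r ≤ 2 * κ / n := by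
  have hg := h.growingLevel_pos r
  have hn : (0 : ℝ) < n := Nat.cast_pos.2 h.n_pos
  rw [div_le_iff₀ hg]
  refine (h.tail_le hκ hδ r).trans ?_
  calc κ * (√(n * l η) / n) ≤ κ * (2 * growingLevel η n r / n) := by
        gcongr; exact h.sqrt_le_level.trans (by linarith [h.le_growingLevel r])
    _ = _ := by ring

theorem growingLevel_zero (η : ℝ) (n : ℕ) : growingLevel η n 0 = η := by simp [growingLevel]

end IsTruncScale

section Products

variable {Ω : Type*} [MeasurableSpace Ω] {P : Measure Ω} [IsProbabilityMeasure P] {ε : ℤ → Ω → ℝ}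
  {δ : ℝ}

/-- With high probability, none of the innovations `ε_{i-p}`, `1 ≤ i ≤ n`, exceeds the truncation
level. -/
theorem IsCenteredDANInnovation.eventually_exists_bad_set (hε : IsCenteredDANInnovation ε P)
    (p : ℤ) {ρ : ℝ} (hρ : 0 < ρ) :
    ∀ᶠ n : ℕ in atTop, ∃ B : Set Ω, P B ≤ ENNReal.ofReal ρ ∧
      ∀ ω, ω ∉ B → ∀ i ∈ Finset.Icc 1 n,
        |ε ((i : ℤ) - p) ω| ≤ truncLevel (truncSecondMoment (ε 0) P) n := by
  filter_upwards [hε.eventually_isTruncScale (show (0 : ℝ) < 1 / 4 by norm_num)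
    (show 0 < ρ / 2 by positivity)] with n h
  have hn : (0 : ℝ) < n := Nat.cast_pos.2 h.n_pos
  refine ⟨_, (hε.measure_exists_lt_abs_le (Finset.Icc 1 n) (fun i => (i : ℤ) - p)
    (T := fun _ => truncLevel (truncSecondMoment (ε 0) P) n)
    (fun _ => zero_lt_one.trans_le h.one_le) (b := ρ / n) fun i => ?_).trans (le_of_eq ?_), ?_⟩
  · have := h.tail_div_le (by positivity) (by norm_num) 0
    rw [IsTruncScale.growingLevel_zero] at this
    refine this.trans (le_of_eq (by ring))
  · rw [Nat.card_Icc]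
    congr 1
    rw [Nat.add_sub_cancel]
    field_simp
  · intro ω hω i hi
    by_contra hc
    exact hω ⟨i, hi, not_le.1 hc⟩

omit [IsProbabilityMeasure P] in
theorem IsCenteredDANInnovation.iIndepFun_shift (hε : IsCenteredDANInnovation ε P) (p : ℤ) :
    iIndepFun (fun i : ℕ => ε ((i : ℤ) - p)) P :=
  hε.indep.precomp (g := fun i : ℕ => (i : ℤ) - p) fun r s h => by simpa using h

/-- The weak law of large numbers for the squares of the innovations, by truncation at `η_n` and
Chebyshev's inequality. -/
theorem IsCenteredDANInnovation.tendstoInMeasure_sum_sq (hε : IsCenteredDANInnovation ε P) (p : ℤ) :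
    TendstoInMeasure P (fun (n : ℕ) ω => 1 / (n * truncVar (truncSecondMoment (ε 0) P) n) *
      ∑ i ∈ Finset.Icc 1 n, ε ((i : ℤ) - p) ω * ε ((i : ℤ) - p) ω) atTop (fun _ => 1) := by
  have hm0 := hε.measurable 0
  set l := truncSecondMoment (ε 0) P with hl
  set η := truncLevel l with hη
  have hsc := hε.eventually_isTruncScale (show (0 : ℝ) < 1 / 4 by norm_num) one_pos
  let f : ℝ → ℝ → ℝ := fun T y => {y : ℝ | |y| ≤ T}.indicator (fun y => y ^ 2) y
  have hfm : ∀ T, Measurable (f T) := fun T => (measurable_id.pow_const 2).indicator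
    (measurableSet_le continuous_abs.measurable measurable_const)
  have hf0 : ∀ T k, ∫ ω, f T (ε k ω) ∂P = l T := fun T k =>
    ((hε.identDistrib k).comp (hfm T)).integral_eq
  have hf2 : ∀ T k, ∫ ω, f T (ε k ω) ^ 2 ∂P = ∫ ω, f T (ε 0 ω) ^ 2 ∂P := fun T k =>
    ((hε.identDistrib k).comp ((hfm T).pow_const 2)).integral_eq
  have hfL : ∀ T k, MemLp (fun ω => f T (ε k ω)) 2 P := fun T k =>
    MemLp.of_bound ((hfm T).comp (hε.measurable k)).aestronglyMeasurable (T ^ 2)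
      (Eventually.of_forall fun ω => by
        rw [Real.norm_of_nonneg (Set.indicator_nonneg (fun _ _ => sq_nonneg _) _)]
        exact indicator_abs_le_sq_le (ξ := id) T (ε k ω))
  -- The truncated squares, centered; they coincide with the squares outside a bad set.
  let g : ℕ → Ω → ℝ := fun n ω => 1 / (n * l (η n)) *
    ∑ i ∈ Finset.Icc 1 n, (f (η n) (ε ((i : ℤ) - p) ω) - l (η n))
  have hb : ∀ᶠ n : ℕ in atTop, ∫⁻ ω, ENNReal.ofReal (g n ω ^ 2) ∂P ≤
      ENNReal.ofReal ((∫ ω, f (η n) (ε 0 ω) ^ 2 ∂P) / (n * l (η n) ^ 2)) := by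
    filter_upwards [hsc] with n h
    have hn : (0 : ℝ) < n := Nat.cast_pos.2 h.n_pos
    have hlp : 0 < l (η n) := h.pos
    have h1 := lintegral_sq_finset_sum (P := P)
      (Y := fun (i : ℕ) ω => f (η n) (ε ((i : ℤ) - p) ω) - l (η n))
      ((hε.iIndepFun_shift p).comp (fun _ y => f (η n) y - l (η n)) fun _ => (hfm _).sub_const _)
      (fun i => (hfL _ _).sub (memLp_const _))
      (fun i => by
        rw [integral_sub ((hfL _ _).integrable one_le_two) (integrable_const _), hf0]; simp)
      (Finset.Icc 1 n)
    have h2 : ∀ i : ℕ, ∫ ω, (f (η n) (ε ((i : ℤ) - p) ω) - l (η n)) ^ 2 ∂P ≤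
        ∫ ω, f (η n) (ε 0 ω) ^ 2 ∂P := by
      intro i
      have i1 : Integrable (fun ω => f (η n) (ε ((i : ℤ) - p) ω) ^ 2) P := (hfL _ _).integrable_sq
      have i2 : Integrable (fun ω => 2 * l (η n) * f (η n) (ε ((i : ℤ) - p) ω)) P :=
        ((hfL _ _).integrable one_le_two).const_mul _
      have i3 : Integrable (fun ω => f (η n) (ε ((i : ℤ) - p) ω) ^ 2 -
        2 * l (η n) * f (η n) (ε ((i : ℤ) - p) ω)) P := i1.sub i2
      have e : ∀ ω, (f (η n) (ε ((i : ℤ) - p) ω) - l (η n)) ^ 2 =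
        f (η n) (ε ((i : ℤ) - p) ω) ^ 2 - 2 * l (η n) * f (η n) (ε ((i : ℤ) - p) ω) +
          l (η n) ^ 2 := fun ω => by ring
      simp only [e]
      rw [integral_add i3 (integrable_const _), integral_sub i1 i2, integral_const_mul, hf0, hf2]
      simp only [integral_const, probReal_univ, one_smul]
      nlinarith [sq_nonneg (l (η n))]
    simp only [g, mul_pow]
    simp only [ENNReal.ofReal_mul (sq_nonneg (1 / ((n : ℝ) * l (η n))))]
    rw [lintegral_const_mul' _ _ ENNReal.ofReal_ne_top, h1,
      ← ENNReal.ofReal_sum_of_nonneg fun i _ => integral_nonneg fun ω => sq_nonneg _,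
      ← ENNReal.ofReal_mul (sq_nonneg _)]
    refine ENNReal.ofReal_le_ofReal ?_
    calc _ ≤ (1 / ((n : ℝ) * l (η n))) ^ 2 * (n * ∫ ω, f (η n) (ε 0 ω) ^ 2 ∂P) := by
          gcongr
          refine (Finset.sum_le_card_nsmul _ _ _ fun i _ => h2 i).trans (le_of_eq ?_)
          simp
      _ = _ := by field_simp
  have hη_top : Tendsto η atTop atTop :=
    (truncLevel_spec (truncSecondMoment_mono hm0) hε.slowlyVarying).1
  have hb0 : Tendsto (fun n : ℕ => (∫ ω, f (η n) (ε 0 ω) ^ 2 ∂P) / (n * l (η n) ^ 2)) atTop (𝓝 0) := by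
    rw [tendsto_order]
    constructor
    · intro c hc
      filter_upwards with n
      exact hc.trans_le (div_nonneg (integral_nonneg fun _ => sq_nonneg _) (by positivity))
    · intro c hc
      -- The two terms of the bound on the fourth moment each contribute at most a quarter of `c`,
      -- as `η² ≤ 4 n l(η)`.
      set κ := min (√(c / 16)) 1
      have hκ : 0 < κ := lt_min (Real.sqrt_pos.2 (by positivity)) one_pos
      have hκc : κ ^ 2 ≤ c / 16 := by
        have : κ ^ 2 ≤ √(c / 16) ^ 2 := by gcongr; exact min_le_left _ _
        rwa [Real.sq_sqrt (by positivity)] at this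
      have hr := hε.slowlyVarying.tendsto_div (x := η) (y := fun n => κ * η n) hη_top hκ
        (tendsto_const_nhds.congr' (by
          filter_upwards [hη_top.eventually_gt_atTop 0] with n hn
          field_simp))
      filter_upwards [hsc, hr.eventually_const_lt (show 1 - c / 16 < 1 by linarith)] with n h h3
      have hn : (0 : ℝ) < n := Nat.cast_pos.2 h.n_pos
      have hlp : 0 < l (η n) := h.pos
      have h4 : (1 - c / 16) * l (η n) < l (κ * η n) := (lt_div_iff₀ hlp).1 h3
      have h5 := integral_sq_indicator_sq_le (P := P) hm0 (κ := κ) (min_le_right _ _)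
        (zero_le_one.trans h.one_le)
      have h5' : ∫ ω, f (η n) (ε 0 ω) ^ 2 ∂P ≤
        (κ * η n) ^ 2 * l (η n) + η n ^ 2 * (l (η n) - l (κ * η n)) := h5
      have h6 : (η n) ^ 2 ≤ 4 * (n * l (η n)) := h.level_le
      have hη0 : 0 < η n := zero_lt_one.trans_le h.one_le
      rw [div_lt_iff₀ (by positivity)]
      calc _ ≤ (κ * η n) ^ 2 * l (η n) + η n ^ 2 * (l (η n) - l (κ * η n)) := h5'
        _ ≤ (κ * η n) ^ 2 * l (η n) + η n ^ 2 * (c / 16 * l (η n)) := by gcongr; linarith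
        _ = (κ ^ 2 + c / 16) * l (η n) * η n ^ 2 := by ring
        _ ≤ (c / 16 + c / 16) * l (η n) * (4 * (n * l (η n))) := by gcongr
        _ < c * (n * l (η n) ^ 2) := by nlinarith [mul_pos hc (mul_pos hn (pow_pos hlp 2))]
  have hg : TendstoInMeasure P g atTop (fun _ => 0) := by
    refine tendstoInMeasure_zero_of_sq (fun n => ?_) hb hb0
    exact ((Finset.measurable_sum _ fun i _ =>
      ((hfm _).comp (hε.measurable _)).sub_const _).const_mul _).aemeasurable
  have hg1 : TendstoInMeasure P (fun n ω => g n ω + 1) atTop (fun _ => 0 + 1) := by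
    refine TendstoInMeasure.add_real hg ?_
    rw [tendstoInMeasure_const_iff]
    exact fun θ hθ ρ hρ => Eventually.of_forall fun n => ⟨∅, by simp, Eventually.of_forall
      fun ω _ => by simpa using hθ.le⟩
  rw [zero_add] at hg1
  refine TendstoInMeasure.of_whp_eq hg1 fun ρ hρ => ?_
  filter_upwards [hε.eventually_exists_bad_set p hρ, hsc] with n ⟨B, hB, h1⟩ h
  have hn : (0 : ℝ) < n := Nat.cast_pos.2 h.n_pos
  have hlp : 0 < l (η n) := h.pos
  refine ⟨B, hB, fun ω hω => ?_⟩
  have h2 : ∑ i ∈ Finset.Icc 1 n, (f (η n) (ε ((i : ℤ) - p) ω) - l (η n)) =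
      ∑ i ∈ Finset.Icc 1 n, ε ((i : ℤ) - p) ω * ε ((i : ℤ) - p) ω - n * l (η n) := by
    rw [Finset.sum_sub_distrib]
    congr 1
    · refine Finset.sum_congr rfl fun i hi => ?_
      rw [← sq]
      exact Set.indicator_of_mem (show ε ((i : ℤ) - p) ω ∈ {y : ℝ | |y| ≤ η n} from h1 ω hω i hi) _
    · simp
  simp only [g, h2, truncVar]
  rw [mul_sub, ← hη]
  field_simp
  ring

/-- The truncation of `ε_k` at level `T`, recentered. -/
noncomputable def centeredTrunc (ε : ℤ → Ω → ℝ) (P : Measure Ω) (T : ℝ) (k : ℤ) (ω : Ω) : ℝ :=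
  truncCore (truncMean (ε 0) P T) T (ε k ω)

namespace IsCenteredDANInnovation

variable (hε : IsCenteredDANInnovation ε P) (T : ℝ)

include hε

omit [IsProbabilityMeasure P] in
theorem measurable_centeredTrunc (k : ℤ) : Measurable (centeredTrunc ε P T k) :=
  (measurable_truncCore _ _).comp (hε.measurable _)

omit [IsProbabilityMeasure P] in
theorem iIndepFun_centeredTrunc : iIndepFun (centeredTrunc ε P T) P :=
  hε.indep.comp (fun _ => truncCore (truncMean (ε 0) P T) T) fun _ => measurable_truncCore _ _

theorem integral_centeredTrunc (k : ℤ) : ∫ ω, centeredTrunc ε P T k ω ∂P = 0 := by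
  have h := hε.integral_coreInnovation (T := fun _ => T) k 0
  simpa [coreInnovation, centeredTrunc] using h

theorem integral_sq_centeredTrunc_le (k : ℤ) :
    ∫ ω, centeredTrunc ε P T k ω ^ 2 ∂P ≤ truncSecondMoment (ε 0) P T := by
  have h := hε.integral_sq_coreInnovation_le (T := fun _ => T) k 0
  simpa [coreInnovation, centeredTrunc] using h

theorem memLp_centeredTrunc {T : ℝ} (hT : 0 ≤ T) (k : ℤ) : MemLp (centeredTrunc ε P T k) 2 P :=
  memLp_truncCore (hε.measurable _) _ hT

theorem memLp_centeredTrunc_mul {T : ℝ} (hT : 0 ≤ T) (k j : ℤ) :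
    MemLp (fun ω => centeredTrunc ε P T k ω * centeredTrunc ε P T j ω) 2 P := by
  refine MemLp.of_bound ((hε.measurable_centeredTrunc T k).mul
    (hε.measurable_centeredTrunc T j)).aestronglyMeasurable
    ((T + |truncMean (ε 0) P T|) * (T + |truncMean (ε 0) P T|)) (Eventually.of_forall fun ω => ?_)
  rw [norm_mul]
  exact mul_le_mul (abs_truncCore_le _ hT _) (abs_truncCore_le _ hT _) (norm_nonneg _)
    (by positivity)

omit hε [IsProbabilityMeasure P] in
theorem _root_.ProbabilityTheory.iIndepFun.integral_mul_triple_eq_zero {Z : ℤ → Ω → ℝ}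
    (hind : iIndepFun Z P) (hm : ∀ k, Measurable (Z k)) {k a b c : ℤ} (hz : ∫ ω, Z k ω ∂P = 0)
    (ha : k ≠ a) (hb : k ≠ b) (hc : k ≠ c) :
    ∫ ω, Z k ω * (Z a ω * Z b ω * Z c ω) ∂P = 0 := by
  have h := hind.indepFun_finset {k} {a, b, c} (by simp [ha, hb, hc]) hm
  let ik : ({k} : Finset ℤ) := ⟨k, by simp⟩
  let ia : ({a, b, c} : Finset ℤ) := ⟨a, by simp⟩
  let ib : ({a, b, c} : Finset ℤ) := ⟨b, by simp⟩
  let ic : ({a, b, c} : Finset ℤ) := ⟨c, by simp⟩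
  have m1 : Measurable fun v : (({k} : Finset ℤ) → ℝ) => v ik := measurable_pi_apply ik
  have m2 : Measurable fun v : (({a, b, c} : Finset ℤ) → ℝ) => v ia * v ib * v ic :=
    ((measurable_pi_apply ia).mul (measurable_pi_apply ib)).mul (measurable_pi_apply ic)
  have h1 := h.comp m1 m2
  have h2 := h1.integral_fun_mul_eq_mul_integral (hm k).aestronglyMeasurable
    (((hm a).mul (hm b)).mul (hm c)).aestronglyMeasurable
  refine h2.trans ?_
  change (∫ ω, Z k ω ∂P) * _ = 0
  rw [hz, zero_mul]

/-- The products `ξ_{i-p} ξ_{i-q}`, with `p ≠ q` fixed and `i` varying, are pairwise orthogonal. -/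
theorem integral_centeredTrunc_mul_eq_zero {p q : ℤ} (hpq : p ≠ q) {i j : ℕ} (hij : i ≠ j) :
    ∫ ω, (centeredTrunc ε P T (i - p) ω * centeredTrunc ε P T (i - q) ω) *
      (centeredTrunc ε P T (j - p) ω * centeredTrunc ε P T (j - q) ω) ∂P = 0 := by
  have hind := hε.iIndepFun_centeredTrunc T
  have hm := hε.measurable_centeredTrunc T
  have hz := hε.integral_centeredTrunc T
  -- the largest of the four indices occurs only once
  rcases lt_or_gt_of_ne hpq with h | h <;> rcases lt_or_gt_of_ne hij with h' | h'
  · rw [← hind.integral_mul_triple_eq_zero hm (hz (j - p)) (a := i - p) (b := i - q) (c := j - q)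
      (by omega) (by omega) (by omega)]
    congr 1; ext ω; ring
  · rw [← hind.integral_mul_triple_eq_zero hm (hz (i - p)) (a := i - q) (b := j - p) (c := j - q)
      (by omega) (by omega) (by omega)]
    congr 1; ext ω; ring
  · rw [← hind.integral_mul_triple_eq_zero hm (hz (j - q)) (a := i - p) (b := i - q) (c := j - p)
      (by omega) (by omega) (by omega)]
    congr 1; ext ω; ring
  · rw [← hind.integral_mul_triple_eq_zero hm (hz (i - q)) (a := i - p) (b := j - p) (c := j - q)
      (by omega) (by omega) (by omega)]
    congr 1; ext ω; ring

theorem integral_sq_centeredTrunc_mul_le {k j : ℤ} (hkj : k ≠ j) :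
    ∫ ω, (centeredTrunc ε P T k ω * centeredTrunc ε P T j ω) ^ 2 ∂P ≤
      truncSecondMoment (ε 0) P T ^ 2 := by
  have hm := hε.measurable_centeredTrunc T
  have h := ((hε.iIndepFun_centeredTrunc T).indepFun hkj).comp (φ := fun y => y ^ 2)
    (ψ := fun y => y ^ 2) (measurable_id.pow_const 2) (measurable_id.pow_const 2)
  have h2 := h.integral_fun_mul_eq_mul_integral ((hm k).pow_const 2).aestronglyMeasurable
    ((hm j).pow_const 2).aestronglyMeasurable
  simp only [mul_pow]
  refine h2.le.trans ?_
  rw [sq (truncSecondMoment (ε 0) P T)]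
  exact mul_le_mul (hε.integral_sq_centeredTrunc_le T k) (hε.integral_sq_centeredTrunc_le T j)
    (integral_nonneg fun _ => sq_nonneg _) (truncSecondMoment_nonneg T)

/-- The off-diagonal products average out: after centering at the truncated mean they are
orthogonal, and the centerings are negligible. -/
theorem tendstoInMeasure_sum_mul {p q : ℤ} (hpq : p ≠ q) :
    TendstoInMeasure P (fun (n : ℕ) ω => 1 / (n * truncVar (truncSecondMoment (ε 0) P) n) *
      ∑ i ∈ Finset.Icc 1 n, ε ((i : ℤ) - p) ω * ε ((i : ℤ) - q) ω) atTop (fun _ => 0) := by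
  set l := truncSecondMoment (ε 0) P with hl
  set η := truncLevel l with hη
  have hsc := hε.eventually_isTruncScale (show (0 : ℝ) < 1 / 4 by norm_num) one_pos
  let m : ℕ → ℝ := fun n => truncMean (ε 0) P (η n)
  let z : ℕ → ℤ → Ω → ℝ := fun n k ω => centeredTrunc ε P (η n) k ω
  have hzm : ∀ n k, Measurable (z n k) := fun n k => hε.measurable_centeredTrunc _ k
  have hmQ : ∀ᶠ n : ℕ in atTop, m n ^ 2 ≤ n * l (η n) / n ^ 2 := by
    filter_upwards [hsc] with n h
    have h1 := (abs_truncMean_le (hε.measurable 0) hε.integrable hε.centered (η n)).trans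
      (by simpa only [IsTruncScale.growingLevel_zero] using
        h.tail_le zero_le_one (by norm_num) 0)
    rw [one_mul] at h1
    calc m n ^ 2 = |m n| ^ 2 := (sq_abs _).symm
      _ ≤ (√(n * l (η n)) / n) ^ 2 := by gcongr
      _ = _ := by rw [div_pow, Real.sq_sqrt h.scale_pos.le]
  have hlim : Tendsto (fun n : ℕ => 1 / (n : ℝ)) atTop (𝓝 0) := tendsto_one_div_atTop_nhds_zero_nat
  -- The terms linear in the truncated innovations, produced by the centering.
  have hlin : ∀ p : ℤ, TendstoInMeasure P (fun n ω => 1 / (n * l (η n)) *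
      (m n * ∑ i ∈ Finset.Icc 1 n, z n ((i : ℤ) - p) ω)) atTop (fun _ => 0) := by
    intro p
    refine tendstoInMeasure_zero_of_sq (b := fun n => 1 / (n : ℝ)) (fun n => ?_) ?_ hlim
    · exact (((Finset.measurable_sum _ fun i _ => hzm _ _).const_mul _).const_mul _).aemeasurable
    · filter_upwards [hsc, hmQ] with n h hmq
      have hn : (0 : ℝ) < n := Nat.cast_pos.2 h.n_pos
      have hn1 : (1 : ℝ) ≤ n := Nat.one_le_cast.2 h.n_pos
      have hlp : 0 < l (η n) := h.pos
      have hη0 : 0 ≤ η n := zero_le_one.trans h.one_le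
      have h1 := lintegral_sq_finset_sum (P := P) (Y := fun (i : ℕ) ω => z n ((i : ℤ) - p) ω)
        ((hε.iIndepFun_centeredTrunc (η n)).precomp (g := fun i : ℕ => (i : ℤ) - p)
          fun r s h => by simpa using h)
        (fun i => hε.memLp_centeredTrunc hη0 _) (fun i => hε.integral_centeredTrunc _ _)
        (Finset.Icc 1 n)
      simp only [mul_pow, ← mul_assoc]
      simp only [ENNReal.ofReal_mul (show 0 ≤ (1 / ((n : ℝ) * l (η n))) ^ 2 * m n ^ 2 by positivity)]
      rw [lintegral_const_mul' _ _ ENNReal.ofReal_ne_top, h1,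
        ← ENNReal.ofReal_sum_of_nonneg fun i _ => integral_nonneg fun ω => sq_nonneg _,
        ← ENNReal.ofReal_mul (by positivity)]
      refine ENNReal.ofReal_le_ofReal ?_
      calc _ ≤ (1 / ((n : ℝ) * l (η n))) ^ 2 * (n * l (η n) / n ^ 2) * (n * l (η n)) := by
            gcongr
            refine (Finset.sum_le_card_nsmul _ _ _ fun i _ =>
              hε.integral_sq_centeredTrunc_le _ _).trans (le_of_eq ?_)
            simp [hl]
        _ = 1 / n * (1 / n) := by field_simp
        _ ≤ 1 / n * 1 := by
            gcongr
            rw [div_le_one hn]; exact hn1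
        _ = 1 / n := mul_one _
  have hquad : TendstoInMeasure P (fun n ω => 1 / (n * l (η n)) *
      ∑ i ∈ Finset.Icc 1 n, z n ((i : ℤ) - p) ω * z n ((i : ℤ) - q) ω) atTop (fun _ => 0) := by
    refine tendstoInMeasure_zero_of_sq (b := fun n => 1 / (n : ℝ)) (fun n => ?_) ?_ hlim
    · exact ((Finset.measurable_sum _ fun i _ => (hzm _ _).mul (hzm _ _)).const_mul _).aemeasurable
    · filter_upwards [hsc] with n h
      have hn : (0 : ℝ) < n := Nat.cast_pos.2 h.n_pos
      have hlp : 0 < l (η n) := h.pos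
      have hη0 : 0 ≤ η n := zero_le_one.trans h.one_le
      have h1 := integral_sq_sum_of_orthogonal (P := P)
        (Z := fun (i : ℕ) ω => z n ((i : ℤ) - p) ω * z n ((i : ℤ) - q) ω) (Finset.Icc 1 n)
        (fun i => hε.memLp_centeredTrunc_mul hη0 _ _)
        (fun i j hij => hε.integral_centeredTrunc_mul_eq_zero _ hpq hij)
      simp only [mul_pow (1 / ((n : ℝ) * l (η n)))]
      simp only [ENNReal.ofReal_mul (sq_nonneg (1 / ((n : ℝ) * l (η n))))]
      rw [lintegral_const_mul' _ _ ENNReal.ofReal_ne_top, h1, ← ENNReal.ofReal_mul (sq_nonneg _)]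
      refine ENNReal.ofReal_le_ofReal ?_
      calc _ ≤ (1 / ((n : ℝ) * l (η n))) ^ 2 * (n * l (η n) ^ 2) := by
            gcongr
            refine (Finset.sum_le_card_nsmul _ _ (l (η n) ^ 2) fun i _ => ?_).trans
              (le_of_eq (by simp))
            exact hε.integral_sq_centeredTrunc_mul_le (η n) (k := (i : ℤ) - p) (j := (i : ℤ) - q)
              (by omega)
        _ = 1 / n := by field_simp
  have hconst : TendstoInMeasure P (fun n (_ : Ω) => 1 / (n * l (η n)) * (n * m n ^ 2)) atTop
      (fun _ => 0) := by
    refine tendstoInMeasure_zero_of_sq (b := fun n => 1 / (n : ℝ)) (fun n => aemeasurable_const) ?_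
      hlim
    filter_upwards [hsc, hmQ] with n h hmq
    have hn : (0 : ℝ) < n := Nat.cast_pos.2 h.n_pos
    have hn1 : (1 : ℝ) ≤ n := Nat.one_le_cast.2 h.n_pos
    have hlp : 0 < l (η n) := h.pos
    rw [lintegral_const, measure_univ, mul_one]
    refine ENNReal.ofReal_le_ofReal ?_
    calc _ ≤ (1 / ((n : ℝ) * l (η n)) * (n * (n * l (η n) / n ^ 2))) ^ 2 := by gcongr
      _ = 1 / n * (1 / n) := by field_simp
      _ ≤ 1 / n * 1 := by
          gcongr
          rw [div_le_one hn]; exact hn1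
      _ = 1 / n := mul_one _
  have hall := TendstoInMeasure.add_real (TendstoInMeasure.add_real hquad (hlin p))
    (TendstoInMeasure.add_real (hlin q) hconst)
  simp only [add_zero] at hall
  refine TendstoInMeasure.of_whp_eq hall fun ρ hρ => ?_
  filter_upwards [hε.eventually_exists_bad_set p (half_pos hρ),
    hε.eventually_exists_bad_set q (half_pos hρ)] with n ⟨B, hB, h1⟩ ⟨B', hB', h2⟩
  refine ⟨B ∪ B', ?_, fun ω hω => ?_⟩
  · refine (measure_union_le _ _).trans ((add_le_add hB hB').trans ?_)
    rw [← ENNReal.ofReal_add (by positivity) (by positivity), add_halves]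
  · rw [Set.mem_union, not_or] at hω
    have hz : ∀ k, |ε k ω| ≤ η n → ε k ω = z n k ω + m n := by
      intro k hk
      simp only [z, centeredTrunc, truncCore, if_pos hk, m]
      ring
    have hsum : ∑ i ∈ Finset.Icc 1 n, ε ((i : ℤ) - p) ω * ε ((i : ℤ) - q) ω =
        ∑ i ∈ Finset.Icc 1 n, z n ((i : ℤ) - p) ω * z n ((i : ℤ) - q) ω +
          m n * ∑ i ∈ Finset.Icc 1 n, z n ((i : ℤ) - p) ω +
          (m n * ∑ i ∈ Finset.Icc 1 n, z n ((i : ℤ) - q) ω + n * m n ^ 2) := by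
      have hc : (n : ℝ) * m n ^ 2 = ∑ i ∈ Finset.Icc 1 n, m n ^ 2 := by simp
      rw [hc, Finset.mul_sum, Finset.mul_sum, ← Finset.sum_add_distrib, ← Finset.sum_add_distrib,
        ← Finset.sum_add_distrib]
      refine Finset.sum_congr rfl fun i hi => ?_
      rw [hz _ (h1 ω hω.1 i hi), hz _ (h2 ω hω.2 i hi)]
      ring
    rw [hsum]
    simp only [truncVar]
    ring

end IsCenteredDANInnovation

/-- The weak law of large numbers for the squares of a finite moving average. -/
theorem IsCenteredDANInnovation.tendstoInMeasure_sum_sq_finite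
    (hε : IsCenteredDANInnovation ε P) (a : ℕ → ℝ) (M : ℕ) :
    TendstoInMeasure P (fun (n : ℕ) ω => 1 / (n * truncVar (truncSecondMoment (ε 0) P) n) *
      ∑ i ∈ Finset.Icc 1 n, linearProcessPartial a ε i M ω ^ 2) atTop
      (fun _ => ∑ p ∈ Finset.range M, a p ^ 2) := by
  have h : ∀ p q : ℕ, TendstoInMeasure P (fun (n : ℕ) ω => a p * a q *
      (1 / (n * truncVar (truncSecondMoment (ε 0) P) n) *
      ∑ i ∈ Finset.Icc 1 n, ε ((i : ℤ) - p) ω * ε ((i : ℤ) - q) ω)) atTop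
      (fun _ => a p * a q * if p = q then 1 else 0) := by
    intro p q
    refine TendstoInMeasure.const_mul_real _ ?_
    split_ifs with hpq
    · subst hpq
      exact hε.tendstoInMeasure_sum_sq p
    · exact hε.tendstoInMeasure_sum_mul (by exact_mod_cast hpq)
  have h' := TendstoInMeasure.sum_real (Finset.range M) fun p =>
    TendstoInMeasure.sum_real (Finset.range M) fun q => h p q
  have e1 : ∑ p ∈ Finset.range M, ∑ q ∈ Finset.range M, (a p * a q * if p = q then 1 else 0) =
      ∑ p ∈ Finset.range M, a p ^ 2 := by
    refine Finset.sum_congr rfl fun p hp => ?_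
    rw [Finset.sum_eq_single_of_mem p hp (fun q _ hq => by simp [hq.symm])]
    simp [sq]
  rw [e1] at h'
  convert h' using 3 with n ω
  have e2 : ∀ i : ℕ, linearProcessPartial a ε i M ω ^ 2 = ∑ p ∈ Finset.range M,
      ∑ q ∈ Finset.range M, a p * a q * (ε ((i : ℤ) - p) ω * ε ((i : ℤ) - q) ω) := by
    intro i
    rw [linearProcessPartial, sq, Finset.sum_mul_sum]
    exact Finset.sum_congr rfl fun p _ => Finset.sum_congr rfl fun q _ => by ring
  simp only [e2]
  rw [Finset.sum_comm, Finset.mul_sum]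
  refine Finset.sum_congr rfl fun p _ => ?_
  rw [Finset.sum_comm, Finset.mul_sum]
  refine Finset.sum_congr rfl fun q _ => ?_
  rw [← Finset.mul_sum]
  ring

end Products

/-! ### The weak law of large numbers for the squares of the linear process -/

/-- The coefficients `a_j` with `j ≥ M`, the other ones being replaced by zero. -/
noncomputable def tailCoeff (a : ℕ → ℝ) (M j : ℕ) : ℝ := if j < M then 0 else a j

theorem abs_tailCoeff_le (a : ℕ → ℝ) (M j : ℕ) : |tailCoeff a M j| ≤ |a j| := by
  unfold tailCoeff
  split_ifs
  · simp
  · exact le_rfl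

theorem measure_lt_le_lintegral_div {Ω : Type*} [MeasurableSpace Ω] {P : Measure Ω} {f : Ω → ℝ≥0∞}
    (hf : AEMeasurable f P) {b t : ℝ} (hb : ∫⁻ ω, f ω ∂P ≤ ENNReal.ofReal b) (ht : 0 < t) :
    P {ω | ENNReal.ofReal t < f ω} ≤ ENNReal.ofReal (b / t) := by
  rw [ENNReal.ofReal_div_of_pos ht]
  refine (measure_mono fun ω hω => ?_).trans ((meas_ge_le_lintegral_div hf
    (ENNReal.ofReal_pos.2 ht).ne' ENNReal.ofReal_ne_top).trans (ENNReal.div_le_div_right hb _))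
  exact le_of_lt (show ENNReal.ofReal t < f ω from hω)

section Remainder

variable {Ω : Type*} [MeasurableSpace Ω] {P : Measure Ω} [IsProbabilityMeasure P] {ε : ℤ → Ω → ℝ}
  {a : ℕ → ℝ} {α δ C : ℝ} {N : ℕ}

/-- As `α > 1 / 2`, the share of the removed parts in the sum of squares, which is of order `n a_n²`
relative to `n l_n`, is negligible. -/
theorem IsPotterSequence.tendsto_mul_sq (ha : IsPotterSequence a α δ C N)
    (hsm : IsSmallExponent α δ) : Tendsto (fun n : ℕ => n * a n ^ 2) atTop (𝓝 0) := by
  obtain ⟨K, hK, hb⟩ := ha.exists_abs_le_rpow hsm.pos hsm.le_alpha hsm.add_lt_one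
  have hq : 0 < 2 * (α - δ) - 1 := by linarith [hsm.one_lt_sq]
  have h1 : Tendsto (fun n : ℕ => K ^ 2 * (1 + (n : ℝ)) ^ (-(2 * (α - δ) - 1))) atTop (𝓝 0) := by
    have h := (tendsto_rpow_neg_atTop hq).comp
      (tendsto_atTop_add_const_left atTop (1 : ℝ) tendsto_natCast_atTop_atTop)
    simpa using h.const_mul (K ^ 2)
  refine squeeze_zero (fun n => by positivity) (fun n => ?_) h1
  have hn : (0 : ℝ) < 1 + n := by positivity
  calc (n : ℝ) * a n ^ 2 ≤ (1 + n) * (K * (1 + (n : ℝ)) ^ (-(α - δ))) ^ 2 := by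
        rw [← sq_abs]
        gcongr
        · linarith
        · exact hb n
    _ = K ^ 2 * ((1 + (n : ℝ)) ^ (1 : ℝ) * ((1 + (n : ℝ)) ^ (-(α - δ)) * (1 + (n : ℝ)) ^ (-(α - δ)))) := by
        rw [Real.rpow_one]; ring
    _ = _ := by
        rw [← Real.rpow_add hn, ← Real.rpow_add hn]
        congr 2; ring

theorem IsCenteredDANInnovation.ae_linearProcess_eq_partial_add (hε : IsCenteredDANInnovation ε P)
    (hsm : IsSmallExponent α δ) (ha : IsPotterSequence a α δ C N) (M : ℕ) (k : ℤ) :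
    ∀ᵐ ω ∂P, linearProcess a ε k ω =
      linearProcessPartial a ε k M ω + linearProcess (tailCoeff a M) ε k ω := by
  filter_upwards [hε.ae_tendsto_linearProcess hsm ha (fun j => le_rfl) k,
    hε.ae_tendsto_linearProcess hsm ha (abs_tailCoeff_le a M) k] with ω h1 h2
  refine tendsto_nhds_unique h1 ((h2.const_add _).congr' ?_)
  filter_upwards [eventually_ge_atTop M] with m hm
  unfold linearProcessPartial
  obtain ⟨j, rfl⟩ := Nat.exists_eq_add_of_le hm
  have h0 : ∑ i ∈ Finset.range M, tailCoeff a M i * ε (k - i) ω = 0 :=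
    Finset.sum_eq_zero fun i hi => by rw [tailCoeff, if_pos (Finset.mem_range.1 hi), zero_mul]
  rw [Finset.sum_range_add, Finset.sum_range_add, h0, zero_add]
  congr 1
  refine Finset.sum_congr rfl fun i _ => ?_
  rw [tailCoeff, if_neg (by omega)]

/-- The second moment of the truncated part of `X_{K-d}`. -/
theorem IsCenteredDANInnovation.lintegral_sq_coreSeries_shiftCoeff_le
    (hε : IsCenteredDANInnovation ε P) (hδ : 0 ≤ δ) (hδ1 : δ ≤ 1) {κ : ℝ} {n : ℕ} {η : ℝ}
    (hsc : IsTruncScale (truncSecondMoment (ε 0) P) (tailFirstMoment (ε 0) P) δ κ n η) {K : ℤ}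
    {c : ℕ → ℝ} {d : ℕ} (hd : d ≤ n) (hs : Summable fun j : ℕ => c j ^ 2 * (1 + (j : ℝ)) ^ δ)
    (hlim : ∀ᵐ ω ∂P, Tendsto (fun M => ∑ r ∈ Finset.range M,
        shiftCoeff c d r * coreInnovation ε P (growingLevel η n) K r ω) atTop
        (𝓝 (coreSeries ε P (growingLevel η n) K (shiftCoeff c d) ω))) :
    ∫⁻ ω, ENNReal.ofReal (coreSeries ε P (growingLevel η n) K (shiftCoeff c d) ω ^ 2) ∂P ≤
      ENNReal.ofReal (4 * truncSecondMoment (ε 0) P η * ∑' j : ℕ, c j ^ 2 * (1 + (j : ℝ)) ^ δ) := by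
  have hn : (0 : ℝ) < n := Nat.cast_pos.2 hsc.n_pos
  have hn1 : (1 : ℝ) ≤ n := Nat.one_le_cast.2 hsc.n_pos
  have hl := hsc.pos
  refine (lintegral_sq_limit_le (hε.measurable_coreInnovation K) (hε.iIndepFun_coreInnovation K)
    (hε.memLp_coreInnovation K fun r => (hsc.growingLevel_pos r).le) (hε.integral_coreInnovation K)
    (hε.integral_sq_coreInnovation_le K) hlim).trans ?_
  rw [← Summable.sum_add_tsum_nat_add' (k := d) ENNReal.summable, Finset.sum_eq_zero, zero_add]
  · rw [← tsum_mul_left, ENNReal.ofReal_tsum_of_nonneg (fun j => by positivity) (hs.mul_left _)]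
    refine ENNReal.tsum_le_tsum fun j => ENNReal.ofReal_le_ofReal ?_
    rw [shiftCoeff, if_pos (by omega), Nat.add_sub_cancel]
    have h1 : 1 + ((j + d : ℕ) : ℝ) / n ≤ 2 * (1 + j) := by
      have h2 : (j : ℝ) / n ≤ j := div_le_self (by positivity) hn1
      have h3 : (d : ℝ) / n ≤ 1 := (div_le_one hn).2 (by exact_mod_cast hd)
      push_cast
      rw [add_div]
      linarith [show (0 : ℝ) ≤ j by positivity]
    have h4 : (1 + ((j + d : ℕ) : ℝ) / n) ^ δ ≤ 2 * (1 + (j : ℝ)) ^ δ := by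
      calc _ ≤ (2 * (1 + (j : ℝ))) ^ δ := by gcongr
        _ = 2 ^ δ * (1 + (j : ℝ)) ^ δ := Real.mul_rpow (by norm_num) (by positivity)
        _ ≤ 2 ^ (1 : ℝ) * (1 + (j : ℝ)) ^ δ := by gcongr; norm_num
        _ = _ := by rw [Real.rpow_one]
    calc _ ≤ c j ^ 2 * (2 * truncSecondMoment (ε 0) P η * (1 + ((j + d : ℕ) : ℝ) / n) ^ δ) := by
          gcongr; exact hsc.core _
      _ ≤ c j ^ 2 * (2 * truncSecondMoment (ε 0) P η * (2 * (1 + (j : ℝ)) ^ δ)) := by gcongr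
      _ = _ := by ring
  · intro r hr
    rw [shiftCoeff, if_neg (by have := Finset.mem_range.1 hr; omega)]
    simp

/-- The coefficients which bound those of `X_{n-d}`, `d < n`, on the innovations `ε_{n-r}` with
`r ≥ 3 n`. -/
noncomputable def farCoeff (a : ℕ → ℝ) (α δ C : ℝ) (n r : ℕ) : ℝ :=
  if r < 3 * n then 0 else 4 * C * a n * (1 + (r : ℝ) / n) ^ (-(α - δ))

omit [IsProbabilityMeasure P] in
/-- If none of the innovations `ε_{K-r}`, `r < 3 n`, exceeds its truncation level, only the
truncated means remain of their removed parts. -/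
theorem IsCenteredDANInnovation.restBound_le (hε : IsCenteredDANInnovation ε P)
    (hsm : IsSmallExponent α δ) (ha : IsPotterSequence a α δ C N) {κ : ℝ} (hκ : 0 ≤ κ) {n : ℕ}
    {η : ℝ} (hsc : IsTruncScale (truncSecondMoment (ε 0) P) (tailFirstMoment (ε 0) P) δ κ n η)
    (hn : N ≤ n) {a' : ℕ → ℝ} (ha' : ∀ j, |a' j| ≤ |a j|) {d : ℕ} (hd : d < n) {K : ℤ} {ω : Ω}
    (hω : ∀ r ∈ Finset.range (3 * n), |ε (K - r) ω| ≤ growingLevel η n r) :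
    restBound ε P (growingLevel η n) K (shiftCoeff a' d) ω ≤
      ENNReal.ofReal ((∑ j ∈ Finset.range (3 * n), |a j|) *
        (κ * (√(n * truncSecondMoment (ε 0) P η) / n))) +
      restBound ε P (growingLevel η n) K (farCoeff a α δ C n) ω := by
  set b := κ * (√(n * truncSecondMoment (ε 0) P η) / n) with hb
  have hb0 : 0 ≤ b := by positivity
  have han := ha.pos n hn
  have hC := ha.C_pos
  have hsh : ∀ r, |shiftCoeff a' d r| ≤ |shiftCoeff a d r| := by
    intro r
    unfold shiftCoeff
    split_ifs
    · exact ha' _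
    · simp
  have h1 : ∀ r, ENNReal.ofReal (|shiftCoeff a' d r| * |restInnovation ε P (growingLevel η n) K r ω|) ≤
      (if r ∈ Finset.range (3 * n) then ENNReal.ofReal (|shiftCoeff a d r| * b) else 0) +
      ENNReal.ofReal (|farCoeff a α δ C n r| * |restInnovation ε P (growingLevel η n) K r ω|) := by
    intro r
    by_cases hr : r ∈ Finset.range (3 * n)
    · rw [if_pos hr]
      refine le_add_right (ENNReal.ofReal_le_ofReal ?_)
      refine mul_le_mul (hsh r) ?_ (abs_nonneg _) (abs_nonneg _)
      rw [restInnovation, truncRest, if_pos (hω r hr), zero_add]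
      exact (abs_truncMean_le (hε.measurable 0) hε.integrable hε.centered _).trans
        (hsc.tail_le hκ (by linarith [hsm.pos, hsm.lower, hsm.add_lt_one]) r)
    · rw [if_neg hr, zero_add]
      rw [Finset.mem_range] at hr
      refine ENNReal.ofReal_le_ofReal (mul_le_mul_of_nonneg_right ?_ (abs_nonneg _))
      refine (hsh r).trans ((ha.abs_shiftCoeff_le_far hsm.pos hsm.le_alpha hsm.add_lt_one hn hd.le
        (not_lt.1 hr)).trans ?_)
      rw [farCoeff, if_neg hr]
      exact le_abs_self _
  unfold restBound
  refine (ENNReal.tsum_le_tsum h1).trans ?_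
  rw [ENNReal.tsum_add]
  refine add_le_add ?_ le_rfl
  rw [tsum_eq_sum (s := Finset.range (3 * n)) fun r hr => if_neg hr]
  rw [Finset.sum_congr rfl fun r hr => if_pos hr,
    ← ENNReal.ofReal_sum_of_nonneg fun r _ => by positivity, ← Finset.sum_mul]
  refine ENNReal.ofReal_le_ofReal (mul_le_mul_of_nonneg_right ?_ hb0)
  calc ∑ r ∈ Finset.range (3 * n), |shiftCoeff a d r|
      ≤ ∑ r ∈ Finset.range (d + 3 * n), |shiftCoeff a d r| :=
        Finset.sum_le_sum_of_subset_of_nonneg (Finset.range_mono (by omega))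
          fun _ _ _ => abs_nonneg _
    _ = ∑ j ∈ Finset.range (3 * n), |a j| := by
        rw [Finset.sum_range_add, Finset.sum_eq_zero, zero_add]
        · refine Finset.sum_congr rfl fun j _ => ?_
          rw [shiftCoeff, if_pos (by omega), Nat.add_sub_cancel_left]
        · intro r hr
          rw [shiftCoeff, if_neg (by have := Finset.mem_range.1 hr; omega), abs_zero]

theorem IsPotterSequence.exists_sum_range_three_le (ha : IsPotterSequence a α δ C N)
    (hsm : IsSmallExponent α δ) : ∃ K : ℝ, 0 < K ∧ ∀ n ≥ N,
      ∑ j ∈ Finset.range (3 * n), |a j| ≤ K * (n * a n) := by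
  have hC := ha.C_pos
  have hden : 0 < 1 - α - δ := by linarith [hsm.add_lt_one]
  refine ⟨C * (1 + 3 ^ (2 * δ)) / (1 - α - δ) * 3 ^ (1 - α - δ), by positivity, fun n hn => ?_⟩
  have hn0 : (0 : ℝ) < n := Nat.cast_pos.2 (ha.N_pos.trans hn)
  refine (ha.sum_range_abs_le hsm.pos hsm.le_alpha hsm.add_lt_one hn (K := 3) (by norm_num)
    (m := 3 * n) (by push_cast; exact le_rfl)).trans (le_of_eq ?_)
  have : ((3 * n : ℕ) : ℝ) / n = 3 := by push_cast; field_simp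
  rw [this]
  ring

/-- The squares of the tails of the series contribute arbitrarily little: the truncated parts in
mean, and the removed parts because, with high probability, only the centerings and the very distant
innovations remain in them. -/
theorem IsCenteredDANInnovation.eventually_sum_sq_tail_le (hε : IsCenteredDANInnovation ε P)
    (hsm : IsSmallExponent α δ) (ha : IsPotterSequence a α δ C N) {θ ρ : ℝ} (hθ : 0 < θ)
    (hρ : 0 < ρ) :
    ∀ᶠ M : ℕ in atTop, ∀ᶠ n : ℕ in atTop, ∃ B : Set Ω, P B ≤ ENNReal.ofReal ρ ∧ ∀ᵐ ω ∂P, ω ∉ B →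
      ∑ i ∈ Finset.Icc 1 n, linearProcess (tailCoeff a M) ε (i : ℤ) ω ^ 2 ≤
        θ * (n * truncVar (truncSecondMoment (ε 0) P) n) := by
  set l := truncSecondMoment (ε 0) P with hl
  have hC := ha.C_pos
  have hδ1 : δ ≤ 1 := by linarith [hsm.pos, hsm.lower, hsm.add_lt_one]
  have hδ2 : δ ≤ 1 / 2 := by linarith [hsm.pos, hsm.lower, hsm.add_lt_one]
  have hS := ha.summable_sq_mul_rpow hsm.pos hsm.le_alpha hsm.add_lt_one hsm.one_lt_core
  have hSM : ∀ M, Summable fun j : ℕ => tailCoeff a M j ^ 2 * (1 + (j : ℝ)) ^ δ := fun M =>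
    Summable.of_nonneg_of_le (fun j => by positivity) (fun j => by
      exact mul_le_mul_of_nonneg_right (sq_le_sq.2 (abs_tailCoeff_le a M j)) (by positivity)) hS
  -- The weighted tail of the series of the squares tends to zero; this chooses `M`.
  have hτ : Tendsto (fun M => ∑' j : ℕ, tailCoeff a M j ^ 2 * (1 + (j : ℝ)) ^ δ) atTop (𝓝 0) := by
    have := tendsto_tsum_of_dominated_convergence (𝓕 := atTop)
      (f := fun (M j : ℕ) => tailCoeff a M j ^ 2 * (1 + (j : ℝ)) ^ δ) (g := fun _ => 0) hS
      (fun j => tendsto_const_nhds.congr' (by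
        filter_upwards [eventually_gt_atTop j] with M hM
        simp [tailCoeff, hM]))
      (Eventually.of_forall fun M j => by
        rw [Real.norm_of_nonneg (by positivity)]
        exact mul_le_mul_of_nonneg_right (sq_le_sq.2 (abs_tailCoeff_le a M j)) (by positivity))
    simpa using this
  obtain ⟨K1, hK1, hKs⟩ := ha.exists_sum_range_three_le hsm
  obtain ⟨K2, hK2, hKt⟩ := IsTruncScale.exists_tsum_tail_le hsm.one_lt_tail
  set κ := min 1 (ρ / 2 / (6 + K2 * (4 * C))) with hκdef
  have hκ : 0 < κ := lt_min one_pos (by positivity)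
  have hκ1 : κ ≤ 1 := min_le_left _ _
  have hκρ : (6 + K2 * (4 * C)) * κ ≤ ρ / 2 := by
    have : κ ≤ ρ / 2 / (6 + K2 * (4 * C)) := min_le_right _ _
    rw [le_div_iff₀ (by positivity)] at this
    linarith
  filter_upwards [hτ.eventually_lt_const (show 0 < θ * ρ / 32 by positivity)] with M hM
  set τ := ∑' j : ℕ, tailCoeff a M j ^ 2 * (1 + (j : ℝ)) ^ δ
  have hna := (ha.tendsto_mul_sq hsm).eventually_lt_const
    (show 0 < θ / 4 / (K1 + 1) ^ 2 by positivity)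
  filter_upwards [hε.eventually_isTruncScale hsm.pos hκ, eventually_ge_atTop N, hna]
    with n hsc hn hna
  set η := truncLevel l n
  have hn0 : (0 : ℝ) < n := Nat.cast_pos.2 hsc.n_pos
  have han := ha.pos n hn
  have hlp : 0 < l η := hsc.pos
  set Q := √(n * l η) with hQ
  have hQ0 : 0 < Q := Real.sqrt_pos.2 hsc.scale_pos
  have hQ2 : Q ^ 2 = n * l η := Real.sq_sqrt hsc.scale_pos.le
  let U : ℕ → Ω → ℝ := fun d ω =>
    coreSeries ε P (growingLevel η n) n (shiftCoeff (tailCoeff a M) d) ω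
  let F : Ω → ℝ≥0∞ := restBound ε P (growingLevel η n) n (farCoeff a α δ C n)
  have hmain := hε.ae_linearProcess_eq_of_scale hsm ha hκ.le hsc hn (abs_tailCoeff_le a M) n
  have hlimU : ∀ d < n, ∀ᵐ ω ∂P, Tendsto (fun m => ∑ r ∈ Finset.range m,
      shiftCoeff (tailCoeff a M) d r * coreInnovation ε P (growingLevel η n) n r ω) atTop
      (𝓝 (U d ω)) := fun d hd => hmain.mono fun ω h => (h d hd).2.2.1
  have hUm : ∀ d < n, AEMeasurable (U d) P := fun d hd =>
    aemeasurable_of_tendsto_metrizable_ae atTop (fun m => (Finset.measurable_sum _ fun r _ =>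
      (hε.measurable_coreInnovation n r).const_mul _).aemeasurable) (hlimU d hd)
  have hUm2 : ∀ d ∈ Finset.range n, AEMeasurable (fun ω => ENNReal.ofReal (U d ω ^ 2)) P :=
    fun d hd => ENNReal.measurable_ofReal.comp_aemeasurable
      ((hUm d (Finset.mem_range.1 hd)).pow_const 2)
  have hfar : ∫⁻ ω, F ω ∂P ≤ ENNReal.ofReal (K2 * κ * (4 * C * a n) * Q) := by
    refine (hε.lintegral_restBound_le n _).trans (hKt hκ.le hsc (by positivity) fun r => ?_)
    unfold farCoeff
    split_ifs
    · rw [abs_zero]; positivity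
    · rw [abs_of_nonneg (by positivity)]
  have hcore : ∫⁻ ω, ∑ d ∈ Finset.range n, ENNReal.ofReal (U d ω ^ 2) ∂P ≤
      ENNReal.ofReal (4 * Q ^ 2 * τ) := by
    rw [lintegral_finsetSum' _ hUm2]
    calc _ ≤ ∑ d ∈ Finset.range n, ENNReal.ofReal (4 * l η * τ) :=
          Finset.sum_le_sum fun d hd => hε.lintegral_sq_coreSeries_shiftCoeff_le hsm.pos.le hδ1 hsc
            (Finset.mem_range.1 hd).le (hSM M) (hlimU d (Finset.mem_range.1 hd))
      _ = ENNReal.ofReal (4 * Q ^ 2 * τ) := by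
          rw [Finset.sum_const, Finset.card_range, nsmul_eq_mul, ← ENNReal.ofReal_natCast,
            ← ENNReal.ofReal_mul (by positivity), hQ2]
          congr 1; ring
  refine ⟨{ω | ENNReal.ofReal (θ / 4 * Q ^ 2) < ∑ d ∈ Finset.range n, ENNReal.ofReal (U d ω ^ 2)} ∪
    ({ω | ENNReal.ofReal (a n * Q) < F ω} ∪
    {ω | ∃ r ∈ Finset.range (3 * n), growingLevel η n r < |ε ((n : ℤ) - r) ω|}), ?_, ?_⟩
  · have b1 := measure_lt_le_lintegral_div (Finset.aemeasurable_fun_sum (Finset.range n) hUm2) hcore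
      (show 0 < θ / 4 * Q ^ 2 by positivity)
    have b2 := measure_lt_le_lintegral_div (hε.measurable_restBound n _).aemeasurable hfar
      (show 0 < a n * Q by positivity)
    have b3 := hε.measure_exists_lt_abs_le (Finset.range (3 * n)) (fun r => (n : ℤ) - r)
      (T := growingLevel η n) hsc.growingLevel_pos (fun r => hsc.tail_div_le hκ.le hδ2 r)
    refine (measure_union_le _ _).trans ((add_le_add b1 ((measure_union_le _ _).trans
      (add_le_add b2 b3))).trans ?_)
    rw [← ENNReal.ofReal_add (by positivity) (by positivity),
      ← ENNReal.ofReal_add (by positivity) (by positivity)]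
    refine ENNReal.ofReal_le_ofReal ?_
    have e1 : 4 * Q ^ 2 * τ / (θ / 4 * Q ^ 2) = 16 * τ / θ := by field_simp; ring
    have e2 : K2 * κ * (4 * C * a n) * Q / (a n * Q) = K2 * (4 * C) * κ := by field_simp
    have e3 : ((Finset.range (3 * n)).card : ℝ) * (2 * κ / n) = 6 * κ := by
      rw [Finset.card_range]; push_cast; field_simp; norm_num
    have e4 : 16 * τ / θ ≤ ρ / 2 := by
      rw [div_le_iff₀ hθ]; linarith
    rw [e1, e2, e3]
    linarith
  · filter_upwards [hmain] with ω h hω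
    simp only [Set.mem_union, not_or] at hω
    obtain ⟨h1, h2, h3⟩ := hω
    have h1 : ∑ d ∈ Finset.range n, ENNReal.ofReal (U d ω ^ 2) ≤ ENNReal.ofReal (θ / 4 * Q ^ 2) :=
      not_lt.1 h1
    have h2 : F ω ≤ ENNReal.ofReal (a n * Q) := not_lt.1 h2
    have h3 : ∀ r ∈ Finset.range (3 * n), |ε ((n : ℤ) - r) ω| ≤ growingLevel η n r := by
      intro r hr
      by_contra hc
      exact h3 ⟨r, hr, not_le.1 hc⟩
    rw [← ENNReal.ofReal_sum_of_nonneg fun d _ => sq_nonneg _,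
      ENNReal.ofReal_le_ofReal_iff (by positivity)] at h1
    have hX : ∀ d ∈ Finset.range n, linearProcess (tailCoeff a M) ε ((n : ℤ) - d) ω ^ 2 ≤
        2 * U d ω ^ 2 + 2 * ((K1 + 1) * (a n * Q)) ^ 2 := by
      intro d hd
      obtain ⟨-, -, -, v, hv, hvb⟩ := h d (Finset.mem_range.1 hd)
      have hv1 := hvb.trans ((hε.restBound_le hsm ha hκ.le hsc hn (abs_tailCoeff_le a M)
        (Finset.mem_range.1 hd) h3).trans (add_le_add le_rfl h2))
      rw [← ENNReal.ofReal_add (mul_nonneg (Finset.sum_nonneg fun _ _ => abs_nonneg _)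
        (by positivity)) (by positivity), ENNReal.ofReal_le_ofReal_iff
        (add_nonneg (mul_nonneg (Finset.sum_nonneg fun _ _ => abs_nonneg _)
        (by positivity)) (by positivity))] at hv1
      have hv2 : |v| ≤ (K1 + 1) * (a n * Q) := by
        refine hv1.trans ?_
        calc _ ≤ K1 * (n * a n) * (1 * (Q / n)) + a n * Q := by gcongr; exact hKs n hn
          _ = _ := by field_simp
      have hv3 : v ^ 2 ≤ ((K1 + 1) * (a n * Q)) ^ 2 := by
        rw [← sq_abs v]; gcongr
      rw [hv]
      change (U d ω + v) ^ 2 ≤ _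
      nlinarith [sq_nonneg (U d ω - v)]
    have hre : ∑ i ∈ Finset.Icc 1 n, linearProcess (tailCoeff a M) ε (i : ℤ) ω ^ 2 =
        ∑ d ∈ Finset.range n, linearProcess (tailCoeff a M) ε ((n : ℤ) - d) ω ^ 2 := by
      refine Finset.sum_bij' (fun i _ => n - i) (fun d _ => n - d) ?_ ?_ ?_ ?_ ?_
      · intro i hi; rw [Finset.mem_Icc] at hi; rw [Finset.mem_range]; omega
      · intro d hd; rw [Finset.mem_range] at hd; rw [Finset.mem_Icc]; omega
      · intro i hi; rw [Finset.mem_Icc] at hi; omega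
      · intro d hd; rw [Finset.mem_range] at hd; omega
      · intro i hi
        rw [Finset.mem_Icc] at hi
        congr 2
        rw [Nat.cast_sub hi.2]; ring
    rw [hre]
    refine (Finset.sum_le_sum hX).trans ?_
    rw [Finset.sum_add_distrib, ← Finset.mul_sum, Finset.sum_const, Finset.card_range, nsmul_eq_mul]
    have h5 : (n : ℝ) * a n ^ 2 * (K1 + 1) ^ 2 ≤ θ / 4 := by
      rw [lt_div_iff₀ (by positivity)] at hna
      exact hna.le
    change _ ≤ θ * (n * l η)
    rw [← hQ2]
    calc _ ≤ 2 * (θ / 4 * Q ^ 2) + 2 * ((n : ℝ) * a n ^ 2 * (K1 + 1) ^ 2) * Q ^ 2 := by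
          have : (n : ℝ) * (2 * ((K1 + 1) * (a n * Q)) ^ 2) =
            2 * ((n : ℝ) * a n ^ 2 * (K1 + 1) ^ 2) * Q ^ 2 := by ring
          linarith
      _ ≤ 2 * (θ / 4 * Q ^ 2) + 2 * (θ / 4) * Q ^ 2 := by gcongr
      _ = θ * Q ^ 2 := by ring

/-- The weak law of large numbers for the squares of the linear process. -/
theorem IsCenteredDANInnovation.tendstoInMeasure_linearSqSum (hε : IsCenteredDANInnovation ε P)
    (hsm : IsSmallExponent α δ) (ha : IsPotterSequence a α δ C N) :
    TendstoInMeasure P (fun (n : ℕ) ω => 1 / (n * truncVar (truncSecondMoment (ε 0) P) n) *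
      linearSqSum a ε n ω) atTop (fun _ => ∑' i, a i ^ 2) := by
  have hS := ha.summable_sq hsm.pos hsm.le_alpha hsm.add_lt_one hsm.one_lt_sq
  set A := ∑' i, a i ^ 2
  have hA : 0 ≤ A := tsum_nonneg fun i => sq_nonneg _
  rw [tendstoInMeasure_const_iff]
  intro θ hθ ρ hρ
  -- `s` weighs the cross terms between the finite moving average and the remainder.
  set s := min 1 (θ / (4 * (A + θ)))
  have hs : 0 < s := lt_min one_pos (by positivity)
  have hs1 : s ≤ 1 := min_le_left _ _
  have hsA : s * (A + θ) ≤ θ / 4 := by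
    have : s ≤ θ / (4 * (A + θ)) := min_le_right _ _
    rw [le_div_iff₀ (by positivity)] at this
    linarith
  have hθ' : 0 < θ / (4 * (1 + 1 / s)) := by positivity
  obtain ⟨M, hM1, hM2⟩ := ((hε.eventually_sum_sq_tail_le hsm ha hθ' (half_pos hρ)).and
    ((Metric.tendsto_nhds.1 hS.hasSum.tendsto_sum_nat) (θ / 4) (by positivity))).exists
  rw [Real.dist_eq] at hM2
  have hW := (tendstoInMeasure_const_iff.1 (hε.tendstoInMeasure_sum_sq_finite a M)) (θ / 4)
    (by positivity) (ρ / 2) (half_pos hρ)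
  filter_upwards [hM1, hW, hε.eventually_isTruncScale hsm.pos one_pos]
    with n ⟨B, hB, h1⟩ ⟨B', hB', h2⟩ hsc
  refine ⟨B ∪ B', ?_, ?_⟩
  · refine (measure_union_le _ _).trans ((add_le_add hB hB').trans ?_)
    rw [← ENNReal.ofReal_add (by positivity) (by positivity), add_halves]
  have hall : ∀ᵐ ω ∂P, ∀ i : ℕ, linearProcess a ε i ω =
      linearProcessPartial a ε i M ω + linearProcess (tailCoeff a M) ε i ω :=
    ae_all_iff.2 fun i => hε.ae_linearProcess_eq_partial_add hsm ha M i
  filter_upwards [h1, h2, hall] with ω h1 h2 h3 hω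
  rw [Set.mem_union, not_or] at hω
  have h1 := h1 hω.1
  have h2 := h2 hω.2
  have hq : 0 < n * truncVar (truncSecondMoment (ε 0) P) n := hsc.scale_pos
  set q := n * truncVar (truncSecondMoment (ε 0) P) n
  set X := ∑ i ∈ Finset.Icc 1 n, linearProcessPartial a ε i M ω ^ 2
  set R := ∑ i ∈ Finset.Icc 1 n, linearProcess (tailCoeff a M) ε (i : ℤ) ω ^ 2
  have hX0 : 0 ≤ X := Finset.sum_nonneg fun _ _ => sq_nonneg _
  have hR0 : 0 ≤ R := Finset.sum_nonneg fun _ _ => sq_nonneg _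
  have hdiff : |linearSqSum a ε n ω - X| ≤ s * X + (1 + 1 / s) * R := by
    simp only [linearSqSum, X, R]
    rw [← Finset.sum_sub_distrib, Finset.mul_sum, Finset.mul_sum, ← Finset.sum_add_distrib]
    refine (Finset.abs_sum_le_sum_abs _ _).trans (Finset.sum_le_sum fun i _ => ?_)
    rw [h3 i]
    set x := linearProcessPartial a ε i M ω
    set y := linearProcess (tailCoeff a M) ε (i : ℤ) ω
    -- `2 |x y| ≤ s x² + y² / s`
    have k1 : 0 ≤ s * (x - y / s) ^ 2 := by positivity
    have k2 : 0 ≤ s * (x + y / s) ^ 2 := by positivity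
    have e1 : s * (x - y / s) ^ 2 = s * x ^ 2 - 2 * (x * y) + 1 / s * y ^ 2 := by field_simp; ring
    have e2 : s * (x + y / s) ^ 2 = s * x ^ 2 + 2 * (x * y) + 1 / s * y ^ 2 := by field_simp; ring
    rw [abs_le]
    constructor <;> nlinarith [sq_nonneg y]
  have hXq : |1 / q * X - A| ≤ θ / 4 + θ / 4 := by
    have : 1 / q * X - A = (1 / q * X - ∑ p ∈ Finset.range M, a p ^ 2) +
      (∑ p ∈ Finset.range M, a p ^ 2 - A) := by ring
    rw [this]
    exact (abs_add_le _ _).trans (add_le_add h2 hM2.le)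
  have hXq' : 1 / q * X ≤ A + θ := by linarith [(abs_le.1 hXq).2]
  have hRq : (1 + 1 / s) * (1 / q * R) ≤ θ / 4 := by
    have : 1 / q * R ≤ θ / (4 * (1 + 1 / s)) := by
      rw [one_div, inv_mul_le_iff₀ hq]
      linarith
    calc _ ≤ (1 + 1 / s) * (θ / (4 * (1 + 1 / s))) := by gcongr
      _ = θ / 4 := by field_simp
  have e : 1 / q * linearSqSum a ε n ω - A =
      1 / q * (linearSqSum a ε n ω - X) + (1 / q * X - A) := by ring
  rw [e]
  refine (abs_add_le _ _).trans ?_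
  rw [abs_mul, abs_of_pos (show 0 < 1 / q by positivity)]
  calc _ ≤ 1 / q * (s * X + (1 + 1 / s) * R) + (θ / 4 + θ / 4) := by gcongr
    _ = s * (1 / q * X) + (1 + 1 / s) * (1 / q * R) + (θ / 4 + θ / 4) := by ring
    _ ≤ s * (A + θ) + θ / 4 + (θ / 4 + θ / 4) := by gcongr
    _ ≤ θ := by linarith

end Remainder

/-! ### Gaussian approximation of the characteristic function of the innovations -/

section CharFun

variable {Ω : Type*} [MeasurableSpace Ω] {P : Measure Ω} [IsProbabilityMeasure P] {ε : ℤ → Ω → ℝ}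
  {a : ℕ → ℝ} {α δ C : ℝ} {N : ℕ}

/-- The norming constant `√(n l_n)` of the sums of `n` innovations. -/
noncomputable def innovationScale (ε : ℤ → Ω → ℝ) (P : Measure Ω) (n : ℕ) : ℝ :=
  √(n * truncVar (truncSecondMoment (ε 0) P) n)

/-- `n` times the distance between the characteristic functions of `ε_0 / √(n l_n)` and of a
Gaussian variable of variance `1 / n`, at the point `u`. -/
noncomputable def cfError (ε : ℤ → Ω → ℝ) (P : Measure Ω) (n : ℕ) (u : ℝ) : ℝ :=
  n * ‖charFun (P.map (ε 0)) (u / innovationScale ε P n) -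
    Complex.exp (-((u ^ 2 / (2 * n) : ℝ) : ℂ))‖

omit [IsProbabilityMeasure P] in
theorem cfError_nonneg (n : ℕ) (u : ℝ) : 0 ≤ cfError ε P n u := by
  unfold cfError; positivity

namespace IsCenteredDANInnovation

variable (hε : IsCenteredDANInnovation ε P)

include hε

theorem cfError_zero (n : ℕ) : cfError ε P n 0 = 0 := by
  have : IsProbabilityMeasure (P.map (ε 0)) :=
    Measure.isProbabilityMeasure_map (hε.measurable 0).aemeasurable
  simp [cfError]

theorem tendsto_truncLevel : Tendsto (truncLevel (truncSecondMoment (ε 0) P)) atTop atTop :=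
  (truncLevel_spec (truncSecondMoment_mono (hε.measurable 0)) hε.slowlyVarying).1

theorem eventually_innovationScale : ∀ᶠ n : ℕ in atTop,
    0 < (n : ℝ) ∧ 0 < truncVar (truncSecondMoment (ε 0) P) n ∧
      0 < truncLevel (truncSecondMoment (ε 0) P) n ∧
      innovationScale ε P n ^ 2 = n * truncVar (truncSecondMoment (ε 0) P) n ∧
      innovationScale ε P n ≤ 2 * truncLevel (truncSecondMoment (ε 0) P) n ∧
      truncLevel (truncSecondMoment (ε 0) P) n ≤ 2 * innovationScale ε P n := by
  filter_upwards [hε.eventually_isTruncScale one_pos one_pos] with n h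
  have h1 := h.one_le
  have e : innovationScale ε P n ^ 2 = n * truncVar (truncSecondMoment (ε 0) P) n :=
    Real.sq_sqrt h.scale_pos.le
  refine ⟨Nat.cast_pos.2 h.n_pos, h.pos, by linarith, e, h.sqrt_le_level, ?_⟩
  have h2 := h.level_le
  change _ ≤ 4 * (n * truncVar (truncSecondMoment (ε 0) P) n) at h2
  rw [← e] at h2
  have h3 : 0 ≤ innovationScale ε P n := Real.sqrt_nonneg _
  nlinarith

theorem tendsto_innovationScale : Tendsto (innovationScale ε P) atTop atTop := by
  refine tendsto_atTop_mono' atTop ?_ (hε.tendsto_truncLevel.const_mul_atTop (show (0 : ℝ) < 1 / 2 by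
    norm_num))
  filter_upwards [hε.eventually_innovationScale] with n h
  linarith [h.2.2.2.2.2]

theorem eventually_cfError_le {κ U : ℝ} (hκ : 0 < κ) :
    ∀ᶠ n : ℕ in atTop, ∀ u : ℝ, u ≠ 0 → |u| ≤ U → cfError ε P n u ≤
      κ * (u ^ 2 * (truncSecondMoment (ε 0) P (innovationScale ε P n / |u|) /
        truncVar (truncSecondMoment (ε 0) P) n)) +
      u ^ 2 / 2 * |truncSecondMoment (ε 0) P (innovationScale ε P n / |u|) /
        truncVar (truncSecondMoment (ε 0) P) n - 1| + u ^ 4 / n := by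
  obtain ⟨u₀, hu₀, hchar⟩ := norm_charFun_sub_le (hε.measurable 0) hε.integrable hε.centered
    hε.slowlyVarying hκ
  filter_upwards [hε.eventually_innovationScale, hε.tendsto_innovationScale.eventually_gt_atTop 0,
    hε.tendsto_innovationScale.eventually_gt_atTop (U / u₀),
    eventually_ge_atTop ⌈U ^ 2⌉₊] with n ⟨hn, hl, _, hQ2, _⟩ hQ0 hQU hnU u hu huU
  set Q := innovationScale ε P n
  set R := truncSecondMoment (ε 0) P (Q / |u|) / truncVar (truncSecondMoment (ε 0) P) n with hR
  have hnU' : U ^ 2 ≤ n := Nat.ceil_le.1 hnU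
  have hu0 : 0 < |u| := abs_pos.2 hu
  have hx1 : |u / Q| = |u| / Q := by rw [abs_div, abs_of_pos hQ0]
  have h1 := hchar (u / Q) (div_ne_zero hu hQ0.ne') (by
    rw [hx1, div_lt_iff₀ hQ0]
    rw [div_lt_iff₀ hu₀] at hQU
    linarith)
  have e1 : (u / Q) ^ 2 * truncSecondMoment (ε 0) P (1 / |u / Q|) = u ^ 2 * R / n := by
    rw [hx1, one_div_div, div_pow, hQ2, hR]
    field_simp
  rw [e1] at h1
  set s : ℝ := u ^ 2 / (2 * n) with hs
  have hs0 : 0 ≤ s := by positivity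
  have hs1 : s ≤ 1 := by
    rw [hs, div_le_one (by positivity), ← sq_abs]
    have : |u| ^ 2 ≤ U ^ 2 := by gcongr
    linarith
  have h2 : ‖Complex.exp (-(s : ℂ)) - 1 - -(s : ℂ)‖ ≤ s ^ 2 := by
    have := Complex.norm_exp_sub_one_sub_id_le (x := -(s : ℂ)) (by
      rw [norm_neg, Complex.norm_real, Real.norm_of_nonneg hs0]; exact hs1)
    rwa [norm_neg, Complex.norm_real, Real.norm_of_nonneg hs0] at this
  have h3 : ‖((s - u ^ 2 * R / n / 2 : ℝ) : ℂ)‖ = u ^ 2 / 2 * |R - 1| / n := by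
    rw [Complex.norm_real, Real.norm_eq_abs,
      show s - u ^ 2 * R / n / 2 = u ^ 2 / (2 * n) * (1 - R) by rw [hs]; field_simp,
      abs_mul, abs_of_nonneg (by positivity : 0 ≤ u ^ 2 / (2 * n)), abs_sub_comm 1 R]
    field_simp
  have e2 : charFun (P.map (ε 0)) (u / Q) - Complex.exp (-(s : ℂ)) =
      (charFun (P.map (ε 0)) (u / Q) - 1 + ((u ^ 2 * R / n / 2 : ℝ) : ℂ)) -
        (Complex.exp (-(s : ℂ)) - 1 - -(s : ℂ)) + ((s - u ^ 2 * R / n / 2 : ℝ) : ℂ) := by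
    push_cast; ring
  unfold cfError
  rw [e2]
  calc _ ≤ n * (κ * (u ^ 2 * R / n) + s ^ 2 + u ^ 2 / 2 * |R - 1| / n) := by
        gcongr
        refine (norm_add_le _ _).trans (add_le_add ((norm_sub_le _ _).trans (add_le_add h1 h2)) h3.le)
    _ = κ * (u ^ 2 * R) + u ^ 2 / 2 * |R - 1| + u ^ 4 / n / 4 := by
        rw [hs]; field_simp; ring
    _ ≤ _ := by
        have : u ^ 4 / n / 4 ≤ u ^ 4 / n := div_le_self (by positivity) (by norm_num)
        linarith

/-- The domination needed to sum the errors over all coefficients: `|u| ^ (2 - δ)` is still summable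
over the rescaled coefficients, as `(2 - δ)(α - δ) > 1`. -/
theorem exists_cfError_le_rpow (hδ : 0 < δ) {U : ℝ} (hU : 0 < U) :
    ∃ K : ℝ, 0 < K ∧ ∀ᶠ n : ℕ in atTop, ∀ u : ℝ, |u| ≤ U → cfError ε P n u ≤ K * |u| ^ (2 - δ) := by
  obtain ⟨X, hX1, hpos, hX⟩ := hε.slowlyVarying.potter hδ
  set K0 : ℝ := 2 * 2 ^ δ + U ^ δ with hK0
  have hK0p : 0 < K0 := by positivity
  refine ⟨K0 + (K0 + U ^ δ) + U ^ 2 * U ^ δ, by positivity, ?_⟩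
  filter_upwards [hε.eventually_cfError_le (U := U) one_pos, hε.eventually_innovationScale,
    hε.tendsto_truncLevel.eventually_ge_atTop X, hε.tendsto_innovationScale.eventually_gt_atTop 0]
    with n h1 ⟨hn, hl, hη0, hQ2, hQη, _⟩ hηX hQ0 u hu
  rcases eq_or_ne u 0 with rfl | hu0
  · rw [hε.cfError_zero]; positivity
  have hu0' : 0 < |u| := abs_pos.2 hu0
  set l := truncSecondMoment (ε 0) P
  set η := truncLevel l n
  set Q := innovationScale ε P n
  set R := l (Q / |u|) / truncVar l n with hR
  have hR0 : 0 ≤ R := div_nonneg (truncSecondMoment_nonneg _) hl.le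
  have hRle : R ≤ 2 * (2 / |u|) ^ δ + 1 := by
    rw [hR, div_le_iff₀ hl]
    change _ ≤ _ * l η
    have hl : 0 < l η := hl
    rcases le_or_gt η (Q / |u|) with h | h
    · refine (hX η hηX _ h).1.trans ?_
      gcongr ?_ * _
      have : Q / |u| / η ≤ 2 / |u| := by
        rw [div_div, div_le_div_iff₀ (by positivity) hu0']
        nlinarith
      calc 2 * (Q / |u| / η) ^ δ ≤ 2 * (2 / |u|) ^ δ := by gcongr
        _ ≤ _ := by linarith
    · refine (truncSecondMoment_mono (hε.measurable 0) h.le).trans ?_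
      have : 0 ≤ (2 / |u|) ^ δ := by positivity
      nlinarith
  have e1 : u ^ 2 = |u| ^ (2 - δ) * |u| ^ δ := by
    rw [← Real.rpow_add hu0', sub_add_cancel, ← sq_abs]
    norm_num
  have h2 : u ^ 2 ≤ U ^ δ * |u| ^ (2 - δ) := by
    rw [e1, mul_comm]; gcongr
  have h3 : u ^ 2 * R ≤ K0 * |u| ^ (2 - δ) := by
    calc u ^ 2 * R ≤ u ^ 2 * (2 * (2 / |u|) ^ δ + 1) := by gcongr
      _ = |u| ^ (2 - δ) * (2 * ((2 / |u|) ^ δ * |u| ^ δ)) + u ^ 2 := by rw [e1]; ring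
      _ = |u| ^ (2 - δ) * (2 * 2 ^ δ) + u ^ 2 := by
          rw [← Real.mul_rpow (by positivity) (by positivity), div_mul_cancel₀ _ hu0'.ne']
      _ ≤ |u| ^ (2 - δ) * (2 * 2 ^ δ) + U ^ δ * |u| ^ (2 - δ) := by gcongr
      _ = _ := by rw [hK0]; ring
  have h4 : u ^ 2 / 2 * |R - 1| ≤ (K0 + U ^ δ) * |u| ^ (2 - δ) := by
    have : |R - 1| ≤ R + 1 := (abs_sub _ _).trans (by rw [abs_of_nonneg hR0, abs_one])
    calc u ^ 2 / 2 * |R - 1| ≤ u ^ 2 * (R + 1) := by gcongr; linarith [sq_nonneg u]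
      _ = u ^ 2 * R + u ^ 2 := by ring
      _ ≤ _ := by linarith
  have hn1 : (1 : ℝ) ≤ n := by
    have : 0 < n := by exact_mod_cast hn
    exact_mod_cast this
  have h5 : u ^ 4 / n ≤ U ^ 2 * U ^ δ * |u| ^ (2 - δ) := by
    calc u ^ 4 / n ≤ u ^ 4 := div_le_self (by positivity) hn1
      _ = |u| ^ 2 * u ^ 2 := by rw [sq_abs]; ring
      _ ≤ U ^ 2 * (U ^ δ * |u| ^ (2 - δ)) := by gcongr
      _ = _ := by ring
  refine (h1 u hu0 hu).trans ?_
  rw [one_mul, add_mul, add_mul]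
  exact add_le_add (add_le_add h3 h4) h5

theorem tendsto_cfError {u : ℕ → ℝ} {v : ℝ} (hu : Tendsto u atTop (𝓝 v)) :
    Tendsto (fun n => cfError ε P n (u n)) atTop (𝓝 0) := by
  have hbd : ∀ᶠ n in atTop, |u n| ≤ |v| + 1 :=
    (hu.abs.eventually_lt_const (lt_add_one _)).mono fun n h => h.le
  rcases eq_or_ne v 0 with rfl | hv
  · obtain ⟨K, hK, hb⟩ := hε.exists_cfError_le_rpow one_pos
      (show (0 : ℝ) < |0| + 1 by positivity)
    refine squeeze_zero' (Eventually.of_forall fun n => cfError_nonneg _ _)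
      (by filter_upwards [hb, hbd] with n h1 h2 using h1 _ h2) ?_
    have h := (hu.abs.rpow_const (p := 2 - 1) (Or.inr (by norm_num))).const_mul K
    rwa [abs_zero, Real.zero_rpow (by norm_num), mul_zero] at h
  have hv0 : 0 < |v| := abs_pos.2 hv
  have hne : ∀ᶠ n in atTop, |v| / 2 < |u n| := hu.abs.eventually_const_lt (half_lt_self hv0)
  have hle : ∀ᶠ n in atTop, |u n| < 2 * |v| := hu.abs.eventually_lt_const (by linarith)
  set l := truncSecondMoment (ε 0) P
  have hR : Tendsto (fun n => l (innovationScale ε P n / |u n|) / truncVar l n) atTop (𝓝 1) := by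
    have hc : ∀ c : ℝ, 0 < c → Tendsto (fun n => l (c * truncLevel l n) / truncVar l n) atTop (𝓝 1) :=
      fun c hc => (hε.slowlyVarying.2 c hc).comp hε.tendsto_truncLevel
    refine tendsto_of_tendsto_of_tendsto_of_le_of_le' (hc (1 / (4 * |v|)) (by positivity))
      (hc (4 / |v|) (by positivity)) ?_ ?_
    · filter_upwards [hε.eventually_innovationScale, hne, hle] with n ⟨hn, hl, hη, hQ2, h1, h2⟩ h3 h4
      have hu0 : 0 < |u n| := by linarith
      gcongr
      refine truncSecondMoment_mono (hε.measurable 0) ?_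
      rw [le_div_iff₀ hu0, one_div, inv_mul_eq_div, div_mul_eq_mul_div, div_le_iff₀ (by positivity)]
      nlinarith
    · filter_upwards [hε.eventually_innovationScale, hne, hle] with n ⟨hn, hl, hη, hQ2, h1, h2⟩ h3 h4
      have hu0 : 0 < |u n| := by linarith
      gcongr
      refine truncSecondMoment_mono (hε.measurable 0) ?_
      rw [div_le_iff₀ hu0, div_mul_eq_mul_div, div_mul_eq_mul_div, le_div_iff₀ hv0]
      nlinarith
  rw [tendsto_order]
  refine ⟨fun c hc => Eventually.of_forall fun n => hc.trans_le (cfError_nonneg _ _), fun c hc => ?_⟩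
  set κ := c / 2 / (v ^ 2 + 1)
  have hκ : 0 < κ := by positivity
  have hlim := (((hu.pow 2).mul hR).const_mul κ).add
    ((((hu.pow 2).div_const 2).mul (hR.sub_const 1).abs).add
      ((hu.pow 4).mul tendsto_one_div_atTop_nhds_zero_nat))
  have hval : κ * (v ^ 2 * 1) + (v ^ 2 / 2 * |(1 : ℝ) - 1| + v ^ 4 * 0) < c := by
    rw [sub_self, abs_zero]
    have : κ * (v ^ 2 + 1) = c / 2 := by simp only [κ]; field_simp
    nlinarith
  filter_upwards [hlim.eventually_lt_const hval, hε.eventually_cfError_le (U := |v| + 1) hκ, hbd, hne] with n h1 h2 h3 h4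
  have hu0 : u n ≠ 0 := abs_pos.1 (by linarith)
  refine (h2 _ hu0 h3).trans_lt (lt_of_eq_of_lt ?_ h1)
  ring

end IsCenteredDANInnovation

end CharFun

/-! ### Finite-dimensional distributions of the partial sums -/

/-- The coefficient of `ε_{n-r}` in `S_m`. -/
noncomputable def sumCoeff (a : ℕ → ℝ) (n m r : ℕ) : ℝ := ∑ i ∈ Finset.Icc 1 m, shiftCoeff a (n - i) r

/-- The limit of the rescaled coefficients of `S_{[nt]}`: the kernel `g_t` of the moving average
representation of fractional Brownian motion, in the time variable `x = r / n`. -/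
noncomputable def fbmKernel (α t x : ℝ) : ℝ :=
  (max (t + x - 1) 0 ^ (1 - α) - max (x - 1) 0 ^ (1 - α)) / (1 - α)

@[fun_prop]
theorem measurable_fbmKernel (α t : ℝ) : Measurable (fbmKernel α t) := by
  unfold fbmKernel; fun_prop

theorem abs_sumCoeff_le (a : ℕ → ℝ) {n m : ℕ} (hm : m ≤ n) (r : ℕ) :
    |sumCoeff a n m r| ≤ ∑ d ∈ Finset.range n, |shiftCoeff a d r| := by
  refine (Finset.abs_sum_le_sum_abs _ _).trans ?_
  calc ∑ i ∈ Finset.Icc 1 m, |shiftCoeff a (n - i) r|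
      ≤ ∑ i ∈ Finset.Icc 1 n, |shiftCoeff a (n - i) r| :=
        Finset.sum_le_sum_of_subset_of_nonneg (Finset.Icc_subset_Icc_right hm)
          fun _ _ _ => abs_nonneg _
    _ = _ := by
        refine Finset.sum_bij' (fun i _ => n - i) (fun d _ => n - d) ?_ ?_ ?_ ?_ ?_
        · intro i hi; rw [Finset.mem_Icc] at hi; rw [Finset.mem_range]; omega
        · intro d hd; rw [Finset.mem_range] at hd; rw [Finset.mem_Icc]; omega
        · intro i hi; rw [Finset.mem_Icc] at hi; omega
        · intro d hd; rw [Finset.mem_range] at hd; omega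
        · intro i hi; rfl

theorem tendsto_nat_sub_div {m : ℕ → ℕ} {t x : ℝ}
    (hm : Tendsto (fun n => (m n : ℝ) / n) atTop (𝓝 t)) (hx : 0 ≤ x) :
    Tendsto (fun n : ℕ => ((m n + ⌊(n : ℝ) * x⌋₊ + 1 - n : ℕ) : ℝ) / n) atTop
      (𝓝 (max (t + x - 1) 0)) := by
  have h1 : Tendsto (fun n : ℕ => (⌊(n : ℝ) * x⌋₊ : ℝ) / n) atTop (𝓝 x) := by
    have := (tendsto_nat_floor_mul_div_atTop hx).comp (tendsto_natCast_atTop_atTop (R := ℝ))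
    simpa only [Function.comp_def, mul_comm] using this
  have h2 : Tendsto (fun n : ℕ => max ((m n : ℝ) / n + (⌊(n : ℝ) * x⌋₊ : ℝ) / n + 1 / n - 1) 0) atTop
      (𝓝 (max (t + x + 0 - 1) 0)) :=
    ((((hm.add h1).add tendsto_one_div_atTop_nhds_zero_nat).sub_const 1).max tendsto_const_nhds)
  rw [add_zero] at h2
  refine h2.congr' ?_
  filter_upwards [eventually_gt_atTop 0] with n hn
  have hn0 : (0 : ℝ) < n := Nat.cast_pos.2 hn
  have e : (m n : ℝ) / n + (⌊(n : ℝ) * x⌋₊ : ℝ) / n + 1 / n - 1 =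
      ((m n : ℝ) + ⌊(n : ℝ) * x⌋₊ + 1 - n) / n := by field_simp
  rw [e]
  rcases le_total n (m n + ⌊(n : ℝ) * x⌋₊ + 1) with h | h
  · have h' : (n : ℝ) ≤ (m n : ℝ) + ⌊(n : ℝ) * x⌋₊ + 1 := by exact_mod_cast h
    rw [max_eq_left (div_nonneg (by linarith) hn0.le), Nat.cast_sub h]
    push_cast
    rfl
  · have h' : (m n : ℝ) + ⌊(n : ℝ) * x⌋₊ + 1 ≤ n := by exact_mod_cast h
    rw [max_eq_right (div_nonpos_of_nonpos_of_nonneg (by linarith) hn0.le), Nat.sub_eq_zero_of_le h]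
    simp

section Fdd

variable {Ω : Type*} [MeasurableSpace Ω] {P : Measure Ω} [IsProbabilityMeasure P] {ε : ℤ → Ω → ℝ}
  {a : ℕ → ℝ} {α δ C : ℝ} {N : ℕ}

/-- The rescaled coefficients of the partial sums converge to the kernel, by Karamata's theorem. -/
theorem IsPotterSequence.tendsto_sumCoeff (ha : IsPotterSequence a α δ C N)
    (hsm : IsSmallExponent α δ) {m : ℕ → ℕ} {t x : ℝ} (hmn : ∀ n, m n ≤ n)
    (hm : Tendsto (fun n => (m n : ℝ) / n) atTop (𝓝 t)) (hx : 0 ≤ x) :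
    Tendsto (fun n : ℕ => sumCoeff a n (m n) ⌊(n : ℝ) * x⌋₊ / (n * a n)) atTop
      (𝓝 (fbmKernel α t x)) := by
  have h0 : Tendsto (fun n : ℕ => (((fun _ => 0 : ℕ → ℕ) n : ℕ) : ℝ) / n) atTop (𝓝 0) := by simp
  have h1 := ha.tendsto_sum_range_div hsm.pos hsm.le_alpha hsm.add_lt_one (le_max_right _ _)
    (tendsto_nat_sub_div hm hx)
  have h2 := ha.tendsto_sum_range_div hsm.pos hsm.le_alpha hsm.add_lt_one (le_max_right _ _)
    (tendsto_nat_sub_div h0 hx)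
  have h3 := h1.sub h2
  simp only [zero_add, ← sub_div] at h3
  refine h3.congr fun n => ?_
  rw [sumCoeff, sum_shiftCoeff a (hmn n)]

theorem IsCenteredDANInnovation.ae_tendsto_linearSum (hε : IsCenteredDANInnovation ε P)
    (hsm : IsSmallExponent α δ) (ha : IsPotterSequence a α δ C N) {κ : ℝ} (hκ : 0 ≤ κ) {n : ℕ}
    {η : ℝ} (hsc : IsTruncScale (truncSecondMoment (ε 0) P) (tailFirstMoment (ε 0) P) δ κ n η)
    (hn : N ≤ n) :
    ∀ᵐ ω ∂P, ∀ m ≤ n, Tendsto (fun M => ∑ r ∈ Finset.range M, sumCoeff a n m r * ε ((n : ℤ) - r) ω)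
      atTop (𝓝 (linearSum a ε m ω)) := by
  filter_upwards [hε.ae_linearProcess_eq_of_scale hsm ha hκ hsc hn (fun j => le_rfl) n] with ω h m hm
  have h1 : Tendsto (fun M => ∑ i ∈ Finset.Icc 1 m, ∑ r ∈ Finset.range M,
      shiftCoeff a (n - i) r * ε ((n : ℤ) - r) ω) atTop (𝓝 (linearSum a ε m ω)) := by
    refine tendsto_finsetSum _ fun i hi => ?_
    rw [Finset.mem_Icc] at hi
    have h2 := (h (n - i) (by omega)).2.1
    have e : (n : ℤ) - (n - i : ℕ) = i := by omega
    rwa [e] at h2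
  refine h1.congr fun M => ?_
  rw [Finset.sum_comm]
  refine Finset.sum_congr rfl fun r _ => ?_
  rw [sumCoeff, Finset.sum_mul]

theorem IsCenteredDANInnovation.aemeasurable_linearSum (hε : IsCenteredDANInnovation ε P)
    (hsm : IsSmallExponent α δ) (ha : IsPotterSequence a α δ C N) (m : ℕ) :
    AEMeasurable (linearSum a ε m) P :=
  Finset.aemeasurable_fun_sum _ fun _ _ => hε.aemeasurable_linearProcess hsm ha (fun _ => le_rfl) _

/-- The characteristic functions of the linear combinations of the rescaled partial sums
converge. -/
theorem IsCenteredDANInnovation.tendsto_charFun_linearSum (hε : IsCenteredDANInnovation ε P)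
    (hsm : IsSmallExponent α δ) (ha : IsPotterSequence a α δ C N) {ι : Type*} [Fintype ι]
    (w : ι → ℝ) {m : ℕ → ι → ℕ} {t : ι → ℝ} (hmn : ∀ n k, m n k ≤ n)
    (hm : ∀ k, Tendsto (fun n => (m n k : ℝ) / n) atTop (𝓝 (t k))) :
    Tendsto (fun n : ℕ => charFun (P.map fun ω =>
        (∑ k, w k * linearSum a ε (m n k) ω) / (n * a n * innovationScale ε P n)) 1) atTop
      (𝓝 (Complex.exp (-(((∫ x in Set.Ioi (0 : ℝ), (∑ k, w k * fbmKernel α (t k) x) ^ 2) / 2 : ℝ)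
        : ℂ)))) := by
  obtain ⟨G, hG, hGb⟩ := ha.exists_sum_abs_shiftCoeff_le hsm.pos hsm.le_alpha hsm.add_lt_one
  have hq0 : 0 ≤ α - δ := by linarith [hsm.le_alpha]
  have hq2 : 1 < 2 * (α - δ) := hsm.one_lt_sq
  have hq3 : 1 < (2 - δ) * (α - δ) := by
    nlinarith [hsm.one_lt_core, hsm.pos, hsm.add_lt_one]
  -- The rescaled coefficients of the linear combination, and their limit.
  let u : ℕ → ℕ → ℝ := fun n r => (∑ k, w k * sumCoeff a n (m n k) r) / (n * a n)
  let g : ℝ → ℝ := fun x => ∑ k, w k * fbmKernel α (t k) x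
  set W := (∑ k, |w k|) * G with hW
  have hW0 : 0 ≤ W := mul_nonneg (Finset.sum_nonneg fun _ _ => abs_nonneg _) hG.le
  have hub : ∀ n ≥ N, ∀ r : ℕ, |u n r| ≤ W * (1 + (r : ℝ) / n) ^ (-(α - δ)) := by
    intro n hn r
    have hn0 : (0 : ℝ) < n := Nat.cast_pos.2 (ha.N_pos.trans hn)
    have han := ha.pos n hn
    have hna : 0 < n * a n := by positivity
    simp only [u]
    rw [abs_div, abs_of_pos hna, div_le_iff₀ hna]
    calc _ ≤ ∑ k, |w k| * (G * (n * a n) * (1 + (r : ℝ) / n) ^ (-(α - δ))) := by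
          refine (Finset.abs_sum_le_sum_abs _ _).trans (Finset.sum_le_sum fun k _ => ?_)
          rw [abs_mul]
          gcongr
          exact (abs_sumCoeff_le a (hmn n k) r).trans (hGb n hn r)
      _ = _ := by rw [← Finset.sum_mul, hW]; ring
  have hubW : ∀ n ≥ N, ∀ r : ℕ, |u n r| ≤ W + 1 := fun n hn r => (hub n hn r).trans (by
    have h1 : (1 + (r : ℝ) / n) ^ (-(α - δ)) ≤ 1 := Real.rpow_le_one_of_one_le_of_nonpos
      (by linarith [show 0 ≤ (r : ℝ) / n by positivity]) (by linarith)
    nlinarith)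
  have hux : ∀ n ≥ N, ∀ x : ℝ, 0 < x → |u n ⌊(n : ℝ) * x⌋₊| ≤ W * 2 ^ (α - δ) * (1 + x) ^ (-(α - δ)) := by
    intro n hn x hx
    refine (hub n hn _).trans ?_
    rw [mul_assoc W]
    exact mul_le_mul_of_nonneg_left (one_add_floor_rpow_le (ha.N_pos.trans hn) hq0 hx) hW0
  have hulim : ∀ x : ℝ, 0 < x → Tendsto (fun n : ℕ => u n ⌊(n : ℝ) * x⌋₊) atTop (𝓝 (g x)) := by
    intro x hx
    have : Tendsto (fun n : ℕ => ∑ k, w k * (sumCoeff a n (m n k) ⌊(n : ℝ) * x⌋₊ / (n * a n))) atTop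
        (𝓝 (g x)) := tendsto_finsetSum _ fun k _ =>
      (ha.tendsto_sumCoeff hsm (fun n => hmn n k) (hm k) hx.le).const_mul (w k)
    refine this.congr fun n => ?_
    simp only [u, Finset.sum_div, mul_div_assoc]
  set W' := W * 2 ^ (α - δ) with hW'
  have hW'0 : 0 ≤ W' := by positivity
  obtain ⟨K, hK, hKb⟩ := hε.exists_cfError_le_rpow hsm.pos (show 0 < W + 1 by positivity)
  have hev : ∀ᶠ n : ℕ in atTop, N ≤ n ∧ ∀ v : ℝ, |v| ≤ W + 1 → cfError ε P n v ≤ K * |v| ^ (2 - δ) :=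
    (eventually_ge_atTop N).and hKb
  have hδ2 : 0 ≤ 2 - δ := by linarith [hsm.le_alpha, hsm.add_lt_one, hsm.pos]
  have hmeas : ∀ (n : ℕ) (F : ℕ → ℝ), AEStronglyMeasurable (fun x : ℝ => F ⌊(n : ℝ) * x⌋₊)
      (volume.restrict (Set.Ioi (0 : ℝ))) := fun n F =>
    ((measurable_of_countable F).comp (measurable_floor_mul n)).aestronglyMeasurable
  have hpow : ∀ (s x : ℝ), 0 < x → 0 ≤ s → (W' * (1 + x) ^ (-(α - δ))) ^ s =
      W' ^ s * (1 + x) ^ (-(s * (α - δ))) := by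
    intro s x hx hs
    rw [Real.mul_rpow hW'0 (by positivity), ← Real.rpow_mul (by positivity)]
    congr 2; ring
  -- convergence of the variances, by dominated convergence
  have hsqb : ∀ᶠ n : ℕ in atTop, ∀ᵐ x ∂(volume.restrict (Set.Ioi (0 : ℝ))),
      ‖u n ⌊(n : ℝ) * x⌋₊ ^ 2‖ ≤ W' ^ (2 : ℝ) * (1 + x) ^ (-(2 * (α - δ))) := by
    filter_upwards [eventually_ge_atTop N] with n hn
    filter_upwards [ae_restrict_mem measurableSet_Ioi] with x hx
    have hx : 0 < x := hx
    rw [← hpow 2 x hx zero_le_two, Real.norm_of_nonneg (sq_nonneg _), ← sq_abs, Real.rpow_two]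
    gcongr
    exact hux n hn x hx
  have hsqi : Integrable (fun x : ℝ => W' ^ (2 : ℝ) * (1 + x) ^ (-(2 * (α - δ))))
      (volume.restrict (Set.Ioi (0 : ℝ))) := (integrableOn_one_add_rpow hq2).const_mul _
  have hsqlim := tendsto_integral_filter_of_dominated_convergence _
    (Eventually.of_forall fun n : ℕ => hmeas n fun r => u n r ^ 2) hsqb hsqi
    (by
      filter_upwards [ae_restrict_mem measurableSet_Ioi] with x hx
      exact (hulim x hx).pow 2)
  -- the errors tend to zero, by dominated convergence
  have herrb : ∀ᶠ n : ℕ in atTop, ∀ᵐ x ∂(volume.restrict (Set.Ioi (0 : ℝ))),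
      ‖cfError ε P n (u n ⌊(n : ℝ) * x⌋₊)‖ ≤ K * W' ^ (2 - δ) * (1 + x) ^ (-((2 - δ) * (α - δ))) := by
    filter_upwards [hev] with n ⟨hn, hb⟩
    filter_upwards [ae_restrict_mem measurableSet_Ioi] with x hx
    have hx : 0 < x := hx
    rw [Real.norm_of_nonneg (cfError_nonneg _ _), mul_assoc, ← hpow (2 - δ) x hx hδ2]
    refine (hb _ (hubW n hn _)).trans ?_
    gcongr
    exact hux n hn x hx
  have herri : Integrable (fun x : ℝ => K * W' ^ (2 - δ) * (1 + x) ^ (-((2 - δ) * (α - δ))))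
      (volume.restrict (Set.Ioi (0 : ℝ))) := (integrableOn_one_add_rpow hq3).const_mul _
  have herrlim := tendsto_integral_filter_of_dominated_convergence _
    (Eventually.of_forall fun n : ℕ => hmeas n fun r => cfError ε P n (u n r)) herrb herri
    (by
      filter_upwards [ae_restrict_mem measurableSet_Ioi] with x hx
      exact hε.tendsto_cfError (hulim x hx))
  rw [integral_zero] at herrlim
  have hgauss : Tendsto (fun n : ℕ => Complex.exp (-(((∫ x in Set.Ioi (0 : ℝ),
      u n ⌊(n : ℝ) * x⌋₊ ^ 2) / 2 : ℝ) : ℂ))) atTop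
      (𝓝 (Complex.exp (-(((∫ x in Set.Ioi (0 : ℝ), g x ^ 2) / 2 : ℝ) : ℂ)))) :=
    (Complex.continuous_exp.tendsto _).comp
      ((Complex.continuous_ofReal.tendsto _).comp (hsqlim.div_const 2)).neg
  rw [tendsto_iff_norm_sub_tendsto_zero] at hgauss ⊢
  have hsum := herrlim.add hgauss
  rw [add_zero] at hsum
  refine squeeze_zero' (Eventually.of_forall fun n => norm_nonneg _) ?_ hsum
  filter_upwards [hsqb, herrb, eventually_ge_atTop N, hε.eventually_isTruncScale hsm.pos one_pos]
    with n hsq herr hn hsc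
  have hn1 : 0 < n := hsc.n_pos
  have hn0 : (0 : ℝ) < n := Nat.cast_pos.2 hn1
  have hsum1 : Summable fun r => u n r ^ 2 := (integrableOn_floor_mul_iff hn1 _).1
    (hsqi.mono' (hmeas n fun r => u n r ^ 2) hsq)
  have hsum2 : Summable fun r => cfError ε P n (u n r) := (integrableOn_floor_mul_iff hn1 _).1
    (herri.mono' (hmeas n fun r => cfError ε P n (u n r)) herr)
  have hZ : ∀ᵐ ω ∂P, Tendsto (fun M => ∑ r ∈ Finset.range M,
      (u n r / innovationScale ε P n) * ε ((n : ℤ) - r) ω) atTop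
      (𝓝 ((∑ k, w k * linearSum a ε (m n k) ω) / (n * a n * innovationScale ε P n))) := by
    filter_upwards [hε.ae_tendsto_linearSum hsm ha zero_le_one hsc hn] with ω h
    have h1 : Tendsto (fun M => (∑ k, w k * ∑ r ∈ Finset.range M,
        sumCoeff a n (m n k) r * ε ((n : ℤ) - r) ω) / (n * a n * innovationScale ε P n)) atTop
        (𝓝 ((∑ k, w k * linearSum a ε (m n k) ω) / (n * a n * innovationScale ε P n))) :=
      (tendsto_finsetSum _ fun k _ => (h _ (hmn n k)).const_mul (w k)).div_const _
    refine h1.congr fun M => ?_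
    simp only [u, Finset.mul_sum, Finset.sum_div, Finset.sum_mul]
    rw [Finset.sum_comm]
    refine Finset.sum_congr rfl fun r _ => Finset.sum_congr rfl fun k _ => ?_
    rw [div_div]; ring
  have hZm : AEMeasurable (fun ω => (∑ k, w k * linearSum a ε (m n k) ω) /
      (n * a n * innovationScale ε P n)) P :=
    (Finset.aemeasurable_fun_sum _ fun k _ =>
      (hε.aemeasurable_linearSum hsm ha _).const_mul (w k)).div_const _
  have hkey := norm_charFun_limit_sub_le (P := P) (ξ := ε 0) (e := fun r : ℕ => ε ((n : ℤ) - r))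
    (fun r => hε.measurable _) (hε.iIndepFun_reverse n) (fun r => hε.identDistrib _) hZ hZm
    (g := fun r => u n r ^ 2 / (2 * n)) (E := fun r => cfError ε P n (u n r) / n)
    (fun r => by positivity) (hsum1.div_const _) (hsum2.div_const _)
    (fun r => by
      unfold cfError
      rw [mul_div_cancel_left₀ _ hn0.ne'])
  have e1 : ∑' r, u n r ^ 2 / (2 * n) = (∫ x in Set.Ioi (0 : ℝ), u n ⌊(n : ℝ) * x⌋₊ ^ 2) / 2 := by
    rw [integral_floor_mul hn1 hsum1, tsum_div_const]
    field_simp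
  have e2 : ∑' r, cfError ε P n (u n r) / n =
      ∫ x in Set.Ioi (0 : ℝ), cfError ε P n (u n ⌊(n : ℝ) * x⌋₊) := by
    rw [integral_floor_mul hn1 hsum2, tsum_div_const]
    field_simp
  rw [e1, e2] at hkey
  refine (norm_sub_le_norm_sub_add_norm_sub _ _ _).trans (add_le_add hkey le_rfl)

end Fdd

/-! ### The covariance of the limit -/

theorem cAlpha_nonneg (α : ℝ) : 0 ≤ cAlpha α :=
  div_nonneg (integral_nonneg fun _ => sq_nonneg _) (sq_nonneg _)

theorem fbmKernel_zero (α x : ℝ) : fbmKernel α 0 x = 0 := by simp [fbmKernel]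

theorem fbmKernel_of_nonpos {α t x : ℝ} (ht : t ≤ 1) (hx : x ≤ 0) :
    fbmKernel α t x = 0 := by
  unfold fbmKernel
  rw [max_eq_right (by linarith), max_eq_right (by linarith)]
  simp

/-- The scaling `x ↦ (x - (1 - t)) / (t - s)` reduces the integral to the one that defines `c_α`. -/
theorem integral_sq_fbmKernel_sub_of_lt {α s t : ℝ} (hα : α < 1) (hst : s < t) (ht : t ≤ 1) :
    ∫ x in Set.Ioi (0 : ℝ), (fbmKernel α t x - fbmKernel α s x) ^ 2 =
      cAlpha α * (t - s) ^ (3 - 2 * α) := by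
  have hβ : 0 < 1 - α := by linarith
  have hh : 0 < t - s := by linarith
  let F : ℝ → ℝ := fun y => (max y 0 ^ (1 - α) - max (y - 1) 0 ^ (1 - α)) ^ 2
  have hF : ∫ y, F y = cAlpha α * (1 - α) ^ 2 := by
    rw [cAlpha, div_mul_cancel₀ _ (by positivity),
      ← setIntegral_eq_integral_of_forall_compl_eq_zero (s := Set.Ioi (0 : ℝ))]
    · refine setIntegral_congr_fun measurableSet_Ioi fun x hx => ?_
      have hx : 0 < x := hx
      simp only [F]
      rw [max_eq_left hx.le]
    · intro x hx
      have hx : x ≤ 0 := not_lt.1 hx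
      simp only [F]
      rw [max_eq_right hx, max_eq_right (by linarith)]
      simp
  have hmax : ∀ z : ℝ, max ((t - s) * z) 0 = (t - s) * max z 0 := fun z => by
    rw [mul_max_of_nonneg _ _ hh.le, mul_zero]
  have hpt : ∀ x, (fbmKernel α t x - fbmKernel α s x) ^ 2 =
      ((t - s) ^ (1 - α)) ^ 2 / (1 - α) ^ 2 * F ((x - (1 - t)) / (t - s)) := by
    intro x
    have e1 : t + x - 1 = (t - s) * ((x - (1 - t)) / (t - s)) := by field_simp; ring
    have e2 : s + x - 1 = (t - s) * ((x - (1 - t)) / (t - s) - 1) := by field_simp; ring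
    simp only [fbmKernel, F]
    rw [e1, e2, hmax, hmax, Real.mul_rpow hh.le (le_max_right _ _),
      Real.mul_rpow hh.le (le_max_right _ _)]
    field_simp
    ring
  rw [setIntegral_eq_integral_of_forall_compl_eq_zero fun x hx => by
    have hx : x ≤ 0 := not_lt.1 hx
    rw [fbmKernel_of_nonpos ht hx, fbmKernel_of_nonpos (by linarith) hx]; simp]
  simp only [hpt]
  rw [integral_const_mul, integral_sub_right_eq_self (fun x => F (x / (t - s))) (1 - t),
    Measure.integral_comp_div, hF, abs_of_pos hh, smul_eq_mul]
  have e : (t - s) ^ (3 - 2 * α) = ((t - s) ^ (1 - α)) ^ 2 * (t - s) := by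
    rw [← Real.rpow_natCast, ← Real.rpow_mul hh.le, ← Real.rpow_add_one hh.ne']
    congr 1; push_cast; ring
  rw [e]
  field_simp

theorem integral_sq_fbmKernel_sub {α s t : ℝ} (hα : α < 1) (hs : s ≤ 1) (ht : t ≤ 1) :
    ∫ x in Set.Ioi (0 : ℝ), (fbmKernel α t x - fbmKernel α s x) ^ 2 =
      cAlpha α * |t - s| ^ (3 - 2 * α) := by
  rcases lt_trichotomy s t with h | rfl | h
  · rw [integral_sq_fbmKernel_sub_of_lt hα h ht, abs_of_pos (by linarith)]
  · simp [Real.zero_rpow (show 3 - 2 * α ≠ 0 by linarith)]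
  · rw [abs_sub_comm, abs_of_pos (by linarith), ← integral_sq_fbmKernel_sub_of_lt hα h hs]
    congr 1; ext x; ring

theorem integral_sq_fbmKernel {α t : ℝ} (hα : α < 1) (ht0 : 0 ≤ t) (ht : t ≤ 1) :
    ∫ x in Set.Ioi (0 : ℝ), fbmKernel α t x ^ 2 = cAlpha α * t ^ (3 - 2 * α) := by
  have h := integral_sq_fbmKernel_sub hα zero_le_one ht
  simpa [fbmKernel_zero, abs_of_nonneg ht0] using h

/-- The kernel inherits the bound on the coefficients of the partial sums, of which it is the
limit. -/
theorem IsPotterSequence.exists_abs_fbmKernel_le {a : ℕ → ℝ} {α δ C : ℝ} {N : ℕ}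
    (ha : IsPotterSequence a α δ C N) (hsm : IsSmallExponent α δ) :
    ∃ K : ℝ, ∀ t : ℝ, 0 ≤ t → t ≤ 1 → ∀ x : ℝ, 0 < x →
      |fbmKernel α t x| ≤ K * (1 + x) ^ (-(α - δ)) := by
  obtain ⟨G, hG, hGb⟩ := ha.exists_sum_abs_shiftCoeff_le hsm.pos hsm.le_alpha hsm.add_lt_one
  refine ⟨G * 2 ^ (α - δ), fun t ht0 ht x hx => ?_⟩
  have hm : Tendsto (fun n : ℕ => (⌊(n : ℝ) * t⌋₊ : ℝ) / n) atTop (𝓝 t) := by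
    have := (tendsto_nat_floor_mul_div_atTop ht0).comp (tendsto_natCast_atTop_atTop (R := ℝ))
    simpa only [Function.comp_def, mul_comm] using this
  have hmn : ∀ n : ℕ, ⌊(n : ℝ) * t⌋₊ ≤ n := fun n =>
    Nat.floor_le_of_le (mul_le_of_le_one_right (Nat.cast_nonneg n) ht)
  refine le_of_tendsto (ha.tendsto_sumCoeff hsm hmn hm hx.le).abs ?_
  filter_upwards [eventually_ge_atTop N] with n hn
  have hn0 : (0 : ℝ) < n := Nat.cast_pos.2 (ha.N_pos.trans hn)
  have han := ha.pos n hn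
  have hna : 0 < n * a n := by positivity
  rw [abs_div, abs_of_pos hna, div_le_iff₀ hna]
  refine (abs_sumCoeff_le a (hmn n) _).trans ((hGb n hn _).trans ?_)
  have h1 := one_add_floor_rpow_le (ha.N_pos.trans hn) (show 0 ≤ α - δ by linarith [hsm.le_alpha]) hx
  calc _ ≤ G * (n * a n) * (2 ^ (α - δ) * (1 + x) ^ (-(α - δ))) := by gcongr
    _ = _ := by ring

theorem IsPotterSequence.memLp_fbmKernel {a : ℕ → ℝ} {α δ C : ℝ} {N : ℕ}
    (ha : IsPotterSequence a α δ C N) (hsm : IsSmallExponent α δ) {t : ℝ} (ht0 : 0 ≤ t)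
    (ht : t ≤ 1) : MemLp (fbmKernel α t) 2 (volume.restrict (Set.Ioi (0 : ℝ))) := by
  obtain ⟨K, hK⟩ := ha.exists_abs_fbmKernel_le hsm
  rw [memLp_two_iff_integrable_sq (measurable_fbmKernel α t).aestronglyMeasurable]
  refine Integrable.mono' ((integrableOn_one_add_rpow hsm.one_lt_sq).const_mul (K ^ 2))
    ((measurable_fbmKernel α t).pow_const 2).aestronglyMeasurable ?_
  filter_upwards [ae_restrict_mem measurableSet_Ioi] with x hx
  have hx : 0 < x := hx
  rw [Real.norm_of_nonneg (sq_nonneg _), ← sq_abs]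
  calc |fbmKernel α t x| ^ 2 ≤ (K * (1 + x) ^ (-(α - δ))) ^ 2 := by gcongr; exact hK t ht0 ht x hx
    _ = K ^ 2 * ((1 + x) ^ (-(α - δ)) * (1 + x) ^ (-(α - δ))) := by ring
    _ = _ := by
        rw [← Real.rpow_add (by positivity)]
        congr 2; ring

/-- The covariance of the linear combinations of the limit is that of `√c_α` times a fractional
Brownian motion. -/
theorem IsPotterSequence.integral_sq_sum_fbmKernel {a : ℕ → ℝ} {α δ C : ℝ} {N : ℕ}
    (ha : IsPotterSequence a α δ C N) (hsm : IsSmallExponent α δ) {ι : Type*} [Fintype ι]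
    (w : ι → ℝ) {t : ι → ℝ} (ht0 : ∀ k, 0 ≤ t k) (ht : ∀ k, t k ≤ 1) :
    ∫ x in Set.Ioi (0 : ℝ), (∑ k, w k * fbmKernel α (t k) x) ^ 2 =
      cAlpha α * ∑ j, ∑ k, w j * w k *
        ((t j ^ (3 - 2 * α) + t k ^ (3 - 2 * α) - |t j - t k| ^ (3 - 2 * α)) / 2) := by
  have hα : α < 1 := by linarith [hsm.pos, hsm.add_lt_one]
  have hL : ∀ k, MemLp (fbmKernel α (t k)) 2 (volume.restrict (Set.Ioi (0 : ℝ))) := fun k =>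
    ha.memLp_fbmKernel hsm (ht0 k) (ht k)
  have hi : ∀ j k, Integrable (fun x => fbmKernel α (t j) x * fbmKernel α (t k) x)
      (volume.restrict (Set.Ioi (0 : ℝ))) := fun j k => (hL j).integrable_mul (hL k)
  have hcov : ∀ j k, ∫ x in Set.Ioi (0 : ℝ), fbmKernel α (t j) x * fbmKernel α (t k) x =
      cAlpha α * ((t j ^ (3 - 2 * α) + t k ^ (3 - 2 * α) - |t j - t k| ^ (3 - 2 * α)) / 2) := by
    intro j k
    have h1 := integral_sq_fbmKernel_sub hα (ht k) (ht j)
    have e : ∀ x, (fbmKernel α (t j) x - fbmKernel α (t k) x) ^ 2 = (fbmKernel α (t j) x ^ 2 +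
      fbmKernel α (t k) x ^ 2) - 2 * (fbmKernel α (t j) x * fbmKernel α (t k) x) := fun x => by ring
    have i1 : Integrable (fun x => fbmKernel α (t j) x ^ 2 + fbmKernel α (t k) x ^ 2)
      (volume.restrict (Set.Ioi (0 : ℝ))) := (hL j).integrable_sq.add (hL k).integrable_sq
    simp only [e] at h1
    rw [integral_sub i1 ((hi j k).const_mul 2), integral_const_mul,
      integral_add (hL j).integrable_sq (hL k).integrable_sq,
      integral_sq_fbmKernel hα (ht0 j) (ht j), integral_sq_fbmKernel hα (ht0 k) (ht k)] at h1
    linarith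
  have e : ∀ x, (∑ k, w k * fbmKernel α (t k) x) ^ 2 =
      ∑ j, ∑ k, w j * w k * (fbmKernel α (t j) x * fbmKernel α (t k) x) := by
    intro x
    rw [sq, Finset.sum_mul_sum]
    exact Finset.sum_congr rfl fun j _ => Finset.sum_congr rfl fun k _ => by ring
  simp only [e]
  rw [integral_finsetSum _ fun j _ => integrable_finsetSum _ fun k _ => (hi j k).const_mul _,
    Finset.mul_sum]
  refine Finset.sum_congr rfl fun j _ => ?_
  rw [integral_finsetSum _ fun k _ => (hi j k).const_mul _, Finset.mul_sum]
  refine Finset.sum_congr rfl fun k _ => ?_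
  rw [integral_const_mul, hcov]
  ring

/-! ### Dyadic chaining -/

/-- Any point of a dyadic block is reached from its left end by at most one increment of each dyadic
length. -/
theorem abs_sub_le_sum_dyadic (p : ℕ) (x : ℕ → ℝ) {k : ℕ} (hk : k ≤ 2 ^ p) :
    |x k - x 0| ≤ ∑ i ∈ Finset.range (p + 1),
      √(∑ j ∈ Finset.range (2 ^ i), (x ((j + 1) * 2 ^ (p - i)) - x (j * 2 ^ (p - i))) ^ 2) := by
  induction p generalizing x k with
  | zero =>
    rcases Nat.le_one_iff_eq_zero_or_eq_one.1 (by simpa using hk) with rfl | rfl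
    · simp
    · simp [Real.sqrt_sq_eq_abs]
  | succ p ih =>
    rw [Finset.sum_range_succ]
    have h1 := ih (fun k => x (2 * k)) (k := k / 2) (by rw [pow_succ] at hk; omega)
    have e : ∀ i ∈ Finset.range (p + 1),
        √(∑ j ∈ Finset.range (2 ^ i), (x (2 * ((j + 1) * 2 ^ (p - i))) -
          x (2 * (j * 2 ^ (p - i)))) ^ 2) =
        √(∑ j ∈ Finset.range (2 ^ i), (x ((j + 1) * 2 ^ (p + 1 - i)) -
          x (j * 2 ^ (p + 1 - i))) ^ 2) := by
      intro i hi
      have hi : i ≤ p := by have := Finset.mem_range.1 hi; omega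
      rw [Nat.succ_sub hi, pow_succ]
      congr 1
      refine Finset.sum_congr rfl fun j _ => ?_
      congr 3 <;> ring_nf
    simp only [mul_zero] at h1
    rw [Finset.sum_congr rfl e] at h1
    have h2 : |x k - x (2 * (k / 2))| ≤
        √(∑ j ∈ Finset.range (2 ^ (p + 1)), (x ((j + 1) * 2 ^ (p + 1 - (p + 1))) -
          x (j * 2 ^ (p + 1 - (p + 1)))) ^ 2) := by
      refine Real.abs_le_sqrt ?_
      simp only [Nat.sub_self, pow_zero, mul_one]
      rcases Nat.even_or_odd' k with ⟨c, rfl | rfl⟩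
      · rw [Nat.mul_div_cancel_left _ two_pos, sub_self]
        simpa using Finset.sum_nonneg fun j _ => sq_nonneg _
      · have e2 : (2 * c + 1) / 2 = c := by omega
        rw [e2]
        exact Finset.single_le_sum (f := fun j => (x (j + 1) - x j) ^ 2)
          (fun j _ => sq_nonneg _) (Finset.mem_range.2 (by omega))
    have e3 : x k - x 0 = (x (2 * (k / 2)) - x 0) + (x k - x (2 * (k / 2))) := by ring
    rw [e3]
    exact (abs_add_le _ _).trans (add_le_add h1 h2)

/-- Cauchy-Schwarz in the chaining bound, with the geometric weights `v ^ i`, and the largest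
increment of each dyadic length bounded by the sum of all of them. -/
theorem sq_sub_le_sum_dyadic {v : ℝ} (hv : 0 < v) (hv1 : v < 1) (p : ℕ) (x : ℕ → ℝ) {k : ℕ}
    (hk : k ≤ 2 ^ p) :
    (x k - x 0) ^ 2 ≤ (1 - v)⁻¹ * ∑ i ∈ Finset.range (p + 1), (v ^ i)⁻¹ *
      ∑ j ∈ Finset.range (2 ^ i), (x ((j + 1) * 2 ^ (p - i)) - x (j * 2 ^ (p - i))) ^ 2 := by
  set D : ℕ → ℝ := fun i =>
    ∑ j ∈ Finset.range (2 ^ i), (x ((j + 1) * 2 ^ (p - i)) - x (j * 2 ^ (p - i))) ^ 2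
  have hD : ∀ i, 0 ≤ D i := fun i => Finset.sum_nonneg fun j _ => sq_nonneg _
  have h1 := abs_sub_le_sum_dyadic p x hk
  have hv0 : 0 < 1 - v := by linarith
  have e : ∀ i, √(D i) = √(v ^ i) * √((v ^ i)⁻¹ * D i) := fun i => by
    rw [← Real.sqrt_mul (by positivity), ← mul_assoc, mul_inv_cancel₀ (by positivity), one_mul]
  have h2 := Finset.sum_mul_sq_le_sq_mul_sq (Finset.range (p + 1)) (fun i => √(v ^ i))
    (fun i => √((v ^ i)⁻¹ * D i))
  have e1 : ∀ i ∈ Finset.range (p + 1), √(v ^ i) ^ 2 = v ^ i := fun i _ =>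
    Real.sq_sqrt (by positivity)
  have e2 : ∀ i ∈ Finset.range (p + 1), √((v ^ i)⁻¹ * D i) ^ 2 = (v ^ i)⁻¹ * D i := fun i _ =>
    Real.sq_sqrt (mul_nonneg (by positivity) (hD i))
  rw [Finset.sum_congr rfl e1, Finset.sum_congr rfl e2] at h2
  have h3 : ∑ i ∈ Finset.range (p + 1), v ^ i ≤ (1 - v)⁻¹ := by
    rw [geom_sum_eq hv1.ne, ← neg_div_neg_eq, neg_sub, neg_sub, div_eq_mul_inv]
    exact mul_le_of_le_one_left (by positivity) (by linarith [pow_pos hv (p + 1)])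
  calc (x k - x 0) ^ 2 = |x k - x 0| ^ 2 := (sq_abs _).symm
    _ ≤ (∑ i ∈ Finset.range (p + 1), √(D i)) ^ 2 := by gcongr
    _ = (∑ i ∈ Finset.range (p + 1), √(v ^ i) * √((v ^ i)⁻¹ * D i)) ^ 2 := by
        rw [Finset.sum_congr rfl fun i _ => e i]
    _ ≤ _ := h2.trans (mul_le_mul_of_nonneg_right h3
        (Finset.sum_nonneg fun i _ => mul_nonneg (by positivity) (hD i)))

/-- The maximal inequality for a process whose increments have second moments of order
`(m - k) ^ γ`, with `γ > 1`. -/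
theorem exists_measure_dyadic_le {γ : ℝ} (hγ : 1 < γ) : ∃ K : ℝ, 0 < K ∧
    ∀ {Ω : Type*} [MeasurableSpace Ω] {P : Measure Ω} {X : ℕ → Ω → ℝ} {A θ : ℝ} {p : ℕ},
      (∀ k, AEMeasurable (X k) P) → 0 ≤ A → 0 < θ →
      (∀ k h : ℕ, ∫⁻ ω, ENNReal.ofReal ((X (k + h) ω - X k ω) ^ 2) ∂P ≤
        ENNReal.ofReal (A * (h : ℝ) ^ γ)) →
      P {ω | ∃ k ≤ 2 ^ p, θ < |X k ω - X 0 ω|} ≤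
        ENNReal.ofReal (K * A * ((2 : ℝ) ^ p) ^ γ / θ ^ 2) := by
  -- The number of increments of length `2 ^ (p - i)` is `2 ^ i`, and `2 * (2 ^ γ)⁻¹ = v * v`:
  -- one factor `v ^ i` pays for the weight of the chaining, the other one makes the sum converge.
  set v : ℝ := 2 ^ ((1 - γ) / 2) with hvdef
  have hv : 0 < v := by positivity
  have hv1 : v < 1 := Real.rpow_lt_one_of_one_lt_of_neg one_lt_two (by linarith)
  have hv2 : v * v = 2 * (2 ^ γ)⁻¹ := by
    rw [hvdef, ← Real.rpow_add two_pos, show (1 - γ) / 2 + (1 - γ) / 2 = 1 + -γ by ring,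
      Real.rpow_add two_pos, Real.rpow_one, Real.rpow_neg two_pos.le]
  have hv0 : 0 < 1 - v := by linarith
  refine ⟨(1 - v)⁻¹ * (1 - v)⁻¹, by positivity, ?_⟩
  intro Ω _ P X A θ p hX hA hθ hinc
  let f : Ω → ℝ≥0∞ := fun ω => ∑ i ∈ Finset.range (p + 1), ENNReal.ofReal ((1 - v)⁻¹ * (v ^ i)⁻¹) *
    ∑ j ∈ Finset.range (2 ^ i),
      ENNReal.ofReal ((X ((j + 1) * 2 ^ (p - i)) ω - X (j * 2 ^ (p - i)) ω) ^ 2)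
  have hm1 : ∀ i j : ℕ, AEMeasurable (fun ω =>
      ENNReal.ofReal ((X ((j + 1) * 2 ^ (p - i)) ω - X (j * 2 ^ (p - i)) ω) ^ 2)) P := fun i j =>
    ENNReal.measurable_ofReal.comp_aemeasurable (((hX _).sub (hX _)).pow_const 2)
  have hm2 : ∀ i : ℕ, AEMeasurable (fun ω => ∑ j ∈ Finset.range (2 ^ i),
      ENNReal.ofReal ((X ((j + 1) * 2 ^ (p - i)) ω - X (j * 2 ^ (p - i)) ω) ^ 2)) P := fun i =>
    Finset.aemeasurable_fun_sum _ fun j _ => hm1 i j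
  have hfm : AEMeasurable f P := Finset.aemeasurable_fun_sum _ fun i _ => (hm2 i).const_mul _
  have hfi : ∫⁻ ω, f ω ∂P ≤
      ENNReal.ofReal ((1 - v)⁻¹ * (1 - v)⁻¹ * A * ((2 : ℝ) ^ p) ^ γ) := by
    simp only [f]
    rw [lintegral_finsetSum' _ fun i _ => (hm2 i).const_mul _]
    calc _ ≤ ∑ i ∈ Finset.range (p + 1), ENNReal.ofReal ((1 - v)⁻¹ * A * ((2 : ℝ) ^ p) ^ γ * v ^ i) := by
          refine Finset.sum_le_sum fun i hi => ?_
          have hi : i ≤ p := by have := Finset.mem_range.1 hi; omega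
          rw [lintegral_const_mul'' _ (hm2 i), lintegral_finsetSum' _ fun j _ => hm1 i j]
          calc _ ≤ ENNReal.ofReal ((1 - v)⁻¹ * (v ^ i)⁻¹) * ∑ j ∈ Finset.range (2 ^ i),
                ENNReal.ofReal (A * ((2 ^ (p - i) : ℕ) : ℝ) ^ γ) := by
                gcongr with j hj
                have := hinc (j * 2 ^ (p - i)) (2 ^ (p - i))
                rwa [← Nat.succ_mul] at this
            _ = _ := by
                rw [Finset.sum_const, Finset.card_range, nsmul_eq_mul, ← ENNReal.ofReal_natCast,
                  ← ENNReal.ofReal_mul (by positivity), ← ENNReal.ofReal_mul (by positivity)]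
                congr 1
                have e1 : ((2 : ℝ) ^ p) ^ γ = ((2 : ℝ) ^ (p - i)) ^ γ * (2 ^ γ) ^ i := by
                  rw [← Real.rpow_natCast (2 ^ γ) i, ← Real.rpow_mul two_pos.le, mul_comm γ,
                    Real.rpow_mul two_pos.le, Real.rpow_natCast,
                    ← Real.mul_rpow (by positivity) (by positivity), ← pow_add, Nat.sub_add_cancel hi]
                have e2 : v ^ i * v ^ i = 2 ^ i * ((2 ^ γ) ^ i)⁻¹ := by
                  rw [← mul_pow, hv2, mul_pow, inv_pow]
                have e3 : (v ^ i)⁻¹ * 2 ^ i = (2 ^ γ) ^ i * v ^ i := by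
                  have : (0 : ℝ) < (2 ^ γ) ^ i := by positivity
                  field_simp at e2 ⊢
                  linarith
                push_cast
                rw [e1]
                calc _ = (1 - v)⁻¹ * A * ((2 : ℝ) ^ (p - i)) ^ γ * ((v ^ i)⁻¹ * 2 ^ i) := by ring
                  _ = _ := by rw [e3]; ring
      _ = ENNReal.ofReal (∑ i ∈ Finset.range (p + 1), (1 - v)⁻¹ * A * ((2 : ℝ) ^ p) ^ γ * v ^ i) :=
          (ENNReal.ofReal_sum_of_nonneg fun i _ => by positivity).symm
      _ ≤ _ := by
          refine ENNReal.ofReal_le_ofReal ?_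
          rw [← Finset.mul_sum]
          have h3 : ∑ i ∈ Finset.range (p + 1), v ^ i ≤ (1 - v)⁻¹ := by
            rw [geom_sum_eq hv1.ne, ← neg_div_neg_eq, neg_sub, neg_sub, div_eq_mul_inv]
            exact mul_le_of_le_one_left (by positivity) (by linarith [pow_pos hv (p + 1)])
          calc _ ≤ (1 - v)⁻¹ * A * ((2 : ℝ) ^ p) ^ γ * (1 - v)⁻¹ := by gcongr
            _ = _ := by ring
  refine (measure_mono fun ω hω => ?_).trans
    (measure_lt_le_lintegral_div hfm hfi (show 0 < θ ^ 2 by positivity))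
  obtain ⟨k, hk, hkθ⟩ := hω
  have h1 := sq_sub_le_sum_dyadic hv hv1 p (fun k => X k ω) hk
  have h2 : θ ^ 2 < (X k ω - X 0 ω) ^ 2 := by
    rw [← sq_abs (X k ω - X 0 ω)]
    exact pow_lt_pow_left₀ hkθ hθ.le two_ne_zero
  have h3 : ENNReal.ofReal (θ ^ 2) < ENNReal.ofReal ((1 - v)⁻¹ * ∑ i ∈ Finset.range (p + 1), (v ^ i)⁻¹ *
      ∑ j ∈ Finset.range (2 ^ i),
        (X ((j + 1) * 2 ^ (p - i)) ω - X (j * 2 ^ (p - i)) ω) ^ 2) :=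
    (ENNReal.ofReal_lt_ofReal_iff_of_nonneg (by positivity)).2 (h2.trans_le h1)
  refine h3.trans_eq ?_
  simp only [f]
  rw [Finset.mul_sum, ENNReal.ofReal_sum_of_nonneg fun i _ => by
    have := Finset.sum_nonneg fun j (_ : j ∈ Finset.range (2 ^ i)) =>
      sq_nonneg (X ((j + 1) * 2 ^ (p - i)) ω - X (j * 2 ^ (p - i)) ω)
    positivity]
  refine Finset.sum_congr rfl fun i _ => ?_
  rw [← mul_assoc, ENNReal.ofReal_mul (by positivity),
    ENNReal.ofReal_sum_of_nonneg fun j _ => sq_nonneg _]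

/-! ### Second moments of the increments -/

theorem potterMajorant_sq_mul_le {α δ v : ℝ} (hδ : 0 ≤ δ) (hv : 0 < v) :
    potterMajorant α δ v ^ 2 * (1 + v ^ δ) ≤
      8 * (v ^ (-(2 * α - 3 * δ)) + v ^ (-(2 * α + 2 * δ))) := by
  set x := v ^ (-(2 * α - 3 * δ))
  set y := v ^ (-(2 * α + 2 * δ))
  -- the intermediate powers lie between the two extreme ones
  have hmid : ∀ q, 2 * α - 3 * δ ≤ q → q ≤ 2 * α + 2 * δ → v ^ (-q) ≤ x + y := by
    intro q h1 h2
    have hx : 0 ≤ x := by positivity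
    have hy : 0 ≤ y := by positivity
    rcases le_total v 1 with h | h
    · have : v ^ (-q) ≤ y := Real.rpow_le_rpow_of_exponent_ge hv h (by linarith)
      linarith
    · have : v ^ (-q) ≤ x := Real.rpow_le_rpow_of_exponent_le h (by linarith)
      linarith
  have h1 : (v ^ (-(α + δ))) ^ 2 = v ^ (-(2 * α + 2 * δ)) := by
    rw [← Real.rpow_natCast, ← Real.rpow_mul hv.le]; congr 1; push_cast; ring
  have h2 : (v ^ (-(α - δ))) ^ 2 = v ^ (-(2 * α - 2 * δ)) := by
    rw [← Real.rpow_natCast, ← Real.rpow_mul hv.le]; congr 1; push_cast; ring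
  have h3 : potterMajorant α δ v ^ 2 ≤ 2 * (v ^ (-(2 * α + 2 * δ)) + v ^ (-(2 * α - 2 * δ))) := by
    unfold potterMajorant
    nlinarith [sq_nonneg (v ^ (-(α + δ)) - v ^ (-(α - δ)))]
  calc _ ≤ 2 * (v ^ (-(2 * α + 2 * δ)) + v ^ (-(2 * α - 2 * δ))) * (1 + v ^ δ) := by gcongr
    _ = 2 * (v ^ (-(2 * α + 2 * δ)) + v ^ (-(2 * α - 2 * δ)) + v ^ (-(2 * α + δ)) +
        v ^ (-(2 * α - 3 * δ))) := by
        rw [mul_add, mul_one, mul_assoc 2, add_mul, ← Real.rpow_add hv, ← Real.rpow_add hv,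
          show -(2 * α + 2 * δ) + δ = -(2 * α + δ) by ring,
          show -(2 * α - 2 * δ) + δ = -(2 * α - 3 * δ) by ring]
        ring
    _ ≤ 2 * ((x + y) + (x + y) + (x + y) + (x + y)) := by
        gcongr
        · exact hmid _ (by linarith) (by linarith)
        · exact hmid _ (by linarith) (by linarith)
        · exact hmid _ (by linarith) (by linarith)
        · exact hmid _ (by linarith) (by linarith)
    _ = _ := by ring

theorem sumCoeff_sub_eq_zero (a : ℕ → ℝ) {n k h : ℕ} (hkh : k + h ≤ n) {r : ℕ}
    (hr : r < n - (k + h)) : sumCoeff a n (k + h) r - sumCoeff a n k r = 0 := by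
  rw [sumCoeff, sumCoeff, sum_shiftCoeff a hkh, sum_shiftCoeff a (by omega),
    show k + h + r + 1 - n = 0 by omega, show k + r + 1 - n = 0 by omega]
  simp

theorem abs_sumCoeff_sub_le (a : ℕ → ℝ) {n k h : ℕ} (hkh : k + h ≤ n) (j : ℕ) :
    |sumCoeff a n (k + h) (j + (n - (k + h))) - sumCoeff a n k (j + (n - (k + h)))| ≤
      ∑ i ∈ Finset.Ico (j + 1 - h) (j + 1), |a i| := by
  rw [sumCoeff, sumCoeff, sum_shiftCoeff a hkh, sum_shiftCoeff a (by omega), sub_sub_sub_cancel_right,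
    show k + h + (j + (n - (k + h))) + 1 - n = j + 1 by omega,
    show k + (j + (n - (k + h))) + 1 - n = j + 1 - h by omega,
    ← Finset.sum_Ico_eq_sub _ (by omega)]
  exact Finset.abs_sum_le_sum_abs _ _

/-- The squares of the coefficients of `S_{k+h} - S_k`, weighted by the growth of the truncated
variances, have a sum of order `h ^ (3 - 2α)`, up to a small loss in the exponent. -/
theorem IsPotterSequence.exists_tsum_increment_le {a : ℕ → ℝ} {α δ C : ℝ} {N : ℕ}
    (ha : IsPotterSequence a α δ C N) (hsm : IsSmallExponent α δ) : ∃ K : ℝ, 0 < K ∧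
    ∀ n ≥ N, ∀ k h : ℕ, 0 < h → k + h ≤ n →
      ∑' r : ℕ, ENNReal.ofReal ((sumCoeff a n (k + h) r - sumCoeff a n k r) ^ 2 *
        (1 + (r : ℝ) / n) ^ δ) ≤
      ENNReal.ofReal (K * n * (n * a n) ^ 2 * ((h : ℝ) / n) ^ (3 - 2 * α - 2 * δ)) := by
  have hC := ha.C_pos
  have hδ0 := hsm.pos
  have hδ1 : δ ≤ 1 := by linarith [hsm.pos, hsm.lower, hsm.add_lt_one]
  have hq1 : 1 < 2 * α - 3 * δ := by linarith [hsm.pos, hsm.lower]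
  have hden : 0 < 1 - α - δ := by linarith [hsm.add_lt_one]
  obtain ⟨K, hK, hKs⟩ := exists_tsum_one_add_rpow_le hq1
  set C1 := C * (1 + 2 ^ (2 * δ)) / (1 - α - δ) with hC1
  have hC1p : 0 < C1 := by positivity
  refine ⟨8 * (C1 * 2 ^ (1 - α - δ)) ^ 2 + 64 * C ^ 2 * K, by positivity, ?_⟩
  intro n hn k h hh hkh
  have hn1 : 0 < n := ha.N_pos.trans hn
  have hn0 : (0 : ℝ) < n := Nat.cast_pos.2 hn1
  have hh0 : (0 : ℝ) < h := Nat.cast_pos.2 hh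
  have han := ha.pos n hn
  have hhn : (h : ℝ) / n ≤ 1 := (div_le_one hn0).2 (by exact_mod_cast (by omega : h ≤ n))
  have hhn0 : 0 < (h : ℝ) / n := by positivity
  set D : ℕ → ℝ := fun r => sumCoeff a n (k + h) r - sumCoeff a n k r
  set s := n - (k + h)
  have hsn : (s : ℝ) ≤ n := by exact_mod_cast (by omega : s ≤ n)
  change ∑' r : ℕ, ENNReal.ofReal (D r ^ 2 * (1 + (r : ℝ) / n) ^ δ) ≤ _
  rw [← Summable.sum_add_tsum_nat_add' (k := s) ENNReal.summable, Finset.sum_eq_zero, zero_add,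
    ← Summable.sum_add_tsum_nat_add' (k := 2 * h) ENNReal.summable]
  swap
  · intro r hr
    have : D r = 0 := sumCoeff_sub_eq_zero a hkh (Finset.mem_range.1 hr)
    simp [this]
  -- the coefficients for which the window of length `h` may contain the origin
  have hnear : ∀ j ∈ Finset.range (2 * h), ENNReal.ofReal (D (j + s) ^ 2 *
      (1 + ((j + s : ℕ) : ℝ) / n) ^ δ) ≤ ENNReal.ofReal
        (4 * (C1 * 2 ^ (1 - α - δ)) ^ 2 * ((n * a n) ^ 2 * ((h : ℝ) / n) ^ (2 - 2 * α - 2 * δ))) := by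
    intro j hj
    rw [Finset.mem_range] at hj
    refine ENNReal.ofReal_le_ofReal ?_
    have h1 : |D (j + s)| ≤ C1 * (n * a n) * ((2 * h : ℕ) / n : ℝ) ^ (1 - α - δ) := by
      refine (abs_sumCoeff_sub_le a hkh j).trans (le_trans ?_ (ha.sum_range_abs_le hsm.pos
        hsm.le_alpha hsm.add_lt_one hn (K := 2) (by norm_num) (m := 2 * h) ?_))
      · rw [Finset.range_eq_Ico]
        exact Finset.sum_le_sum_of_subset_of_nonneg (Finset.Ico_subset_Ico (Nat.zero_le _) (by omega))
          fun _ _ _ => abs_nonneg _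
      · exact_mod_cast (by omega : 2 * h ≤ 2 * n)
    have h2 : ((2 * h : ℕ) / n : ℝ) ^ (1 - α - δ) = 2 ^ (1 - α - δ) * ((h : ℝ) / n) ^ (1 - α - δ) := by
      rw [← Real.mul_rpow (by norm_num) hhn0.le]
      congr 1; push_cast; ring
    have h3 : (1 + ((j + s : ℕ) : ℝ) / n) ^ δ ≤ 4 := by
      have : 1 + ((j + s : ℕ) : ℝ) / n ≤ 4 := by
        have : ((j + s : ℕ) : ℝ) ≤ 3 * n := by exact_mod_cast (by omega : j + s ≤ 3 * n)
        rw [← le_sub_iff_add_le', div_le_iff₀ hn0]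
        linarith
      calc _ ≤ (4 : ℝ) ^ δ := by gcongr
        _ ≤ (4 : ℝ) ^ (1 : ℝ) := Real.rpow_le_rpow_of_exponent_le (by norm_num) hδ1
        _ = 4 := Real.rpow_one 4
    rw [h2] at h1
    rw [← sq_abs]
    have e : ((h : ℝ) / n) ^ (2 - 2 * α - 2 * δ) = (((h : ℝ) / n) ^ (1 - α - δ)) ^ 2 := by
      rw [← Real.rpow_natCast, ← Real.rpow_mul hhn0.le]; congr 1; push_cast; ring
    rw [e]
    calc _ ≤ (C1 * (n * a n) * (2 ^ (1 - α - δ) * ((h : ℝ) / n) ^ (1 - α - δ))) ^ 2 * 4 := by gcongr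
      _ = _ := by ring
  -- the other ones, for which the majorant of `a` is monotone on the window
  have hfar : ∀ j : ℕ, ENNReal.ofReal (D (j + 2 * h + s) ^ 2 *
      (1 + ((j + 2 * h + s : ℕ) : ℝ) / n) ^ δ) ≤ ENNReal.ofReal
        (64 * C ^ 2 * (a n * h) ^ 2 * ((h : ℝ) / n) ^ (-(2 * α + 2 * δ)) *
          (1 + (j : ℝ) / h) ^ (-(2 * α - 3 * δ))) := by
    intro j
    refine ENNReal.ofReal_le_ofReal ?_
    set v : ℝ := ((h : ℝ) + j) / n with hv
    have hv0 : 0 < v := by positivity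
    have h1 : |D (j + 2 * h + s)| ≤ h * (C * a n * potterMajorant α δ v) := by
      refine (abs_sumCoeff_sub_le a hkh (j + 2 * h)).trans ?_
      have hcard : (Finset.Ico (j + 2 * h + 1 - h) (j + 2 * h + 1)).card = h := by
        rw [Nat.card_Ico]; omega
      refine (Finset.sum_le_card_nsmul _ _ (C * a n * potterMajorant α δ v) fun i hi => ?_).trans
        (le_of_eq ?_)
      · rw [Finset.mem_Ico] at hi
        refine (ha.bound n hn i).trans ?_
        refine mul_le_mul_of_nonneg_left (potterMajorant_anti hδ0.le hsm.le_alpha hv0 ?_)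
          (by positivity)
        have : (h : ℝ) + j ≤ i := by exact_mod_cast (by omega : h + j ≤ i)
        rw [hv]
        exact div_le_div_of_nonneg_right (by linarith) hn0.le
      · rw [hcard, nsmul_eq_mul]
    have h3 : (1 + ((j + 2 * h + s : ℕ) : ℝ) / n) ^ δ ≤ 4 * (1 + v ^ δ) := by
      have h4 : 1 + ((j + 2 * h + s : ℕ) : ℝ) / n ≤ 4 * max 1 v := by
        have : ((j + 2 * h + s : ℕ) : ℝ) / n = v + (h : ℝ) / n + (s : ℝ) / n := by
          rw [hv]; push_cast; field_simp; ring
        rw [this]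
        have h5 : (s : ℝ) / n ≤ 1 := (div_le_one hn0).2 hsn
        linarith [le_max_left 1 v, le_max_right 1 v]
      have h6 : (max 1 v) ^ δ ≤ 1 + v ^ δ := by
        have : 0 ≤ v ^ δ := by positivity
        rcases le_total 1 v with h | h
        · rw [max_eq_right h]; linarith
        · rw [max_eq_left h, Real.one_rpow]; linarith
      calc _ ≤ (4 * max 1 v) ^ δ := by gcongr
        _ = 4 ^ δ * (max 1 v) ^ δ := Real.mul_rpow (by norm_num) (by positivity)
        _ ≤ 4 ^ (1 : ℝ) * (1 + v ^ δ) := by gcongr; norm_num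
        _ = _ := by rw [Real.rpow_one]
    have hvh : v = (h : ℝ) / n * (1 + (j : ℝ) / h) := by rw [hv]; field_simp
    have hw1 : (1 : ℝ) ≤ 1 + (j : ℝ) / h := by linarith [show 0 ≤ (j : ℝ) / h by positivity]
    have h7 : v ^ (-(2 * α - 3 * δ)) + v ^ (-(2 * α + 2 * δ)) ≤
        2 * (((h : ℝ) / n) ^ (-(2 * α + 2 * δ)) * (1 + (j : ℝ) / h) ^ (-(2 * α - 3 * δ))) := by
      rw [hvh, Real.mul_rpow hhn0.le (by positivity), Real.mul_rpow hhn0.le (by positivity),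
        two_mul (((h : ℝ) / n) ^ _ * _)]
      refine add_le_add (mul_le_mul_of_nonneg_right ?_ (by positivity))
        (mul_le_mul_of_nonneg_left ?_ (by positivity))
      · exact Real.rpow_le_rpow_of_exponent_ge hhn0 hhn (by linarith)
      · exact Real.rpow_le_rpow_of_exponent_le hw1 (by linarith)
    have h8 := potterMajorant_sq_mul_le (α := α) hδ0.le hv0
    have hP := potterMajorant_nonneg (α := α) (δ := δ) hv0.le
    calc _ ≤ (h * (C * a n * potterMajorant α δ v)) ^ 2 * (4 * (1 + v ^ δ)) := by
          rw [← sq_abs]; gcongr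
      _ = 4 * C ^ 2 * (a n * h) ^ 2 * (potterMajorant α δ v ^ 2 * (1 + v ^ δ)) := by ring
      _ ≤ 4 * C ^ 2 * (a n * h) ^ 2 * (8 * (2 * (((h : ℝ) / n) ^ (-(2 * α + 2 * δ)) *
          (1 + (j : ℝ) / h) ^ (-(2 * α - 3 * δ))))) :=
          mul_le_mul_of_nonneg_left (h8.trans (by gcongr)) (by positivity)
      _ = _ := by ring
  obtain ⟨hsum, hle⟩ := hKs h hh
  calc _ ≤ ∑ j ∈ Finset.range (2 * h), ENNReal.ofReal
          (4 * (C1 * 2 ^ (1 - α - δ)) ^ 2 * ((n * a n) ^ 2 * ((h : ℝ) / n) ^ (2 - 2 * α - 2 * δ))) +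
        ∑' j : ℕ, ENNReal.ofReal (64 * C ^ 2 * (a n * h) ^ 2 * ((h : ℝ) / n) ^ (-(2 * α + 2 * δ)) *
          (1 + (j : ℝ) / h) ^ (-(2 * α - 3 * δ))) :=
        add_le_add (Finset.sum_le_sum hnear) (ENNReal.tsum_le_tsum hfar)
    _ ≤ ENNReal.ofReal (8 * (C1 * 2 ^ (1 - α - δ)) ^ 2 * n * (n * a n) ^ 2 *
          ((h : ℝ) / n) ^ (3 - 2 * α - 2 * δ)) +
        ENNReal.ofReal (64 * C ^ 2 * K * n * (n * a n) ^ 2 *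
          ((h : ℝ) / n) ^ (3 - 2 * α - 2 * δ)) := by
        refine add_le_add (le_of_eq ?_) ?_
        · rw [Finset.sum_const, Finset.card_range, nsmul_eq_mul, ← ENNReal.ofReal_natCast,
            ← ENNReal.ofReal_mul (by positivity)]
          congr 1
          have e : ((h : ℝ) / n) ^ (3 - 2 * α - 2 * δ) =
              ((h : ℝ) / n) ^ (2 - 2 * α - 2 * δ) * ((h : ℝ) / n) := by
            rw [← Real.rpow_add_one hhn0.ne']; congr 1; ring
          rw [e]
          push_cast
          field_simp
          norm_num
        · rw [← ENNReal.ofReal_tsum_of_nonneg (fun j => by positivity) (hsum.mul_left _),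
            tsum_mul_left]
          refine ENNReal.ofReal_le_ofReal ?_
          have e : ((h : ℝ) / n) ^ (3 - 2 * α - 2 * δ) =
              ((h : ℝ) / n) ^ (-(2 * α + 2 * δ)) * ((h : ℝ) / n) ^ 3 := by
            rw [← Real.rpow_natCast, ← Real.rpow_add hhn0]; congr 1; push_cast; ring
          rw [e]
          calc _ ≤ 64 * C ^ 2 * (a n * h) ^ 2 * ((h : ℝ) / n) ^ (-(2 * α + 2 * δ)) * (K * h) := by
                gcongr
            _ = _ := by field_simp
    _ = _ := by
        rw [← ENNReal.ofReal_add (by positivity) (by positivity)]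
        congr 1; ring

/-! ### The modulus of continuity of the partial sums -/

section Modulus

variable {Ω : Type*} [MeasurableSpace Ω] {P : Measure Ω} [IsProbabilityMeasure P] {ε : ℤ → Ω → ℝ}
  {a : ℕ → ℝ} {α δ C : ℝ} {N : ℕ}

/-- The sum of the absolute values of the coefficients of `X_1, …, X_n` on `ε_{n-r}`. -/
noncomputable def totalCoeff (a : ℕ → ℝ) (n r : ℕ) : ℝ :=
  ∑ d ∈ Finset.range n, |shiftCoeff a d r|

theorem totalCoeff_nonneg (a : ℕ → ℝ) (n r : ℕ) : 0 ≤ totalCoeff a n r :=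
  Finset.sum_nonneg fun _ _ => abs_nonneg _

/-- The partial sum `S_m`, computed with the truncated innovations. -/
noncomputable def coreSum (ε : ℤ → Ω → ℝ) (P : Measure Ω) (a : ℕ → ℝ) (η : ℝ) (n m : ℕ) (ω : Ω) : ℝ :=
  coreSeries ε P (growingLevel η n) n (sumCoeff a n m) ω

namespace IsCenteredDANInnovation

variable (hε : IsCenteredDANInnovation ε P)

include hε

theorem ae_tendsto_coreSum (hsm : IsSmallExponent α δ) (ha : IsPotterSequence a α δ C N) {κ : ℝ}
    {n : ℕ} {η : ℝ}
    (hsc : IsTruncScale (truncSecondMoment (ε 0) P) (tailFirstMoment (ε 0) P) δ κ n η) (hn : N ≤ n)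
    {m : ℕ} (hm : m ≤ n) :
    ∀ᵐ ω ∂P, Tendsto (fun M => ∑ r ∈ Finset.range M,
      sumCoeff a n m r * coreInnovation ε P (growingLevel η n) n r ω) atTop
      (𝓝 (coreSum ε P a η n m ω)) := by
  obtain ⟨G, hG, hb⟩ := ha.exists_sum_abs_shiftCoeff_le hsm.pos hsm.le_alpha hsm.add_lt_one
  exact hε.ae_tendsto_coreSeries n (fun r => (hsc.growingLevel_pos r).le)
    (hsc.tsum_core_ne_top hsm.one_lt_core fun r => (abs_sumCoeff_le a hm r).trans (hb n hn r))

/-- The partial sums `S_m`, `m ≤ n`, differ from those of the truncated innovations by at most one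
common variable. -/
theorem ae_linearSum_eq (hsm : IsSmallExponent α δ) (ha : IsPotterSequence a α δ C N) {κ : ℝ}
    (hκ : 0 ≤ κ) {n : ℕ} {η : ℝ}
    (hsc : IsTruncScale (truncSecondMoment (ε 0) P) (tailFirstMoment (ε 0) P) δ κ n η)
    (hn : N ≤ n) :
    ∀ᵐ ω ∂P, ∀ m ≤ n, ENNReal.ofReal |linearSum a ε m ω - coreSum ε P a η n m ω| ≤
      restBound ε P (growingLevel η n) n (totalCoeff a n) ω := by
  obtain ⟨G, hG, hb⟩ := ha.exists_sum_abs_shiftCoeff_le hsm.pos hsm.le_alpha hsm.add_lt_one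
  obtain ⟨K', -, hK'⟩ := IsTruncScale.exists_tsum_tail_le hsm.one_lt_tail
  have han := ha.pos n hn
  have hsplit : ∀ᵐ ω ∂P, ∀ m, m ≤ n → ∃ v : ℝ,
      Tendsto (fun M => ∑ r ∈ Finset.range M, sumCoeff a n m r * ε ((n : ℤ) - r) ω) atTop
        (𝓝 (coreSum ε P a η n m ω + v)) ∧
      ENNReal.ofReal |v| ≤ restBound ε P (growingLevel η n) n (sumCoeff a n m) ω := by
    rw [ae_all_iff]
    intro m
    by_cases hm : m ≤ n
    swap
    · exact Eventually.of_forall fun ω h => absurd h hm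
    have hc : ∀ r, |sumCoeff a n m r| ≤ G * (n * a n) * (1 + (r : ℝ) / n) ^ (-(α - δ)) := fun r =>
      (abs_sumCoeff_le a hm r).trans (hb n hn r)
    filter_upwards [hε.ae_tendsto_series n (fun r => (hsc.growingLevel_pos r).le)
      (hsc.tsum_core_ne_top hsm.one_lt_core hc)
      (ne_top_of_le_ne_top ENNReal.ofReal_ne_top (hK' hκ hsc (by positivity) hc))] with ω h _
    exact h
  filter_upwards [hsplit, hε.ae_tendsto_linearSum hsm ha hκ hsc hn] with ω h1 h2 m hm
  obtain ⟨v, hv, hvb⟩ := h1 m hm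
  rw [tendsto_nhds_unique (h2 m hm) hv, add_sub_cancel_left]
  refine hvb.trans (ENNReal.tsum_le_tsum fun r => ENNReal.ofReal_le_ofReal ?_)
  refine mul_le_mul_of_nonneg_right ?_ (abs_nonneg _)
  rw [abs_of_nonneg (totalCoeff_nonneg a n r)]
  exact abs_sumCoeff_le a hm r

theorem exists_lintegral_sq_coreSum_sub_le (hsm : IsSmallExponent α δ)
    (ha : IsPotterSequence a α δ C N) : ∃ K : ℝ, 0 < K ∧ ∀ {κ : ℝ} {n : ℕ} {η : ℝ},
    IsTruncScale (truncSecondMoment (ε 0) P) (tailFirstMoment (ε 0) P) δ κ n η → N ≤ n →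
    ∀ k h : ℕ, k + h ≤ n →
      ∫⁻ ω, ENNReal.ofReal ((coreSum ε P a η n (k + h) ω - coreSum ε P a η n k ω) ^ 2) ∂P ≤
        ENNReal.ofReal (K * ((n * a n) ^ 2 * (n * truncSecondMoment (ε 0) P η)) *
          ((n : ℝ) ^ (3 - 2 * α - 2 * δ))⁻¹ * (h : ℝ) ^ (3 - 2 * α - 2 * δ)) := by
  obtain ⟨K, hK, hKb⟩ := ha.exists_tsum_increment_le hsm
  refine ⟨2 * K, by positivity, ?_⟩
  intro κ n η hsc hn k h hkh
  have hl := hsc.pos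
  have hn0 : (0 : ℝ) < n := Nat.cast_pos.2 hsc.n_pos
  rcases Nat.eq_zero_or_pos h with rfl | hh
  · simp
  have hlim : ∀ᵐ ω ∂P, Tendsto (fun M => ∑ r ∈ Finset.range M,
      (sumCoeff a n (k + h) r - sumCoeff a n k r) * coreInnovation ε P (growingLevel η n) n r ω) atTop
      (𝓝 (coreSum ε P a η n (k + h) ω - coreSum ε P a η n k ω)) := by
    filter_upwards [hε.ae_tendsto_coreSum hsm ha hsc hn hkh,
      hε.ae_tendsto_coreSum hsm ha hsc hn (m := k) (by omega)] with ω h1 h2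
    refine (h1.sub h2).congr fun M => ?_
    simp only [sub_mul, Finset.sum_sub_distrib]
  refine (lintegral_sq_limit_le (hε.measurable_coreInnovation n) (hε.iIndepFun_coreInnovation n)
    (hε.memLp_coreInnovation n fun r => (hsc.growingLevel_pos r).le) (hε.integral_coreInnovation n)
    (hε.integral_sq_coreInnovation_le n) hlim).trans ?_
  calc _ ≤ ∑' r : ℕ, ENNReal.ofReal (2 * truncSecondMoment (ε 0) P η) *
        ENNReal.ofReal ((sumCoeff a n (k + h) r - sumCoeff a n k r) ^ 2 *
        (1 + (r : ℝ) / n) ^ δ) := by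
        refine ENNReal.tsum_le_tsum fun r => ?_
        rw [← ENNReal.ofReal_mul (by positivity)]
        refine ENNReal.ofReal_le_ofReal ?_
        calc _ ≤ (sumCoeff a n (k + h) r - sumCoeff a n k r) ^ 2 *
              (2 * truncSecondMoment (ε 0) P η * (1 + (r : ℝ) / n) ^ δ) := by
              gcongr; exact hsc.core r
          _ = _ := by ring
    _ ≤ ENNReal.ofReal (2 * truncSecondMoment (ε 0) P η) *
        ENNReal.ofReal (K * n * (n * a n) ^ 2 * ((h : ℝ) / n) ^ (3 - 2 * α - 2 * δ)) := by
        rw [ENNReal.tsum_mul_left]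
        gcongr
        exact hKb n hn k h hh hkh
    _ = _ := by
        rw [← ENNReal.ofReal_mul (by positivity), Real.div_rpow (by positivity) hn0.le]
        congr 1
        field_simp

/-- With high probability, the partial sums vary little over each of `M` blocks of equal length, if
`M` is large. -/
theorem eventually_modulus_le (hsm : IsSmallExponent α δ) (ha : IsPotterSequence a α δ C N)
    {θ ρ : ℝ} (hθ : 0 < θ) (hρ : 0 < ρ) :
    ∀ᶠ M : ℕ in atTop, ∀ᶠ n : ℕ in atTop, ∃ B : Set Ω, P B ≤ ENNReal.ofReal ρ ∧ ∀ᵐ ω ∂P, ω ∉ B →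
      ∀ j < M, ∀ k : ℕ, n * j / M ≤ k → k ≤ n → k * M ≤ n * (j + 1) →
        |linearSum a ε k ω - linearSum a ε (n * j / M) ω| ≤
          θ * (n * a n * innovationScale ε P n) := by
  obtain ⟨G, hG, hGb⟩ := ha.exists_sum_abs_shiftCoeff_le hsm.pos hsm.le_alpha hsm.add_lt_one
  obtain ⟨K1, hK1, hK1b⟩ := IsTruncScale.exists_tsum_tail_le hsm.one_lt_tail
  obtain ⟨K2, hK2, hK2b⟩ := hε.exists_lintegral_sq_coreSum_sub_le hsm ha
  set γ := 3 - 2 * α - 2 * δ with hγdef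
  have hγ : 1 < γ := by linarith [hsm.pos, hsm.upper]
  obtain ⟨K3, hK3, hK3b⟩ := exists_measure_dyadic_le hγ
  -- `κ` makes the removed parts, whose mean is at most `K1 κ G (n a_n Q)`, negligible.
  set κ := ρ * θ / (8 * (K1 * G)) with hκdef
  have hκ : 0 < κ := by positivity
  -- The probability bound for one block is of order `M ^ (-γ)`; there are `M` blocks, and `γ > 1`.
  have hlim : Tendsto (fun M : ℕ => K3 * K2 * 4 ^ γ / (θ / 2) ^ 2 * (M : ℝ) ^ (-(γ - 1))) atTop
      (𝓝 0) := by
    have h := (tendsto_rpow_neg_atTop (show 0 < γ - 1 by linarith)).comp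
      (tendsto_natCast_atTop_atTop (R := ℝ))
    simpa using h.const_mul (K3 * K2 * 4 ^ γ / (θ / 2) ^ 2)
  filter_upwards [hlim.eventually_lt_const (half_pos hρ), eventually_gt_atTop 0] with M hM hM0
  filter_upwards [hε.eventually_isTruncScale hsm.pos hκ, eventually_ge_atTop N,
    eventually_ge_atTop M] with n hsc hn hnM
  set η := truncLevel (truncSecondMoment (ε 0) P) n
  have hn0 : (0 : ℝ) < n := Nat.cast_pos.2 hsc.n_pos
  have hM0' : (0 : ℝ) < M := Nat.cast_pos.2 hM0
  have han := ha.pos n hn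
  have hl := hsc.pos
  set Q := innovationScale ε P n with hQ
  have hQ0 : 0 < Q := Real.sqrt_pos.2 hsc.scale_pos
  have hQ2 : Q ^ 2 = n * truncSecondMoment (ε 0) P η := Real.sq_sqrt hsc.scale_pos.le
  set q := n * a n * Q with hq
  have hq0 : 0 < q := by positivity
  -- A dyadic length exceeding the length of the blocks, and comparable with it.
  obtain ⟨p0, hp0, hp1⟩ := exists_nat_pow_near (Nat.le_add_left 1 (n / M)) (one_lt_two (α := ℕ))
  set p := p0 + 1
  have hp2 : 2 ^ p ≤ 2 * (n / M + 1) := by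
    change 2 ^ (p0 + 1) ≤ _
    rw [pow_succ]; omega
  have hp3 : (2 : ℝ) ^ p ≤ 4 * n / M := by
    have h1 : ((n / M : ℕ) : ℝ) ≤ n / M := Nat.cast_div_le
    have h2 : (1 : ℝ) ≤ n / M := (one_le_div hM0').2 (by exact_mod_cast hnM)
    have h3 : (2 : ℝ) ^ p ≤ 2 * ((n / M : ℕ) + 1) := by exact_mod_cast hp2
    rw [mul_div_assoc]
    linarith
  -- The process over the `j`th block, stopped at time `n`.
  let X : ℕ → ℕ → Ω → ℝ := fun j i => coreSum ε P a η n (min (n * j / M + i) n)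
  have hXm : ∀ j i, AEMeasurable (X j i) P := fun j i =>
    aemeasurable_of_tendsto_metrizable_ae atTop (fun m => (Finset.measurable_sum _ fun r _ =>
      (hε.measurable_coreInnovation n r).const_mul _).aemeasurable)
      (hε.ae_tendsto_coreSum hsm ha hsc hn (min_le_right _ _))
  set A := K2 * ((n * a n) ^ 2 * (n * truncSecondMoment (ε 0) P η)) * ((n : ℝ) ^ γ)⁻¹ with hA
  have hA0 : 0 ≤ A := by positivity
  have hXinc : ∀ j k h : ℕ, ∫⁻ ω, ENNReal.ofReal ((X j (k + h) ω - X j k ω) ^ 2) ∂P ≤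
      ENNReal.ofReal (A * (h : ℝ) ^ γ) := by
    intro j k h
    obtain ⟨h', hh', he⟩ : ∃ h' ≤ h, min (n * j / M + (k + h)) n = min (n * j / M + k) n + h' :=
      ⟨min (n * j / M + (k + h)) n - min (n * j / M + k) n, by omega, by omega⟩
    simp only [X]
    rw [he]
    refine (hK2b hsc hn _ h' (by omega)).trans (ENNReal.ofReal_le_ofReal ?_)
    gcongr
  have hblock : ∀ j, P {ω | ∃ k ≤ 2 ^ p, θ / 2 * q < |X j k ω - X j 0 ω|} ≤
      ENNReal.ofReal (K3 * K2 * 4 ^ γ / (θ / 2) ^ 2 * (M : ℝ) ^ (-γ)) := by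
    intro j
    refine (hK3b (hXm j) hA0 (show 0 < θ / 2 * q by positivity) (hXinc j)).trans
      (ENNReal.ofReal_le_ofReal ?_)
    have h1 : ((2 : ℝ) ^ p) ^ γ ≤ 4 ^ γ * n ^ γ * (M : ℝ) ^ (-γ) := by
      calc ((2 : ℝ) ^ p) ^ γ ≤ (4 * n / M) ^ γ := by gcongr
        _ = _ := by
          rw [Real.div_rpow (by positivity) hM0'.le, Real.mul_rpow (by norm_num) hn0.le,
            Real.rpow_neg hM0'.le, div_eq_mul_inv]
    have hnγ : (0 : ℝ) < (n : ℝ) ^ γ := by positivity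
    calc _ ≤ K3 * A * (4 ^ γ * n ^ γ * (M : ℝ) ^ (-γ)) / (θ / 2 * q) ^ 2 := by gcongr
      _ = _ := by
        rw [hA, ← hQ2, hq]
        field_simp
  have hfar : ∫⁻ ω, restBound ε P (growingLevel η n) n (totalCoeff a n) ω ∂P ≤
      ENNReal.ofReal (K1 * κ * (G * (n * a n)) * Q) := by
    refine (hε.lintegral_restBound_le n _).trans (hK1b hκ.le hsc (by positivity) fun r => ?_)
    rw [abs_of_nonneg (totalCoeff_nonneg a n r)]
    exact hGb n hn r
  refine ⟨(⋃ j ∈ Finset.range M, {ω | ∃ k ≤ 2 ^ p, θ / 2 * q < |X j k ω - X j 0 ω|}) ∪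
    {ω | ENNReal.ofReal (θ / 4 * q) < restBound ε P (growingLevel η n) n (totalCoeff a n) ω}, ?_, ?_⟩
  · refine (measure_union_le _ _).trans ((add_le_add ((measure_biUnion_finset_le _ _).trans
      (Finset.sum_le_sum fun j _ => hblock j)) (measure_lt_le_lintegral_div
      (hε.measurable_restBound n _).aemeasurable hfar
      (show 0 < θ / 4 * q by positivity))).trans ?_)
    rw [Finset.sum_const, Finset.card_range, nsmul_eq_mul, ← ENNReal.ofReal_natCast,
      ← ENNReal.ofReal_mul (by positivity), ← ENNReal.ofReal_add (by positivity) (by positivity)]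
    refine ENNReal.ofReal_le_ofReal ?_
    have e1 : (M : ℝ) * (K3 * K2 * 4 ^ γ / (θ / 2) ^ 2 * (M : ℝ) ^ (-γ)) =
        K3 * K2 * 4 ^ γ / (θ / 2) ^ 2 * (M : ℝ) ^ (-(γ - 1)) := by
      rw [show -(γ - 1) = -γ + 1 by ring, Real.rpow_add_one hM0'.ne']; ring
    have e2 : K1 * κ * (G * (n * a n)) * Q / (θ / 4 * q) = ρ / 2 := by
      rw [hκdef, hq]; field_simp; norm_num
    rw [e1, e2]
    linarith
  · filter_upwards [hε.ae_linearSum_eq hsm ha hκ.le hsc hn] with ω h1 hω j hj k hk1 hk2 hk3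
    rw [Set.mem_union, not_or] at hω
    obtain ⟨hω1, hω2⟩ := hω
    have hω2 : restBound ε P (growingLevel η n) n (totalCoeff a n) ω ≤ ENNReal.ofReal (θ / 4 * q) :=
      not_lt.1 hω2
    have hrest : ∀ m ≤ n, |linearSum a ε m ω - coreSum ε P a η n m ω| ≤ θ / 4 * q := fun m hm =>
      (ENNReal.ofReal_le_ofReal_iff (by positivity)).1 ((h1 m hm).trans hω2)
    have hkj : k ≤ n * j / M + (n / M + 1) := by
      have h2 : k ≤ n * (j + 1) / M := (Nat.le_div_iff_mul_le hM0).2 hk3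
      refine h2.trans ?_
      rw [Nat.div_le_iff_le_mul_add_pred hM0]
      have h3 := Nat.div_add_mod (n * j) M
      have h4 := Nat.div_add_mod n M
      have h5 := Nat.mod_lt (n * j) hM0
      have h6 := Nat.mod_lt n hM0
      rw [mul_add, mul_add, mul_one, mul_add, mul_one]
      omega
    have hcore : |coreSum ε P a η n k ω - coreSum ε P a η n (n * j / M) ω| ≤ θ / 2 * q := by
      by_contra hc
      refine hω1 (Set.mem_biUnion (Finset.mem_coe.2 (Finset.mem_range.2 hj)) ?_)
      refine ⟨k - n * j / M, by omega, ?_⟩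
      simp only [X]
      rw [add_zero, Nat.add_sub_cancel' hk1, min_eq_left hk2, min_eq_left (hk1.trans hk2)]
      exact not_le.1 hc
    have e : linearSum a ε k ω - linearSum a ε (n * j / M) ω =
        (linearSum a ε k ω - coreSum ε P a η n k ω) +
        (coreSum ε P a η n k ω - coreSum ε P a η n (n * j / M) ω) -
        (linearSum a ε (n * j / M) ω - coreSum ε P a η n (n * j / M) ω) := by ring
    rw [e]
    refine (abs_sub _ _).trans ((add_le_add (abs_add_le _ _) le_rfl).trans ?_)
    have h2 := hrest k hk2
    have h3 := hrest _ (hk1.trans hk2)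
    linarith

end IsCenteredDANInnovation

end Modulus

/-! ### Approximation in the Skorokhod space -/

namespace SkorokhodD

theorem ext_of_forall {f g : SkorokhodD} (h : ∀ t, f t = g t) : f = g := by
  cases f
  cases g
  congr
  exact funext h

/-- The Skorokhod distance is at most the uniform distance: take the identity time change. -/
theorem edist_le_of_forall {f g : SkorokhodD} {θ : ℝ≥0∞} (h : ∀ t, edist (f t) (g t) ≤ θ) :
    edist f g ≤ θ := by
  refine (iInf_le _ (OrderIso.refl I)).trans ?_
  simpa [cost] using h

theorem lipschitzWith_const_smul (c : ℝ) :
    LipschitzWith (max 1 ‖c‖₊) (fun f : SkorokhodD => c • f) := by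
  intro f g
  change (⨅ e : I ≃o I, cost (c • f) (c • g) e) ≤ _ * ⨅ e : I ≃o I, cost f g e
  rw [ENNReal.mul_iInf_of_ne (by simp) ENNReal.coe_ne_top]
  refine le_iInf fun e => iInf_le_of_le e ?_
  unfold cost
  refine max_le (iSup_le fun t => ?_) (iSup_le fun t => ?_)
  · calc edist (e t) t ≤ 1 * edist (e t) t := by rw [one_mul]
      _ ≤ _ := by
        gcongr
        · exact_mod_cast le_max_left _ _
        · exact le_max_of_le_left (le_iSup (fun t => edist (e t) t) t)
  · calc edist ((c • f) t) ((c • g) (e t)) = ‖c‖₊ * edist (f t) (g (e t)) := by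
          change edist (c * f t) (c * g (e t)) = _
          rw [← smul_eq_mul, ← smul_eq_mul, edist_smul₀]
          rfl
      _ ≤ _ := by
        gcongr
        · exact_mod_cast le_max_right _ _
        · exact le_max_of_le_right (le_iSup (fun t => edist (f t) (g (e t))) t)

theorem continuous_const_smul (c : ℝ) : Continuous (fun f : SkorokhodD => c • f) :=
  (lipschitzWith_const_smul c).continuous

theorem floor_mul_le (n : ℕ) (t : I) : ⌊(n : ℝ) * (t : ℝ)⌋₊ ≤ n := by
  refine Nat.floor_le_of_le ?_
  exact mul_le_of_le_one_right (Nat.cast_nonneg n) t.2.2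

/-- The path `t ↦ v_{[nt]}` attached to finitely many values `v_0, …, v_n`. -/
noncomputable def finStepPath (n : ℕ) (v : Fin (n + 1) → ℝ) : SkorokhodD :=
  stepPath (fun m => if h : m < n + 1 then v ⟨m, h⟩ else 0) n

theorem finStepPath_apply (n : ℕ) (v : Fin (n + 1) → ℝ) (t : I) :
    finStepPath n v t = v ⟨⌊(n : ℝ) * (t : ℝ)⌋₊, Nat.lt_succ_of_le (floor_mul_le n t)⟩ := by
  change (if h : _ < n + 1 then _ else _) = _
  rw [dif_pos]

theorem stepPath_eq_finStepPath (s : ℕ → ℝ) (n : ℕ) :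
    stepPath s n = finStepPath n fun k => s k :=
  ext_of_forall fun t => by
    rw [finStepPath_apply]
    rfl

theorem continuous_finStepPath (n : ℕ) : Continuous (finStepPath n) := by
  have : LipschitzWith 1 (finStepPath n) := by
    intro v w
    rw [ENNReal.coe_one, one_mul]
    refine edist_le_of_forall fun t => ?_
    rw [finStepPath_apply, finStepPath_apply]
    exact edist_le_pi_edist v w _
  exact this.continuous

theorem aemeasurable_stepPath {Ω : Type*} [MeasurableSpace Ω] {P : Measure Ω} {s : Ω → ℕ → ℝ}
    (hs : ∀ m, AEMeasurable (fun ω => s ω m) P) (n : ℕ) :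
    AEMeasurable (fun ω => stepPath (s ω) n) P := by
  simp_rw [stepPath_eq_finStepPath]
  exact (continuous_finStepPath n).measurable.comp_aemeasurable
    (aemeasurable_pi_lambda _ fun k => hs k)

/-- A step path with `n` steps is close to its restriction to a coarser grid of mesh `1 / M` if the
underlying sequence varies little over each cell of the coarser grid. -/
theorem edist_stepPath_stepPath_le {y : ℕ → ℝ} {n M : ℕ} (hM : 0 < M) {θ : ℝ}
    (h : ∀ j < M, ∀ k, n * j / M ≤ k → k ≤ n → k * M ≤ n * (j + 1) →
      |y k - y (n * j / M)| ≤ θ) :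
    edist (stepPath y n) (stepPath (fun j => y (n * j / M)) M) ≤ ENNReal.ofReal θ := by
  refine edist_le_of_forall fun t => ?_
  change edist (y ⌊(n : ℝ) * (t : ℝ)⌋₊) (y (n * ⌊(M : ℝ) * (t : ℝ)⌋₊ / M)) ≤ _
  have hM' : (0 : ℝ) < M := Nat.cast_pos.2 hM
  rcases eq_or_lt_of_le t.2.2 with ht | ht
  · rw [ht, mul_one, mul_one, Nat.floor_natCast, Nat.floor_natCast, Nat.mul_div_cancel _ hM,
      edist_self]
    exact zero_le
  rw [edist_dist, Real.dist_eq]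
  have hMt : (0 : ℝ) ≤ M * t := mul_nonneg hM'.le t.2.1
  have hj := Nat.floor_le hMt
  have hj' := Nat.lt_floor_add_one ((M : ℝ) * t)
  have hk := Nat.floor_le (mul_nonneg (Nat.cast_nonneg n) t.2.1)
  refine ENNReal.ofReal_le_ofReal (h _ ?_ _ ?_ (floor_mul_le n t) ?_)
  · rw [Nat.floor_lt hMt]
    nlinarith
  · refine Nat.le_floor ?_
    refine Nat.cast_div_le.trans ?_
    rw [div_le_iff₀ hM', Nat.cast_mul]
    nlinarith [Nat.cast_nonneg (α := ℝ) n]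
  · have : ((⌊(n : ℝ) * (t : ℝ)⌋₊ * M : ℕ) : ℝ) ≤ ((n * (⌊(M : ℝ) * (t : ℝ)⌋₊ + 1) : ℕ) : ℝ) := by
      push_cast
      have h1 := mul_le_mul_of_nonneg_right hk hM'.le
      have h2 := mul_le_mul_of_nonneg_left hj'.le (Nat.cast_nonneg (α := ℝ) n)
      linarith
    exact_mod_cast this

/-- The grid point `j / M` of `[0,1]` (for `j ≤ M`). -/
noncomputable def gridPoint (M j : ℕ) : I := Set.projIcc 0 1 zero_le_one ((j : ℝ) / M)

theorem coe_gridPoint {M j : ℕ} (h : j ≤ M) : (gridPoint M j : ℝ) = j / M := by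
  unfold gridPoint
  rw [Set.projIcc_of_mem]
  exact ⟨by positivity, div_le_one_of_le₀ (by exact_mod_cast h) (by positivity)⟩

/-- A continuous path is the limit of its discretizations. -/
theorem tendsto_stepPath_gridPoint {f : SkorokhodD} (hf : Continuous f.toFun) :
    Tendsto (fun M => stepPath (fun j => f (gridPoint M j)) M) atTop (𝓝 f) := by
  rw [EMetric.tendsto_atTop]
  intro θ hθ
  obtain ⟨θ', hθ', hθ2⟩ := exists_between hθ
  obtain ⟨d, hd, hd'⟩ := EMetric.uniformContinuous_iff.1
    (CompactSpace.uniformContinuous_of_continuous hf) θ' hθ'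
  obtain ⟨e, he0, he⟩ : ∃ e : ℝ, 0 < e ∧ ENNReal.ofReal e ≤ d := by
    rcases eq_or_ne d ∞ with rfl | hdt
    · exact ⟨1, one_pos, le_top⟩
    · exact ⟨d.toReal, ENNReal.toReal_pos hd.ne' hdt, (ENNReal.ofReal_toReal hdt).le⟩
  obtain ⟨M₀, hM₀⟩ := exists_nat_gt (1 / e)
  refine ⟨M₀, fun M hM => (edist_le_of_forall fun t => ?_).trans_lt hθ2⟩
  have hMe : 1 / e < M := hM₀.trans_le (by exact_mod_cast hM)
  have hM' : (0 : ℝ) < M := lt_trans (by positivity) hMe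
  have hMt : (0 : ℝ) ≤ M * t := mul_nonneg hM'.le t.2.1
  refine (hd' (a := gridPoint M ⌊(M : ℝ) * t⌋₊) (b := t) (lt_of_lt_of_le ?_ he)).le
  rw [edist_dist, ENNReal.ofReal_lt_ofReal_iff he0, Subtype.dist_eq, Real.dist_eq,
    coe_gridPoint (floor_mul_le M t)]
  have h1 := Nat.floor_le hMt
  have h2 := Nat.lt_floor_add_one ((M : ℝ) * t)
  have h3 : (⌊(M : ℝ) * t⌋₊ : ℝ) / M - t = (⌊(M : ℝ) * t⌋₊ - M * t) / M := by field_simp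
  rw [h3, abs_div, abs_of_pos hM', div_lt_iff₀ hM', abs_lt]
  have h4 : 1 < e * M := by rw [div_lt_iff₀ he0] at hMe; linarith
  constructor <;> linarith

end SkorokhodD

/-- Converging together: if `Y n` is approximated, up to events of small probability and uniformly
for large `n`, by sequences that converge in distribution to `Z M`, and `Z M → Z`, then `Y n`
converges in distribution to `Z`. -/
theorem tendstoInDistribution_of_approx {Ω Ω' E : Type*} [MeasurableSpace Ω] [MeasurableSpace Ω']
    {P : Measure Ω} {P' : Measure Ω'} [IsProbabilityMeasure P] [IsProbabilityMeasure P']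
    [PseudoEMetricSpace E] [MeasurableSpace E] [BorelSpace E]
    {Y : ℕ → Ω → E} {Z : Ω' → E} {YM : ℕ → ℕ → Ω → E} {ZM : ℕ → Ω' → E}
    (hY : ∀ n, AEMeasurable (Y n) P) (hZ : AEMeasurable Z P')
    (hM : ∀ M, TendstoInDistribution (YM M) atTop (ZM M) (fun _ => P) P')
    (hZM : ∀ᵐ ω ∂P', Tendsto (fun M => ZM M ω) atTop (𝓝 (Z ω)))
    (happ : ∀ θ > (0 : ℝ), ∀ ρ > (0 : ℝ), ∀ᶠ M in atTop, ∀ᶠ n in atTop, ∃ B : Set Ω,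
      P B ≤ ENNReal.ofReal ρ ∧ ∀ᵐ ω ∂P, ω ∉ B → edist (Y n ω) (YM M n ω) ≤ ENNReal.ofReal θ) :
    TendstoInDistribution Y atTop Z (fun _ => P) P' := by
  refine ⟨hY, hZ, ?_⟩
  refine tendsto_iff_forall_lipschitz_integral_tendsto.2 ?_
  rintro f ⟨K, hK⟩ ⟨L, hL⟩
  have hfm : Measurable f := hL.continuous.measurable
  have hZf := tendsto_iff_forall_lipschitz_integral_tendsto.1
    (tendstoInDistribution_of_ae_tendsto (fun M => (hM M).aemeasurable_limit) hZ hZM).tendsto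
    f ⟨K, hK⟩ ⟨L, hL⟩
  simp only [ProbabilityMeasure.coe_mk] at hZf ⊢
  have hobs : Nonempty E := by
    obtain ⟨ω⟩ := nonempty_of_isProbabilityMeasure P
    exact ⟨Y 0 ω⟩
  obtain ⟨x₀⟩ := hobs
  have hK0 : 0 ≤ K := dist_nonneg.trans (hK x₀ x₀)
  have hbound : ∀ x, ‖f x‖ ≤ ‖f x₀‖ + K := fun x => by
    have := hK x x₀
    rw [dist_eq_norm] at this
    linarith [norm_sub_norm_le (f x) (f x₀)]
  have hint : ∀ {g : Ω → E}, AEMeasurable g P → Integrable (fun ω => f (g ω)) P := fun hg =>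
    Integrable.of_bound (hfm.comp_aemeasurable hg).aestronglyMeasurable (‖f x₀‖ + K)
      (ae_of_all _ fun _ => hbound _)
  rw [Metric.tendsto_atTop']
  intro e he
  have hθ : 0 < e / (3 * (L + 1)) := by positivity
  have hρ : 0 < e / (3 * (K + 1)) := by positivity
  obtain ⟨M, hMn, hMZ⟩ := ((happ _ hθ _ hρ).and
    (Metric.tendsto_nhds.1 hZf (e / 4) (by positivity))).exists
  have hYf := tendsto_iff_forall_lipschitz_integral_tendsto.1 (hM M).tendsto f ⟨K, hK⟩ ⟨L, hL⟩
  simp only [ProbabilityMeasure.coe_mk] at hYf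
  have hev : ∀ᶠ n in atTop, dist (∫ x, f x ∂(P.map (Y n))) (∫ x, f x ∂(P'.map Z)) < e := by
    filter_upwards [hMn, Metric.tendsto_nhds.1 hYf (e / 12) (by positivity)] with n hn hn'
    obtain ⟨B, hB, hB'⟩ := hn
    have hYM := (hM M).forall_aemeasurable n
    have hmain : dist (∫ x, f x ∂(P.map (Y n))) (∫ x, f x ∂(P.map (YM M n))) ≤ 2 * e / 3 := by
      rw [integral_map (hY n) hfm.aestronglyMeasurable,
        integral_map hYM hfm.aestronglyMeasurable, dist_eq_norm,
        ← integral_sub (hint (hY n)) (hint hYM)]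
      set B' := toMeasurable P B with hB'def
      have hB'm : MeasurableSet B' := measurableSet_toMeasurable P B
      have hPB' : P.real B' ≤ e / (3 * (K + 1)) := by
        rw [Measure.real, hB'def, measure_toMeasurable]
        exact ENNReal.toReal_le_of_le_ofReal hρ.le hB
      have hb : ∀ᵐ ω ∂P, ‖f (Y n ω) - f (YM M n ω)‖ ≤
          L * (e / (3 * (L + 1))) + B'.indicator (fun _ => K) ω := by
        filter_upwards [hB'] with ω hω
        by_cases hωB : ω ∈ B'
        · rw [Set.indicator_of_mem hωB, ← dist_eq_norm]
          exact (hK _ _).trans (le_add_of_nonneg_left (by positivity))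
        · rw [Set.indicator_of_notMem hωB, add_zero, ← dist_eq_norm]
          have h1 := hω fun h => hωB (subset_toMeasurable P B h)
          have h2 := (hL (Y n ω) (YM M n ω)).trans (mul_le_mul_right h1 _)
          rw [edist_dist, ← ENNReal.ofReal_coe_nnreal,
            ← ENNReal.ofReal_mul (by positivity)] at h2
          exact (ENNReal.ofReal_le_ofReal_iff (by positivity)).1 h2
      have hg : Integrable (fun ω => L * (e / (3 * (L + 1))) + B'.indicator (fun _ => K) ω) P :=
        (integrable_const _).add ((integrable_const K).indicator hB'm)
      refine (norm_integral_le_of_norm_le hg hb).trans ?_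
      rw [integral_add (integrable_const _) ((integrable_const K).indicator hB'm),
        integral_indicator_const _ hB'm]
      simp only [integral_const, probReal_univ, smul_eq_mul, one_mul]
      have h1 : (L : ℝ) * (e / (3 * (L + 1))) ≤ e / 3 := by
        rw [mul_div_assoc', div_le_div_iff₀ (by positivity) (by positivity)]
        nlinarith [L.2]
      have h2 : P.real B' * K ≤ e / 3 := by
        refine (mul_le_mul_of_nonneg_right hPB' hK0).trans ?_
        rw [div_mul_eq_mul_div, div_le_div_iff₀ (by positivity) (by positivity)]
        nlinarith
      linarith
    have h3 := dist_triangle4 (∫ x, f x ∂(P.map (Y n))) (∫ x, f x ∂(P.map (YM M n)))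
      (∫ x, f x ∂(P'.map (ZM M))) (∫ x, f x ∂(P'.map Z))
    linarith
  exact (eventually_atTop.1 hev).imp fun N hN n hn => hN n hn.le

/-! ### Finite-dimensional distributions of fractional Brownian motion -/

/-- The characteristic function of a random vector is determined by its linear combinations. -/
theorem charFun_map_toLp {Ω ι : Type*} [MeasurableSpace Ω] [Fintype ι] {P : Measure Ω}
    {X : ι → Ω → ℝ} (hX : ∀ k, AEMeasurable (X k) P) (w : EuclideanSpace ℝ ι) :
    charFun (P.map fun ω => WithLp.toLp 2 fun k => X k ω) w =
      charFun (P.map fun ω => ∑ k, w k * X k ω) 1 := by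
  have h1 : AEMeasurable (fun ω => WithLp.toLp 2 fun k => X k ω) P :=
    (WithLp.measurable_toLp 2 _).comp_aemeasurable (aemeasurable_pi_lambda _ hX)
  have h2 : AEMeasurable (fun ω => ∑ k, w k * X k ω) P :=
    Finset.aemeasurable_fun_sum _ fun k _ => (hX k).const_mul _
  rw [charFun_apply, charFun_apply, integral_map h1 (by fun_prop), integral_map h2 (by fun_prop)]
  simp [PiLp.inner_apply, mul_comm]

/-- The finite-dimensional distributions of a multiple of fractional Brownian motion, through the
characteristic functions of its linear combinations. -/
theorem IsFractionalBrownianMotion.charFun_sum {Ω ι : Type*} [MeasurableSpace Ω] [Fintype ι]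
    {P : Measure Ω} [IsProbabilityMeasure P] {H : ℝ} {W : Ω → SkorokhodD}
    (hW : IsFractionalBrownianMotion H W P) (c : ℝ) (w : ι → ℝ) (t : ι → I) :
    charFun (P.map fun ω => ∑ k, w k * (c * W ω (t k))) 1 =
      Complex.exp (-(((c ^ 2 * ∑ j, ∑ k, w j * w k *
        (((t j : ℝ) ^ (2 * H) + (t k : ℝ) ^ (2 * H) - |(t j : ℝ) - t k| ^ (2 * H)) / 2)) / 2 : ℝ) :
          ℂ)) := by
  have hG : IsGaussianProcess (fun k ω => W ω (t k)) P := hW.gaussian.comp_right t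
  have hG' : IsGaussianProcess (fun k ω => w k * (c * W ω (t k))) P := by
    simpa [mul_assoc] using hG.smul (fun k => w k * c)
  have hL2 : ∀ k, MemLp (fun ω => W ω (t k)) 2 P := fun k => (hG.hasGaussianLaw_eval k).memLp_two
  have hL2' : ∀ k, MemLp (fun ω => w k * (c * W ω (t k))) 2 P := fun k =>
    ((hL2 k).const_mul c).const_mul (w k)
  have hsum : HasGaussianLaw (fun ω => ∑ k, w k * (c * W ω (t k))) P := hG'.hasGaussianLaw_fun_sum
  rw [hsum.map_eq_gaussianReal, charFun_gaussianReal]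
  have hmean : ∫ ω, ∑ k, w k * (c * W ω (t k)) ∂P = 0 := by
    rw [integral_finsetSum _ fun k _ => (hL2' k).integrable (by norm_num)]
    refine Finset.sum_eq_zero fun k _ => ?_
    rw [integral_const_mul, integral_const_mul, hW.centered, mul_zero, mul_zero]
  have hvar : Var[fun ω => ∑ k, w k * (c * W ω (t k)); P] = c ^ 2 * ∑ j, ∑ k, w j * w k *
      (((t j : ℝ) ^ (2 * H) + (t k : ℝ) ^ (2 * H) - |(t j : ℝ) - t k| ^ (2 * H)) / 2) := by
    rw [variance_fun_sum hL2', Finset.mul_sum]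
    refine Finset.sum_congr rfl fun j _ => ?_
    rw [Finset.mul_sum]
    refine Finset.sum_congr rfl fun k _ => ?_
    rw [covariance_const_mul_left, covariance_const_mul_left, covariance_const_mul_right,
      covariance_const_mul_right, hW.covariance, abs_sub_comm]
    ring
  rw [hmean, Real.coe_toNNReal _ (variance_nonneg _ _), hvar]
  congr 1
  push_cast
  ring

/-! ### Self-normalization -/

/-- Convergence in probability to a constant is preserved by functions continuous there. -/
theorem TendstoInMeasure.comp_continuousAt_const {Ω : Type*} [MeasurableSpace Ω] {P : Measure Ω}
    {f : ℕ → Ω → ℝ} {c : ℝ} {g : ℝ → ℝ} (h : TendstoInMeasure P f atTop fun _ => c)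
    (hg : ContinuousAt g c) :
    TendstoInMeasure P (fun n ω => g (f n ω)) atTop fun _ => g c := by
  rw [tendstoInMeasure_const_iff] at h ⊢
  intro θ hθ ρ hρ
  obtain ⟨d, hd, hd'⟩ := Metric.continuousAt_iff.1 hg θ hθ
  filter_upwards [h (d / 2) (by positivity) ρ hρ] with n hn
  obtain ⟨B, hB, hB'⟩ := hn
  refine ⟨B, hB, ?_⟩
  filter_upwards [hB'] with ω hω hωB
  exact (hd' (lt_of_le_of_lt (hω hωB) (by linarith))).le

section Standing

variable {Ω : Type*} [MeasurableSpace Ω] {P : Measure Ω} [IsProbabilityMeasure P] {ε : ℤ → Ω → ℝ}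
  {a : ℕ → ℝ} {α δ C : ℝ} {N : ℕ}

theorem IsPotterSequence.tsum_sq_pos (hsm : IsSmallExponent α δ)
    (ha : IsPotterSequence a α δ C N) : 0 < ∑' i, a i ^ 2 :=
  (ha.summable_sq hsm.pos hsm.le_alpha hsm.add_lt_one hsm.one_lt_sq).tsum_pos
    (fun _ => sq_nonneg _) N (pow_pos (ha.pos N le_rfl) 2)

/-- The ratio of the deterministic and the random normalizations of the partial sums. -/
noncomputable def normRatio (a : ℕ → ℝ) (ε : ℤ → Ω → ℝ) (P : Measure Ω) (n : ℕ) (ω : Ω) : ℝ :=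
  (√(1 / ((n : ℝ) * truncVar (truncSecondMoment (ε 0) P) n) * linearSqSum a ε n ω))⁻¹

namespace IsCenteredDANInnovation

variable (hε : IsCenteredDANInnovation ε P)

include hε

theorem aemeasurable_linearSqSum (hsm : IsSmallExponent α δ) (ha : IsPotterSequence a α δ C N)
    (n : ℕ) : AEMeasurable (linearSqSum a ε n) P :=
  Finset.aemeasurable_fun_sum _ fun _ _ =>
    (hε.aemeasurable_linearProcess hsm ha (fun _ => le_rfl) _).pow_const 2

theorem aemeasurable_normRatio (hsm : IsSmallExponent α δ) (ha : IsPotterSequence a α δ C N)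
    (n : ℕ) : AEMeasurable (normRatio a ε P n) P :=
  ((hε.aemeasurable_linearSqSum hsm ha n).const_mul _).sqrt.inv

theorem tendstoInMeasure_normRatio (hsm : IsSmallExponent α δ) (ha : IsPotterSequence a α δ C N) :
    TendstoInMeasure P (normRatio a ε P) atTop fun _ => (√(∑' i, a i ^ 2))⁻¹ :=
  TendstoInMeasure.comp_continuousAt_const (g := fun x => (√x)⁻¹)
    (hε.tendstoInMeasure_linearSqSum hsm ha)
    (Real.continuous_sqrt.continuousAt.inv₀ (Real.sqrt_pos.2 (ha.tsum_sq_pos hsm)).ne')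

/-- Replacing the deterministic normalization by the random one amounts to multiplying by
`normRatio`. -/
theorem eventually_div_eq_normRatio_mul (a : ℕ → ℝ) :
    ∀ᶠ n : ℕ in atTop, ∀ (ω : Ω) (x : ℝ), x / (n * a n * √(linearSqSum a ε n ω)) =
      normRatio a ε P n ω * (x / (n * a n * innovationScale ε P n)) := by
  filter_upwards [hε.eventually_innovationScale] with n hn ω x
  obtain ⟨hn0, hl, -⟩ := hn
  have hn0 : (0 : ℝ) < n := by exact_mod_cast hn0
  have hnl : 0 < √((n : ℝ) * truncVar (truncSecondMoment (ε 0) P) n) := by positivity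
  unfold normRatio innovationScale
  rw [Real.sqrt_mul (by positivity), one_div, Real.sqrt_inv, mul_inv, inv_inv, div_eq_mul_inv,
    div_eq_mul_inv, mul_inv, mul_inv (_ * a n) (√(_ * truncVar _ _))]
  field_simp

/-- The self-normalized central limit theorem. -/
theorem tendstoInDistribution_linearSum (hsm : IsSmallExponent α δ)
    (ha : IsPotterSequence a α δ C N) (hα : α < 1) :
    TendstoInDistribution
      (fun (n : ℕ) ω => linearSum a ε n ω / ((n : ℝ) * a n * √(linearSqSum a ε n ω)))
      atTop (id : ℝ → ℝ) (fun _ => P)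
      (gaussianReal 0 (cAlpha α / ∑' i, a i ^ 2).toNNReal) := by
  set A2 := ∑' i, a i ^ 2 with hA2
  have hA : 0 < A2 := ha.tsum_sq_pos hsm
  have hm : ∀ n, AEMeasurable
      (fun ω => linearSum a ε n ω / (n * a n * innovationScale ε P n)) P := fun n =>
    (hε.aemeasurable_linearSum hsm ha n).div_const _
  have hc := cAlpha_nonneg α
  -- The limit law is realized as that of `x ↦ √A2 * x`: dividing by `√A2` leaves the identity.
  have h1 : TendstoInDistribution
      (fun (n : ℕ) ω => linearSum a ε n ω / (n * a n * innovationScale ε P n)) atTop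
      (fun x : ℝ => √A2 * x) (fun _ => P) (gaussianReal 0 (cAlpha α / A2).toNNReal) := by
    refine ⟨hm, by fun_prop, ProbabilityMeasure.tendsto_iff_tendsto_charFun.2 fun w => ?_⟩
    simp only [ProbabilityMeasure.coe_mk]
    rw [gaussianReal_map_const_mul, charFun_gaussianReal]
    have h2 := hε.tendsto_charFun_linearSum hsm ha (fun _ : Unit => w) (m := fun n _ => n)
      (t := fun _ => 1) (fun n _ => le_rfl) (fun _ => by
        refine tendsto_const_nhds.congr' ?_
        filter_upwards [eventually_gt_atTop 0] with n hn
        rw [div_self (by positivity)])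
    rw [ha.integral_sq_sum_fbmKernel hsm _ (fun _ => zero_le_one) (fun _ => le_rfl)] at h2
    have hexp : (3 - 2 * α) ≠ 0 := by linarith
    refine (h2.congr fun n => ?_).trans_eq ?_
    · simp only [Finset.univ_unique, Finset.sum_singleton]
      rw [← mul_one w, ← charFun_map_mul_comp (hm n)]
      simp only [mul_one, mul_div_assoc]
    · congr 2
      simp only [Finset.univ_unique, Finset.sum_singleton, Real.one_rpow, sub_self, abs_zero,
        Real.zero_rpow hexp]
      rw [NNReal.coe_mul, NNReal.coe_mk, Real.coe_toNNReal _ (by positivity), Real.sq_sqrt hA.le,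
        mul_div_cancel₀ _ hA.ne']
      push_cast
      ring
  have h3 := h1.continuous_comp_prodMk_of_tendstoInMeasure_const
    (g := fun p : ℝ × ℝ => p.2 * p.1) (by fun_prop) (hε.tendstoInMeasure_normRatio hsm ha)
    (hε.aemeasurable_normRatio hsm ha)
  refine ⟨fun n => (hε.aemeasurable_linearSum hsm ha n).div
    ((hε.aemeasurable_linearSqSum hsm ha n).sqrt.const_mul _), aemeasurable_id, ?_⟩
  have hlim : (fun x : ℝ => (√A2)⁻¹ * (√A2 * x)) = id := by
    funext x
    rw [inv_mul_cancel_left₀ (Real.sqrt_pos.2 hA).ne', id]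
  have h4 := h3.congr (fun _ => EventuallyEq.rfl) (EventuallyEq.of_eq hlim)
  refine h4.tendsto.congr' ?_
  filter_upwards [hε.eventually_div_eq_normRatio_mul a] with n hn
  simp only [hn]
  rfl

/-- The self-normalized invariance principle. -/
theorem tendstoInDistribution_stepPath (hsm : IsSmallExponent α δ)
    (ha : IsPotterSequence a α δ C N) {Ω' : Type*} [MeasurableSpace Ω'] {P' : Measure Ω'}
    [IsProbabilityMeasure P'] {W : Ω' → SkorokhodD}
    (hW : IsFractionalBrownianMotion (3 / 2 - α) W P') :
    TendstoInDistribution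
      (fun (n : ℕ) ω => SkorokhodD.stepPath
        (fun m => linearSum a ε m ω / ((n : ℝ) * a n * √(linearSqSum a ε n ω))) n)
      atTop (fun ω' => (√(cAlpha α) / √(∑' i, a i ^ 2)) • W ω') (fun _ => P) P' := by
  set A2 := ∑' i, a i ^ 2 with hA2
  have hc := cAlpha_nonneg α
  have hmS : ∀ n m, AEMeasurable
      (fun ω => linearSum a ε m ω / (n * a n * innovationScale ε P n)) P := fun n m =>
    (hε.aemeasurable_linearSum hsm ha m).div_const _
  have hmW : ∀ t : I, AEMeasurable (fun ω => W ω t) P' := fun t => hW.gaussian.aemeasurable t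
  have hfdd : ∀ M : ℕ, TendstoInDistribution
      (fun (n : ℕ) ω => (WithLp.toLp 2 fun k : Fin (M + 1) =>
        linearSum a ε (n * k / M) ω / (n * a n * innovationScale ε P n) :
          EuclideanSpace ℝ (Fin (M + 1)))) atTop
      (fun ω' => WithLp.toLp 2 fun k : Fin (M + 1) =>
        √(cAlpha α) * W ω' (SkorokhodD.gridPoint M k)) (fun _ => P) P' := by
    intro M
    refine ⟨fun n => (WithLp.measurable_toLp 2 _).comp_aemeasurable
      (aemeasurable_pi_lambda _ fun k => hmS n _), (WithLp.measurable_toLp 2 _).comp_aemeasurable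
      (aemeasurable_pi_lambda _ fun k => (hmW _).const_mul _),
      ProbabilityMeasure.tendsto_iff_tendsto_charFun.2 fun w => ?_⟩
    simp only [ProbabilityMeasure.coe_mk]
    rw [charFun_map_toLp fun k => (hmW _).const_mul _, hW.charFun_sum]
    have h2 := hε.tendsto_charFun_linearSum hsm ha (ι := Fin (M + 1)) (fun k => w k)
      (m := fun n k => n * k / M) (t := fun k => (SkorokhodD.gridPoint M k : ℝ)) ?_ ?_
    · rw [ha.integral_sq_sum_fbmKernel hsm (ι := Fin (M + 1)) (fun k => w k)
        (t := fun k => (SkorokhodD.gridPoint M k : ℝ)) (fun k => (SkorokhodD.gridPoint M k).2.1)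
        (fun k => (SkorokhodD.gridPoint M k).2.2)] at h2
      refine (h2.congr fun n => ?_).trans_eq ?_
      · rw [charFun_map_toLp fun k => hmS n _]
        simp only [mul_div_assoc, Finset.sum_div]
      · rw [Real.sq_sqrt hc, show 2 * (3 / 2 - α) = 3 - 2 * α by ring]
    · intro n k
      exact Nat.div_le_of_le_mul ((Nat.mul_le_mul_left n (Nat.lt_succ_iff.1 k.2)).trans_eq
        (mul_comm n M))
    · intro k
      rw [SkorokhodD.coe_gridPoint (Nat.lt_succ_iff.1 k.2)]
      rcases Nat.eq_zero_or_pos M with rfl | hM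
      · simp
      have h3 := (tendsto_nat_floor_mul_div_atTop (R := ℝ) (a := (k : ℝ) / M)
        (by positivity)).comp (tendsto_natCast_atTop_atTop (R := ℝ))
      refine h3.congr fun n => ?_
      simp only [Function.comp]
      rw [div_mul_eq_mul_div, mul_comm, ← Nat.cast_mul, Nat.floor_div_natCast, Nat.floor_natCast]
  set r := √(cAlpha α) / √A2 with hr
  refine tendstoInDistribution_of_approx
    (YM := fun M n ω => SkorokhodD.finStepPath M fun k => normRatio a ε P n ω *
      (linearSum a ε (n * k / M) ω / (n * a n * innovationScale ε P n)))
    (ZM := fun M ω' => SkorokhodD.finStepPath M fun k => (√A2)⁻¹ *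
      (√(cAlpha α) * W ω' (SkorokhodD.gridPoint M k)))
    (fun n => SkorokhodD.aemeasurable_stepPath (fun m => (hε.aemeasurable_linearSum hsm ha m).div
      ((hε.aemeasurable_linearSqSum hsm ha n).sqrt.const_mul _)) n)
    (((SkorokhodD.continuous_const_smul r).measurable.comp hW.measurable).aemeasurable) ?_ ?_ ?_
  · intro M
    refine (hfdd M).continuous_comp_prodMk_of_tendstoInMeasure_const
      (g := fun p : EuclideanSpace ℝ (Fin (M + 1)) × ℝ =>
        SkorokhodD.finStepPath M fun k => p.2 * p.1 k)
      ((SkorokhodD.continuous_finStepPath M).comp (by fun_prop))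
      (hε.tendstoInMeasure_normRatio hsm ha) (hε.aemeasurable_normRatio hsm ha)
  · filter_upwards [hW.continuous_paths] with ω hω
    have h1 : Continuous (r • W ω).toFun := hω.const_mul r
    refine (SkorokhodD.tendsto_stepPath_gridPoint h1).congr fun M => ?_
    rw [SkorokhodD.stepPath_eq_finStepPath]
    congr 1
    funext k
    change r * W ω _ = _
    rw [hr]
    ring
  · intro θ hθ ρ hρ
    -- With high probability the ratio of the normalizations is at most `K`, and the modulus of
    -- continuity of the partial sums controls the distance to the discretized path.
    set K := (√A2)⁻¹ + 1 with hK
    have hK0 : 0 < K := by positivity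
    filter_upwards [hε.eventually_modulus_le hsm ha (div_pos hθ hK0) (half_pos hρ),
      eventually_gt_atTop 0] with M hM hM0
    filter_upwards [hM, tendstoInMeasure_const_iff.1 (hε.tendstoInMeasure_normRatio hsm ha) 1
      one_pos _ (half_pos hρ), hε.eventually_div_eq_normRatio_mul a, hε.eventually_innovationScale,
      eventually_ge_atTop N] with n hn hn' hrw hsc hnN
    obtain ⟨B, hB, hB'⟩ := hn
    obtain ⟨D, hD, hD'⟩ := hn'
    refine ⟨B ∪ D, ?_, ?_⟩
    · refine (measure_union_le B D).trans ((add_le_add hB hD).trans ?_)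
      rw [← ENNReal.ofReal_add (by positivity) (by positivity), add_halves]
    filter_upwards [hB', hD'] with ω hω hω' hωBD
    rw [Set.mem_union, not_or] at hωBD
    have hmod := hω hωBD.1
    have hR : normRatio a ε P n ω ≤ K := by
      have := (abs_le.1 (hω' hωBD.2)).2
      linarith
    have hR0 : 0 ≤ normRatio a ε P n ω := inv_nonneg.2 (Real.sqrt_nonneg _)
    have hn0 : (0 : ℝ) < n := hsc.1
    have hl := hsc.2.1
    have hq : 0 < n * a n * innovationScale ε P n :=
      mul_pos (mul_pos hn0 (ha.pos n hnN)) (Real.sqrt_pos.2 (mul_pos hn0 hl))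
    simp only [hrw]
    rw [← SkorokhodD.stepPath_eq_finStepPath (fun j => normRatio a ε P n ω *
      (linearSum a ε (n * j / M) ω / (n * a n * innovationScale ε P n)))]
    refine SkorokhodD.edist_stepPath_stepPath_le (y := fun m => normRatio a ε P n ω *
      (linearSum a ε m ω / (n * a n * innovationScale ε P n))) hM0 fun j hj k h1 h2 h3 => ?_
    have h4 := hmod j hj k h1 h2 h3
    rw [← mul_sub, ← sub_div, abs_mul, abs_of_nonneg hR0, abs_div, abs_of_pos hq]
    calc _ ≤ K * (θ / K) := mul_le_mul hR ((div_le_iff₀ hq).2 h4) (by positivity) hK0.le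
      _ = θ := mul_div_cancel₀ _ hK0.ne'

end IsCenteredDANInnovation

end Standing
theorem theorem2 {Ω : Type*} [MeasurableSpace Ω] (P : Measure Ω) [IsProbabilityMeasure P]
    (ε : ℤ → Ω → ℝ) (hε : IsCenteredDANInnovation ε P)
    (α : ℝ) (hα : 1 / 2 < α) (hα' : α < 1)
    (L : ℕ → ℝ) (hL : IsStronglySlowlyVaryingSeq L)
    (a : ℕ → ℝ) (ha : ∀ n : ℕ, 1 ≤ n → a n = (n : ℝ) ^ (-α) * L n) :
    -- the linear process is well defined and `A² = ∑ a_i²` is finite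
    (∀ k : ℤ, ∀ᵐ ω ∂P,
      Tendsto (fun N => linearProcessPartial a ε k N ω) atTop (𝓝 (linearProcess a ε k ω))) ∧
    Summable (fun i => a i ^ 2) ∧
    -- the weak law of large numbers for the squares
    TendstoInMeasure P
      (fun (n : ℕ) ω => 1 / ((n : ℝ) * truncVar (truncSecondMoment (ε 0) P) n) *
        linearSqSum a ε n ω)
      atTop (fun _ => ∑' i, a i ^ 2) ∧
    -- the self-normalized invariance principle in `D[0,1]`
    (∀ {Ω' : Type*} [MeasurableSpace Ω'] (P' : Measure Ω') [IsProbabilityMeasure P']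
      (W : Ω' → SkorokhodD), IsFractionalBrownianMotion (3 / 2 - α) W P' →
      TendstoInDistribution
        (fun (n : ℕ) ω => SkorokhodD.stepPath
          (fun m => linearSum a ε m ω / ((n : ℝ) * a n * √(linearSqSum a ε n ω))) n)
        atTop (fun ω' => (√(cAlpha α) / √(∑' i, a i ^ 2)) • W ω') (fun _ => P) P') ∧
    -- the self-normalized central limit theorem
    TendstoInDistribution
      (fun (n : ℕ) ω => linearSum a ε n ω / ((n : ℝ) * a n * √(linearSqSum a ε n ω)))
      atTop (id : ℝ → ℝ) (fun _ => P)
      (gaussianReal 0 (cAlpha α / ∑' i, a i ^ 2).toNNReal) := by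
  obtain ⟨δ, hsm⟩ := exists_isSmallExponent hα hα'
  obtain ⟨C, N, hP⟩ := exists_isPotterSequence hsm.pos (by linarith [hsm.pos, hsm.lower]) hα' hL ha
  exact ⟨hε.ae_tendsto_linearProcess hsm hP fun _ => le_rfl,
    hP.summable_sq hsm.pos hsm.le_alpha hsm.add_lt_one hsm.one_lt_sq,
    hε.tendstoInMeasure_linearSqSum hsm hP,
    fun _ _ _ hW => hε.tendstoInDistribution_stepPath hsm hP hW,
    hε.tendstoInDistribution_linearSum hsm hP hα'⟩
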